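/- **Setting.** Manifolds are finite-dimensional, real, smooth and without boundary. Let $(G,\pi_G)$ be a connected, simply connected Poisson Lie group with Lie algebra $\mathfrak g$, and let $(G^*,\pi_{G^*})$ be its dual: the connected, simply connected Poisson Lie group with Lie algebra $\mathfrak g^*$, such that $\langle[x,y]_*,\xi\rangle=d_e\big(\pi_G(\bar x,\bar y)\big)(\xi)$ for $x,y\in\mathfrak g^*$, $\xi\in\mathfrak g$, and $\langle x,[\xi,\eta]\rangle=d_e\big(\pi_{G^*}(\theta_\xi,\theta_\eta)\big)(x)$. Here $\bar x$ is the left-invariant 1-form on $G$ with value $x$ at $e$, and $\theta_\xi$ is the left-invariant 1-form on $G^*$ with value $\xi\in\mathfrak g=(T_eG^*)^*$ at $e$. For $x\in\mathfrak g^*$ define $ad^*_x$ on $\mathfrak g$ by $\langle y,ad^*_x\xi\rangle=-\langle[x,y]_*,\xi\rangle$. Let $(M,\pi)$ be a Poisson manifold, $\langle\pi^\sharp(\alpha),\beta\rangle=\pi(\alpha,\beta)$, $\{f,g\}=\pi(df,dg)$, with a Poisson action of $(G,\pi_G)$: a smooth left action for which $G\times M\to M$ is a Poisson map. Put $\xi_M(m)=\frac{d}{dt}\big|_{0}\exp(-t\xi)\cdot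 m$ and $\mathcal L_\xi f=\xi_M f$; for a map $\zeta:M\to\mathfrak g$ write $(\mathcal L_\zeta f)(m)=(\mathcal L_{\zeta(m)}f)(m)$. A *momentum map* is a smooth map $\mu:M\to G^*$ with $\xi_M=\pi^\sharp(\mu^*\theta_\xi)$ for all $\xi\in\mathfrak g$. **Theorem.** Let $\epsilon>0$ and let $\mu_t:M\to G^*$, $t\in[-\epsilon,\epsilon]$, be momentum maps for this action such that $(t,m)\mapsto\mu_t(m)$ is of class $C^2$ (for instance smooth). Let $X:M\to\mathfrak g^*$ be a smooth map with $\mu_t(m)=\mu_0(m)\exp(tX_m)+o(t)$ as $t\to0$, for every $m\in M$, and write $X(\xi)(m)=\langle X_m,\xi\rangle$. Then: 1. $\{X(\xi),\cdot\,\}=-\mathcal L_{ad^*_X\xi}$ on $C^\infty(M)$, for all $\xi\in\mathfrak g$. 2. If all $\mu_t$ are moreover Poisson maps (equivariant momentum maps), then $\mathcal L_\xi X(\eta)-\mathcal L_\eta X(\xi)=X([\xi,\eta])$ for all $\xi,\eta\in\mathfrak g$. Hence $X$ belongs to the vector space $\mathcal T$ of all smooth maps $Y:M\to\mathfrak g^*$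 that satisfy both identities, with $Y$ in place of $X$. 3. For $Y\in\mathcal T$ let $[Y]\in H^1(\mathfrak g,C^\infty(M))$ be the class of the 1-cocycle $\xi\mapsto Y(\xi)$. Then $[Y]=0$ if and only if there is $\Phi\in C^\infty(M)$ with $Y(\xi)=\mathcal L_\xi\Phi$ for all $\xi$ and such that the vector field $W=-\pi^\sharp(d\Phi)$ commutes with $\pi$ and with all $\xi_M$ and generates $Y$, i.e. $Y(\xi)=\langle\mu_0^*\theta_\xi,W\rangle$ for all $\xi$. So, modulo these trivial infinitesimal deformations, $\mathcal T$ is a subspace of $H^1(\mathfrak g,C^\infty(M))$. 4. If $G$ is compact and $\mathfrak g$ is semisimple, then every $Y\in\mathcal T$ is trivial in the sense of 3. -/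

import Mathlib

open Set Filter Topology Asymptotics
open scoped Manifold ContDiff

noncomputable section

namespace PoissonLie

/-! ### Bivector fields and Poisson structures -/

section Bivector

variable {E H M : Type*} [NormedAddCommGroup E] [NormedSpace ℝ E] [TopologicalSpace H]
  [TopologicalSpace M] [ChartedSpace H M]
  {E' H' M' : Type*} [NormedAddCommGroup E'] [NormedSpace ℝ E'] [TopologicalSpace H']
  [TopologicalSpace M'] [ChartedSpace H' M']

/-- The cotangent space of `M` at `m`. -/
abbrev Cotangent (I : ModelWithCorners ℝ E H) {M : Type*} [TopologicalSpace M] [ChartedSpace H M]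
    (m : M) : Type _ := Module.Dual ℝ (TangentSpace I m)

/-- The differential `df_m` of a real function, as a covector at `m`. -/
def dAt (I : ModelWithCorners ℝ E H) (f : M → ℝ) (m : M) : Cotangent I m :=
  (mfderiv I 𝓘(ℝ, ℝ) f m).toLinearMap

/-- The function `V f`, for a vector field `V` and a real function `f`. -/
def vfApply (I : ModelWithCorners ℝ E H) (V : ∀ m : M, TangentSpace I m) (f : M → ℝ) : M → ℝ :=
  fun m => dAt I f m (V m)

/-- The pullback `φ^* a` of a covector at `φ m` to a covector at `m`. -/
def pullCov (I : ModelWithCorners ℝ E H) (I' : ModelWithCorners ℝ E' H') (φ : M → M') (m : M)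
    (a : Cotangent I' (φ m)) : Cotangent I m :=
  a ∘ₗ (mfderiv I I' φ m).toLinearMap

/-- A (not necessarily smooth) bivector field `π` on `M`, given by the skew-symmetric linear maps
`π♯(m) : T_m^* M → T_m M`; so `π(m)(a, b) = b (π♯(m) a)`. -/
structure BivectorField (I : ModelWithCorners ℝ E H) (M : Type*) [TopologicalSpace M]
    [ChartedSpace H M] where
  sharp : ∀ m : M, Cotangent I m →ₗ[ℝ] TangentSpace I m
  alternating : ∀ (m : M) (a : Cotangent I m), a (sharp m a) = 0

variable {I : ModelWithCorners ℝ E H} {I' : ModelWithCorners ℝ E' H'}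

/-- The bracket `{f, g} = π(df, dg)`. -/
def BivectorField.bracket (π : BivectorField I M) (f g : M → ℝ) : M → ℝ :=
  fun m => dAt I g m (π.sharp m (dAt I f m))

/-- `π` is a (smooth) Poisson bivector field. -/
structure BivectorField.IsPoisson (π : BivectorField I M) : Prop where
  smooth : ∀ f g : M → ℝ, ContMDiff I 𝓘(ℝ, ℝ) ∞ f → ContMDiff I 𝓘(ℝ, ℝ) ∞ g →
    ContMDiff I 𝓘(ℝ, ℝ) ∞ (π.bracket f g)
  jacobi : ∀ f g h : M → ℝ, ContMDiff I 𝓘(ℝ, ℝ) ∞ f → ContMDiff I 𝓘(ℝ, ℝ) ∞ g →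
    ContMDiff I 𝓘(ℝ, ℝ) ∞ h → ∀ m : M,
    π.bracket f (π.bracket g h) m + π.bracket g (π.bracket h f) m
      + π.bracket h (π.bracket f g) m = 0

/-- The product bivector field `π₁ ⊕ π₂` on `M × M'`. -/
def BivectorField.prod (π₁ : BivectorField I M) (π₂ : BivectorField I' M') :
    BivectorField (I.prod I') (M × M') where
  sharp p :=
    { toFun := fun a : Module.Dual ℝ (E × E') =>
        ((π₁.sharp p.1 (a ∘ₗ LinearMap.inl ℝ E E'), π₂.sharp p.2 (a ∘ₗ LinearMap.inr ℝ E E')) :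
          E × E')
      map_add' := fun a b => Prod.ext
        ((π₁.sharp p.1).map_add (a ∘ₗ LinearMap.inl ℝ E E') (b ∘ₗ LinearMap.inl ℝ E E'))
        ((π₂.sharp p.2).map_add (a ∘ₗ LinearMap.inr ℝ E E') (b ∘ₗ LinearMap.inr ℝ E E'))
      map_smul' := fun c a => Prod.ext
        ((π₁.sharp p.1).map_smul c (a ∘ₗ LinearMap.inl ℝ E E'))
        ((π₂.sharp p.2).map_smul c (a ∘ₗ LinearMap.inr ℝ E E')) }
  alternating p := fun a : Module.Dual ℝ (E × E') => by
    have h₁ : a (π₁.sharp p.1 (a ∘ₗ LinearMap.inl ℝ E E'), (0 : E')) = 0 :=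
      π₁.alternating p.1 (a ∘ₗ LinearMap.inl ℝ E E')
    have h₂ : a ((0 : E), π₂.sharp p.2 (a ∘ₗ LinearMap.inr ℝ E E')) = 0 :=
      π₂.alternating p.2 (a ∘ₗ LinearMap.inr ℝ E E')
    have h := a.map_add (π₁.sharp p.1 (a ∘ₗ LinearMap.inl ℝ E E'), (0 : E'))
      ((0 : E), π₂.sharp p.2 (a ∘ₗ LinearMap.inr ℝ E E'))
    rw [h₁, h₂, add_zero] at h
    have e : ∀ (u : E) (v : E'), ((u, v) : E × E') = (u, 0) + (0, v) := by simp
    exact (congrArg a (e _ _)).trans h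

/-- `φ : (M, π) → (M', π')` is a Poisson mapping. -/
def IsPoissonMap (π : BivectorField I M) (π' : BivectorField I' M') (φ : M → M') : Prop :=
  ContMDiff I I' ∞ φ ∧
  ∀ f g : M' → ℝ, ContMDiff I' 𝓘(ℝ, ℝ) ∞ f → ContMDiff I' 𝓘(ℝ, ℝ) ∞ g →
    π.bracket (f ∘ φ) (g ∘ φ) = π'.bracket f g ∘ φ

end Bivector

/-! ### Lie groups: invariant forms, the exponential map, Poisson structures -/

section LieGroups

variable {E H G : Type*} [NormedAddCommGroup E] [NormedSpace ℝ E] [TopologicalSpace H]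
  [TopologicalSpace G] [ChartedSpace H G] [Group G]

/-- A smooth Lie group has the regularity for which its Lie algebra is defined in the library. -/
instance lieGroup_minSmoothness (I : ModelWithCorners ℝ E H) (G : Type*) [TopologicalSpace G]
    [ChartedSpace H G] [Group G] [LieGroup I ∞ G] : LieGroup I (minSmoothness ℝ 3) G :=
  LieGroup.of_le (n := ∞) (by
    rw [minSmoothness_of_isRCLikeNormedField]
    exact ENat.LEInfty.out)

variable {I : ModelWithCorners ℝ E H}

/-- The left-invariant 1-form on `G` with value `a` at the identity. -/
def leftInvForm (a : Module.Dual ℝ (GroupLieAlgebra I G)) (g : G) : Cotangent I g :=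
  LinearMap.comp (M₂ := GroupLieAlgebra I G) a (mfderiv I I (fun h : G => g⁻¹ * h) g).toLinearMap

/-- Left-invariant vector fields on a Lie group are complete: there is an integral curve
`t ↦ exp (t x)` through the identity, defined for all times. -/
theorem exists_integralCurve [CompleteSpace E] [LieGroup I ∞ G] [BoundarylessManifold I G]
    [T2Space G] (x : GroupLieAlgebra I G) :
    ∃ γ : ℝ → G, γ 0 = 1 ∧ IsMIntegralCurve γ (mulInvariantVectorField x) := by
  have hv : ContMDiff I I.tangent 1
      (fun g : G => (⟨g, mulInvariantVectorField x g⟩ : TangentBundle I G)) :=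
    (contMDiff_mulInvariantVectorField x).of_le (by
      rw [minSmoothness_of_isRCLikeNormedField]; norm_num)
  obtain ⟨γ, hγ1, hγ⟩ :=
    exists_isMIntegralCurveAt_of_contMDiffAt_boundaryless 0 (hv.contMDiffAt (x := (1 : G)))
  obtain ⟨ε, hε, hγ⟩ := isMIntegralCurveAt_iff'.mp hγ
  rw [Real.ball_eq_Ioo, zero_sub, zero_add] at hγ
  refine exists_isMIntegralCurve_of_isMIntegralCurveOn hv hε (fun g => ?_) 1
  refine ⟨fun t => g * γ t, by simp [hγ1], fun t ht => ?_⟩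
  have hd : ∀ a b : G, MDifferentiableAt I I (fun h : G => a * h) b := fun a b =>
    (contMDiff_mul_left (I := I) (n := ∞) (a := a)).mdifferentiableAt (by simp)
  have key : mfderiv I I (fun h : G => g * h) (γ t) (mulInvariantVectorField x (γ t))
      = mulInvariantVectorField x (g * γ t) := by
    have h1 := mfderiv_comp (I' := I) (1 : G) (g := fun h : G => g * h)
      (f := fun h : G => γ t * h) (by simpa using hd g (γ t * 1)) (hd (γ t) 1)
    have h2 : (fun h : G => g * h) ∘ (fun h : G => γ t * h) = fun h => g * γ t * h := by
      ext h; simp [mul_assoc]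
    rw [h2] at h1
    have h3 := congrArg (fun L => L x) h1
    simp only [mulInvariantVectorField]
    refine Eq.trans ?_ h3.symm
    have h4 : ∀ (b : G) (w : E), b = γ t →
        (mfderiv I I (fun h : G => g * h) (γ t) : E → E) w
          = (mfderiv I I (fun h : G => g * h) b : E → E) w := by
      rintro b w rfl; rfl
    exact h4 _ _ (mul_one _)
  have hc := (hd g (γ t)).hasMFDerivAt.comp_hasMFDerivWithinAt t (hγ t ht)
  have he : ContinuousLinearMap.comp (mfderiv I I (fun h : G => g * h) (γ t))
      ((1 : ℝ →L[ℝ] ℝ).smulRight (mulInvariantVectorField x (γ t)))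
      = (1 : ℝ →L[ℝ] ℝ).smulRight (mulInvariantVectorField x (g * γ t)) := by
    apply ContinuousLinearMap.ext
    intro r
    exact ((mfderiv I I (fun h : G => g * h) (γ t)).map_smul r
      (mulInvariantVectorField x (γ t))).trans (congrArg (fun w : E => r • w) key)
  exact he ▸ hc

/-- The exponential map of a Lie group: `exp x = γ 1`, where `γ` is the integral curve through the
identity of the left-invariant vector field defined by `x`. -/
def lieExp [CompleteSpace E] [LieGroup I ∞ G] [BoundarylessManifold I G] [T2Space G]
    (x : GroupLieAlgebra I G) : G :=
  (exists_integralCurve x).choose 1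

/-- `u(t) = v(t) + o(t)` as `t → 0`, for curves in a manifold with `u(0) = v(0)`: this is read in
the chart at `u(0)`. -/
def EqToFirstOrder (I : ModelWithCorners ℝ E H) (u v : ℝ → G) : Prop :=
  u 0 = v 0 ∧
    (fun t => extChartAt I (u 0) (u t) - extChartAt I (u 0) (v t)) =o[𝓝 0] (fun t : ℝ => t)

/-- `(G, π)` is a Poisson Lie group: `π` is Poisson and multiplicative, that is
`π(gh) = (λ_g)_* π(h) + (ρ_h)_* π(g)`. -/
structure IsPoissonLieGroup (π : BivectorField I G) : Prop where
  poisson : π.IsPoisson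
  multiplicative : ∀ (g h : G) (a : Cotangent I (g * h)),
    π.sharp (g * h) a =
      mfderiv I I (fun k : G => g * k) h (π.sharp h (pullCov I I (fun k : G => g * k) h a))
      + mfderiv I I (fun k : G => k * h) g (π.sharp g (pullCov I I (fun k : G => k * h) g a))

/-- The linearization at the identity: `d_e (π(ā, b̄))`, with `ā`, `b̄` the left-invariant 1-forms
extending `a` and `b`. -/
def linearization (π : BivectorField I G) (a b : Module.Dual ℝ (GroupLieAlgebra I G)) :
    Module.Dual ℝ (GroupLieAlgebra I G) :=
  dAt I (fun g => leftInvForm b g (π.sharp g (leftInvForm a g))) 1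

end LieGroups

/-! ### Dual Poisson Lie groups, Poisson actions and momentum maps -/

section Dual

variable {E H G : Type*} [NormedAddCommGroup E] [NormedSpace ℝ E]
  [TopologicalSpace H] [TopologicalSpace G] [ChartedSpace H G] [Group G]
  {F K Gs : Type*} [NormedAddCommGroup F] [NormedSpace ℝ F]
  [TopologicalSpace K] [TopologicalSpace Gs] [ChartedSpace K Gs] [Group Gs]
  {I : ModelWithCorners ℝ E H} {J : ModelWithCorners ℝ F K}

/-- An element `ξ ∈ 𝔤` seen as a linear form on `𝔤^*`, through an identification `p` of the Lie
algebra of `Gs` with `𝔤^*`. -/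
def toForm (p : GroupLieAlgebra J Gs ≃ₗ[ℝ] Module.Dual ℝ (GroupLieAlgebra I G))
    (ξ : GroupLieAlgebra I G) : Module.Dual ℝ (GroupLieAlgebra J Gs) :=
  Module.Dual.eval ℝ (GroupLieAlgebra I G) ξ ∘ₗ p.toLinearMap

/-- The Lie groups `(G, πG)` and `(Gs, πGs)` with bivector fields are dual to each other, through
the identification `p` of the Lie algebra of `Gs` with `𝔤^*`: the Lie bracket of each of the two
Lie algebras is the linearization at the identity of the bivector field of the other group. -/
structure IsDualPair (πG : BivectorField I G) (πGs : BivectorField J Gs)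
    (p : GroupLieAlgebra J Gs ≃ₗ[ℝ] Module.Dual ℝ (GroupLieAlgebra I G)) : Prop where
  bracket_dual : ∀ (x y : GroupLieAlgebra J Gs) (ξ : GroupLieAlgebra I G),
    p ⁅x, y⁆ ξ = linearization πG (p x) (p y) ξ
  bracket_self : ∀ (ξ η : GroupLieAlgebra I G) (x : GroupLieAlgebra J Gs),
    p x ⁅ξ, η⁆ = linearization πGs (toForm p ξ) (toForm p η) x

/-- The coadjoint action `ad^*_x ξ ∈ 𝔤` of `x ∈ 𝔤^*`, given by `⟨y, ad^*_x ξ⟩ = - ⟨[x, y], ξ⟩`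
for all `y ∈ 𝔤^*`. -/
def coad [FiniteDimensional ℝ E] [CompleteSpace F] [LieGroup J ∞ Gs]
    (p : GroupLieAlgebra J Gs ≃ₗ[ℝ] Module.Dual ℝ (GroupLieAlgebra I G))
    (x : GroupLieAlgebra J Gs) (ξ : GroupLieAlgebra I G) : GroupLieAlgebra I G :=
  haveI : FiniteDimensional ℝ (GroupLieAlgebra I G) := inferInstanceAs (FiniteDimensional ℝ E)
  (Module.evalEquiv ℝ (GroupLieAlgebra I G)).symm
    (-(toForm p ξ ∘ₗ (LieAlgebra.ad ℝ (GroupLieAlgebra J Gs) x) ∘ₗ p.symm.toLinearMap))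

end Dual

set_option linter.unusedSectionVars false

section Action

variable {E H G : Type*} [NormedAddCommGroup E] [NormedSpace ℝ E]
  [TopologicalSpace H] [TopologicalSpace G] [ChartedSpace H G] [Group G]
  {F K Gs : Type*} [NormedAddCommGroup F] [NormedSpace ℝ F]
  [TopologicalSpace K] [TopologicalSpace Gs] [ChartedSpace K Gs] [Group Gs]
  {V N M : Type*} [NormedAddCommGroup V] [NormedSpace ℝ V]
  [TopologicalSpace N] [TopologicalSpace M] [ChartedSpace N M] [MulAction G M]
  (I : ModelWithCorners ℝ E H) (J : ModelWithCorners ℝ F K) (L : ModelWithCorners ℝ V N)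

/-- The infinitesimal generator `ξ_M(m) = d/dt|₀ exp(-tξ) • m`, that is, minus the image of `ξ`
under the differential at the identity of the orbit map `g ↦ g • m`. -/
def infGen (ξ : GroupLieAlgebra I G) (m : M) : TangentSpace L m :=
  -((mfderiv I L (fun g : G => g • m) 1 : E → V) ξ)

variable {I J L}

/-- The smooth action of `(G, πG)` on `(M, π)` is a Poisson action: the action map
`G × M → M` is a Poisson mapping for `πG ⊕ π`. -/
def IsPoissonAction (πG : BivectorField I G) (π : BivectorField L M) : Prop :=
  IsPoissonMap (πG.prod π) π (fun q : G × M => q.1 • q.2)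

/-- The 1-form `α_ξ = μ^* θ_ξ`, where `θ_ξ` is the left-invariant 1-form on `Gs` defined by
`ξ ∈ 𝔤 = (𝔤^*)^*`. -/
def momentForm (L : ModelWithCorners ℝ V N)
    (p : GroupLieAlgebra J Gs ≃ₗ[ℝ] Module.Dual ℝ (GroupLieAlgebra I G))
    (μ : M → Gs) (ξ : GroupLieAlgebra I G) (m : M) : Cotangent L m :=
  pullCov L J μ m (leftInvForm (toForm p ξ) (μ m))

/-- `μ : M → Gs` is a momentum map: it is smooth and `ξ_M = π♯ (μ^* θ_ξ)` for all `ξ ∈ 𝔤`. -/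
structure IsMomentumMap (π : BivectorField L M)
    (p : GroupLieAlgebra J Gs ≃ₗ[ℝ] Module.Dual ℝ (GroupLieAlgebra I G))
    (μ : M → Gs) : Prop where
  smooth : ContMDiff L J ∞ μ
  generates : ∀ (ξ : GroupLieAlgebra I G) (m : M),
    infGen I L ξ m = π.sharp m (momentForm L p μ ξ m)

/-- The Lie derivative `𝓛_ξ f = ξ_M f` of a function along an infinitesimal generator. -/
def lieDer (I : ModelWithCorners ℝ E H) (L : ModelWithCorners ℝ V N)
    (ξ : GroupLieAlgebra I G) (f : M → ℝ) : M → ℝ :=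
  vfApply L (infGen I L ξ) f

/-! ### The first cohomology group `H¹(𝔤, C^∞(M))` -/

/-- `f ↦ df_m` and `f ↦ 𝓛_ξ f` are linear on smooth functions. -/
theorem dAt_add {f g : M → ℝ} (hf : ContMDiff L 𝓘(ℝ, ℝ) ∞ f) (hg : ContMDiff L 𝓘(ℝ, ℝ) ∞ g)
    (m : M) : dAt L (f + g) m = dAt L f m + dAt L g m := by
  have h := mfderiv_add (hf.mdifferentiableAt (by simp) (x := m))
    (hg.mdifferentiableAt (by simp) (x := m))
  exact congrArg (fun T : V →L[ℝ] ℝ => T.toLinearMap) h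

theorem dAt_smul (c : ℝ) {f : M → ℝ} (hf : ContMDiff L 𝓘(ℝ, ℝ) ∞ f) (m : M) :
    dAt L (c • f) m = c • dAt L f m := by
  have h := const_smul_mfderiv (hf.mdifferentiableAt (by simp) (x := m)) c
  exact congrArg (fun T : V →L[ℝ] ℝ => T.toLinearMap) h

theorem dAt_zero (m : M) : dAt L (0 : M → ℝ) m = 0 := by
  have h := mfderiv_const (I := L) (I' := 𝓘(ℝ, ℝ)) (c := (0 : ℝ)) (x := m)
  exact congrArg (fun T : V →L[ℝ] ℝ => T.toLinearMap) h

theorem lieDer_add (ξ : GroupLieAlgebra I G) {f g : M → ℝ} (hf : ContMDiff L 𝓘(ℝ, ℝ) ∞ f)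
    (hg : ContMDiff L 𝓘(ℝ, ℝ) ∞ g) (m : M) :
    lieDer I L ξ (f + g) m = lieDer I L ξ f m + lieDer I L ξ g m := by
  simp [lieDer, vfApply, dAt_add hf hg]

theorem lieDer_smul (ξ : GroupLieAlgebra I G) (c : ℝ) {f : M → ℝ}
    (hf : ContMDiff L 𝓘(ℝ, ℝ) ∞ f) (m : M) :
    lieDer I L ξ (c • f) m = c * lieDer I L ξ f m := by
  simp [lieDer, vfApply, dAt_smul c hf]

theorem lieDer_zero (ξ : GroupLieAlgebra I G) (m : M) :
    lieDer I L ξ (0 : M → ℝ) m = 0 := by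
  simp [lieDer, vfApply, dAt_zero]

/-- `C¹(𝔤, C^∞(M))`: the linear maps `𝔤 → C^∞(M)`. -/
def cochains (I : ModelWithCorners ℝ E H) (G : Type*) [TopologicalSpace G] [ChartedSpace H G]
    [Group G] (L : ModelWithCorners ℝ V N) (M : Type*) [TopologicalSpace M] [ChartedSpace N M] :
    Submodule ℝ (GroupLieAlgebra I G → M → ℝ) where
  carrier := {c | IsLinearMap ℝ c ∧ ∀ ξ, ContMDiff L 𝓘(ℝ, ℝ) ∞ (c ξ)}
  zero_mem' := ⟨⟨fun _ _ => by simp, fun _ _ => by simp⟩, fun _ => contMDiff_const⟩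
  add_mem' := fun {a b} ha hb =>
    ⟨⟨fun ξ η => by simp only [Pi.add_apply, ha.1.map_add, hb.1.map_add]; abel,
      fun r ξ => by simp only [Pi.add_apply, ha.1.map_smul, hb.1.map_smul, smul_add]⟩,
      fun ξ => (ha.2 ξ).add (hb.2 ξ)⟩
  smul_mem' := fun r a ha =>
    ⟨⟨fun ξ η => by simp only [Pi.smul_apply, ha.1.map_add, smul_add],
      fun s ξ => by simp only [Pi.smul_apply, ha.1.map_smul, smul_comm r s]⟩,
      fun ξ => contMDiff_const.mul (ha.2 ξ)⟩

/-- `Z¹(𝔤, C^∞(M))`: the 1-cochains with `𝓛_ξ c(η) - 𝓛_η c(ξ) = c([ξ, η])`. -/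
def cocycles (I : ModelWithCorners ℝ E H) (G : Type*) [TopologicalSpace G] [ChartedSpace H G]
    [Group G] (L : ModelWithCorners ℝ V N) (M : Type*) [TopologicalSpace M] [ChartedSpace N M]
    [MulAction G M] : Submodule ℝ (GroupLieAlgebra I G → M → ℝ) where
  carrier := {c | c ∈ cochains I G L M ∧ ∀ (ξ η : GroupLieAlgebra I G) (m : M),
    lieDer I L ξ (c η) m - lieDer I L η (c ξ) m = c ⁅ξ, η⁆ m}
  zero_mem' := ⟨Submodule.zero_mem _, fun ξ η m => by simp [lieDer_zero]⟩
  add_mem' := fun {a b} ha hb => ⟨Submodule.add_mem _ ha.1 hb.1, fun ξ η m => by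
    have h₁ := ha.2 ξ η m
    have h₂ := hb.2 ξ η m
    simp only [Pi.add_apply, lieDer_add _ (ha.1.2 _) (hb.1.2 _)]
    linarith⟩
  smul_mem' := fun r a ha => ⟨Submodule.smul_mem _ r ha.1, fun ξ η m => by
    have h₁ := ha.2 ξ η m
    simp only [Pi.smul_apply, lieDer_smul _ r (ha.1.2 _), smul_eq_mul]
    rw [← h₁, mul_sub]⟩

/-- `B¹(𝔤, C^∞(M))`: the 1-cochains `ξ ↦ 𝓛_ξ Φ` with `Φ ∈ C^∞(M)`. -/
def coboundaries (I : ModelWithCorners ℝ E H) (G : Type*) [TopologicalSpace G] [ChartedSpace H G]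
    [Group G] (L : ModelWithCorners ℝ V N) (M : Type*) [TopologicalSpace M] [ChartedSpace N M]
    [MulAction G M] : Submodule ℝ (GroupLieAlgebra I G → M → ℝ) where
  carrier := {c | c ∈ cochains I G L M ∧ ∃ Φ : M → ℝ, ContMDiff L 𝓘(ℝ, ℝ) ∞ Φ ∧
    ∀ (ξ : GroupLieAlgebra I G) (m : M), c ξ m = lieDer I L ξ Φ m}
  zero_mem' := ⟨Submodule.zero_mem _, 0, contMDiff_const, fun ξ m => by simp [lieDer_zero]⟩
  add_mem' := fun {a b} ⟨ha, Φ, hΦ, h₁⟩ ⟨hb, Ψ, hΨ, h₂⟩ =>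
    ⟨Submodule.add_mem _ ha hb, Φ + Ψ, hΦ.add hΨ, fun ξ m => by
      simp [lieDer_add _ hΦ hΨ, h₁, h₂]⟩
  smul_mem' := fun r a ⟨ha, Φ, hΦ, h₁⟩ =>
    ⟨Submodule.smul_mem _ r ha, r • Φ, contMDiff_const.mul hΦ, fun ξ m => by
      simp [lieDer_smul _ r hΦ, h₁]⟩

/-- `H¹(𝔤, C^∞(M)) = Z¹ / B¹`. -/
abbrev H1 (I : ModelWithCorners ℝ E H) (G : Type*) [TopologicalSpace G] [ChartedSpace H G]
    [Group G] (L : ModelWithCorners ℝ V N) (M : Type*) [TopologicalSpace M] [ChartedSpace N M]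
    [MulAction G M] : Type _ :=
  cocycles I G L M ⧸ (coboundaries I G L M).submoduleOf (cocycles I G L M)

/-- The class in `H¹(𝔤, C^∞(M))` of a 1-cocycle. -/
def cohClass (I : ModelWithCorners ℝ E H) (G : Type*) [TopologicalSpace G] [ChartedSpace H G]
    [Group G] (L : ModelWithCorners ℝ V N) (M : Type*) [TopologicalSpace M] [ChartedSpace N M]
    [MulAction G M] : cocycles I G L M →ₗ[ℝ] H1 I G L M :=
  ((coboundaries I G L M).submoduleOf (cocycles I G L M)).mkQ

/-! ### Infinitesimal deformations -/

/-- The 1-cochain `ξ ↦ X(ξ)`, `X(ξ)(m) = ⟨X_m, ξ⟩`, given by a map `X : M → 𝔤^*`. -/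
def evalMap (p : GroupLieAlgebra J Gs ≃ₗ[ℝ] Module.Dual ℝ (GroupLieAlgebra I G))
    (X : M → GroupLieAlgebra J Gs) (ξ : GroupLieAlgebra I G) (m : M) : ℝ :=
  p (X m) ξ

/-- `X : M → 𝔤^*` is smooth. -/
def IsSmoothMap (L : ModelWithCorners ℝ V N)
    (p : GroupLieAlgebra J Gs ≃ₗ[ℝ] Module.Dual ℝ (GroupLieAlgebra I G))
    (X : M → GroupLieAlgebra J Gs) : Prop :=
  ∀ ξ : GroupLieAlgebra I G, ContMDiff L 𝓘(ℝ, ℝ) ∞ (evalMap p X ξ)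

/-- `{X(ξ), f} = - 𝓛_{ad^*_X ξ} f` for all `ξ ∈ 𝔤` and `f ∈ C^∞(M)`. -/
def BracketIdentity [FiniteDimensional ℝ E] [CompleteSpace F] [LieGroup J ∞ Gs]
    (π : BivectorField L M)
    (p : GroupLieAlgebra J Gs ≃ₗ[ℝ] Module.Dual ℝ (GroupLieAlgebra I G))
    (X : M → GroupLieAlgebra J Gs) : Prop :=
  ∀ (ξ : GroupLieAlgebra I G) (f : M → ℝ), ContMDiff L 𝓘(ℝ, ℝ) ∞ f → ∀ m : M,
    π.bracket (evalMap p X ξ) f m = - lieDer I L (coad p (X m) ξ) f m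

theorem evalMap_add (p : GroupLieAlgebra J Gs ≃ₗ[ℝ] Module.Dual ℝ (GroupLieAlgebra I G))
    (X Y : M → GroupLieAlgebra J Gs) : evalMap p (X + Y) = evalMap p X + evalMap p Y := by
  funext ξ m
  simp [evalMap]

theorem evalMap_smul (p : GroupLieAlgebra J Gs ≃ₗ[ℝ] Module.Dual ℝ (GroupLieAlgebra I G))
    (r : ℝ) (X : M → GroupLieAlgebra J Gs) : evalMap p (r • X) = r • evalMap p X := by
  funext ξ m
  simp [evalMap]

theorem infGen_add (ξ η : GroupLieAlgebra I G) (m : M) :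
    infGen I L (ξ + η) m = infGen I L ξ m + infGen I L η m := by
  have h := (mfderiv I L (fun g : G => g • m) 1).map_add ξ η
  exact (congrArg (fun v : V => -v) h).trans (neg_add _ _)

theorem infGen_smul (r : ℝ) (ξ : GroupLieAlgebra I G) (m : M) :
    infGen I L (r • ξ) m = r • infGen I L ξ m := by
  have h := (mfderiv I L (fun g : G => g • m) 1).map_smul r ξ
  exact (congrArg (fun v : V => -v) h).trans (smul_neg _ _).symm

theorem coad_add [FiniteDimensional ℝ E] [CompleteSpace F] [LieGroup J ∞ Gs]
    (p : GroupLieAlgebra J Gs ≃ₗ[ℝ] Module.Dual ℝ (GroupLieAlgebra I G))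
    (x y : GroupLieAlgebra J Gs) (ξ : GroupLieAlgebra I G) :
    coad p (x + y) ξ = coad p x ξ + coad p y ξ := by
  have : FiniteDimensional ℝ (GroupLieAlgebra I G) := inferInstanceAs (FiniteDimensional ℝ E)
  simp only [coad]
  rw [← map_add]
  congr 1
  ext φ
  simp
  abel

theorem coad_smul [FiniteDimensional ℝ E] [CompleteSpace F] [LieGroup J ∞ Gs]
    (p : GroupLieAlgebra J Gs ≃ₗ[ℝ] Module.Dual ℝ (GroupLieAlgebra I G))
    (r : ℝ) (x : GroupLieAlgebra J Gs) (ξ : GroupLieAlgebra I G) :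
    coad p (r • x) ξ = r • coad p x ξ := by
  have : FiniteDimensional ℝ (GroupLieAlgebra I G) := inferInstanceAs (FiniteDimensional ℝ E)
  simp only [coad]
  rw [← map_smul]
  congr 1
  ext φ
  simp

/-- The space of infinitesimal deformations: the smooth maps `X : M → 𝔤^*` with
`𝓛_ξ X(η) - 𝓛_η X(ξ) = X([ξ, η])` (so that `ξ ↦ X(ξ)` is a 1-cocycle) and
`{X(ξ), ·} = - 𝓛_{ad^*_X ξ}`. -/
def infDeformations [FiniteDimensional ℝ E] [CompleteSpace F] [LieGroup J ∞ Gs]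
    (π : BivectorField L M)
    (p : GroupLieAlgebra J Gs ≃ₗ[ℝ] Module.Dual ℝ (GroupLieAlgebra I G)) :
    Submodule ℝ (M → GroupLieAlgebra J Gs) where
  carrier := {X | evalMap p X ∈ cocycles I G L M ∧ BracketIdentity π p X}
  zero_mem' := by
    have h : evalMap p (0 : M → GroupLieAlgebra J Gs) = 0 := by
      simpa using evalMap_smul p 0 (0 : M → GroupLieAlgebra J Gs)
    have hc : ∀ ξ, coad p 0 ξ = 0 := fun ξ => by simpa using coad_smul p 0 0 ξ
    have hg : ∀ m : M, infGen I L (0 : GroupLieAlgebra I G) m = 0 := fun m => by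
      simpa using infGen_smul (L := L) 0 (0 : GroupLieAlgebra I G) m
    refine ⟨by rw [h]; exact Submodule.zero_mem _, fun ξ f _ m => ?_⟩
    simp [h, BivectorField.bracket, dAt_zero, lieDer, vfApply, hc, hg]
  add_mem' := fun {X Y} hX hY => by
    refine ⟨by rw [evalMap_add]; exact Submodule.add_mem _ hX.1 hY.1, fun ξ f hf m => ?_⟩
    have h₁ := hX.2 ξ f hf m
    have h₂ := hY.2 ξ f hf m
    simp only [BivectorField.bracket, lieDer, vfApply, evalMap_add, Pi.add_apply, coad_add,
      infGen_add, dAt_add (hX.1.1.2 ξ) (hY.1.1.2 ξ), map_add] at h₁ h₂ ⊢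
    rw [h₁, h₂, neg_add]
  smul_mem' := fun r X hX => by
    refine ⟨by rw [evalMap_smul]; exact Submodule.smul_mem _ r hX.1, fun ξ f hf m => ?_⟩
    have h₁ := hX.2 ξ f hf m
    simp only [BivectorField.bracket, lieDer, vfApply, evalMap_smul, Pi.smul_apply, coad_smul,
      infGen_smul, dAt_smul r (hX.1.1.2 ξ), map_smul] at h₁ ⊢
    rw [h₁, smul_neg]

/-- The linear map sending an infinitesimal deformation `X` to the class of `ξ ↦ X(ξ)` in
`H¹(𝔤, C^∞(M))`. -/
def infClass [FiniteDimensional ℝ E] [CompleteSpace F] [LieGroup J ∞ Gs]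
    (π : BivectorField L M)
    (p : GroupLieAlgebra J Gs ≃ₗ[ℝ] Module.Dual ℝ (GroupLieAlgebra I G)) :
    infDeformations π p →ₗ[ℝ] H1 I G L M :=
  cohClass I G L M ∘ₗ
    { toFun := fun X => ⟨evalMap p X.1, X.2.1⟩
      map_add' := fun X Y => Subtype.ext (evalMap_add p X.1 Y.1)
      map_smul' := fun r X => Subtype.ext (evalMap_smul p r X.1) }

/-- The infinitesimal deformation `X` of the momentum map `μ` is the trivial one generated by the
vector field `W` on `M`: `W` commutes with the action and with `π`, and `X` is the image of `W`
under `dμ`, left-translated to the identity: `⟨X, ξ⟩ = ⟨μ^* θ_ξ, W⟩`. -/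
structure IsTrivialDeformation (π : BivectorField L M)
    (p : GroupLieAlgebra J Gs ≃ₗ[ℝ] Module.Dual ℝ (GroupLieAlgebra I G))
    (μ : M → Gs) (X : M → GroupLieAlgebra J Gs) (W : ∀ m : M, TangentSpace L m) : Prop where
  invariant : ∀ (ξ : GroupLieAlgebra I G) (f : M → ℝ), ContMDiff L 𝓘(ℝ, ℝ) ∞ f →
    vfApply L W (lieDer I L ξ f) = lieDer I L ξ (vfApply L W f)
  poisson : ∀ f g : M → ℝ, ContMDiff L 𝓘(ℝ, ℝ) ∞ f → ContMDiff L 𝓘(ℝ, ℝ) ∞ g →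
    vfApply L W (π.bracket f g) = π.bracket (vfApply L W f) g + π.bracket f (vfApply L W g)
  generates : ∀ (ξ : GroupLieAlgebra I G) (m : M), p (X m) ξ = momentForm L p μ ξ m (W m)

/-- The Hamiltonian vector field `H_Φ = π♯(dΦ) = {Φ, ·}`. -/
def hamiltonianVF (π : BivectorField L M) (Φ : M → ℝ) (m : M) : TangentSpace L m :=
  π.sharp m (dAt L Φ m)

/-- For some `Φ ∈ C^∞(M)`: `X(ξ) = 𝓛_ξ Φ`, and `X` is the trivial infinitesimal deformation of `μ`
generated by the vector field `- H_Φ`. -/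
def IsHamiltonianTrivial (π : BivectorField L M)
    (p : GroupLieAlgebra J Gs ≃ₗ[ℝ] Module.Dual ℝ (GroupLieAlgebra I G))
    (μ : M → Gs) (X : M → GroupLieAlgebra J Gs) : Prop :=
  ∃ Φ : M → ℝ, ContMDiff L 𝓘(ℝ, ℝ) ∞ Φ ∧
    (∀ (ξ : GroupLieAlgebra I G) (m : M), evalMap p X ξ m = lieDer I L ξ Φ m) ∧
    IsTrivialDeformation π p μ X (fun m => - hamiltonianVF π Φ m)

end Action

end PoissonLie

end

open PoissonLie

noncomputable section

namespace PoissonLie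

set_option linter.unusedSectionVars false

/-! ### The Maurer-Cartan form of a Lie group in a chart -/

section MaurerCartan

variable {E : Type*} [NormedAddCommGroup E] [NormedSpace ℝ E]
  {Γ : Type*} [TopologicalSpace Γ] [ChartedSpace E Γ] [Group Γ]

/-! Let `α_ξ(t) = μ_t^* θ_ξ`. Everything in the first two assertions comes from one first variation
formula, `d/dt|₀ α_ξ(t) = dX(ξ) + μ_0^* θ_{ad^*_X ξ}` (`hasDerivAt_pullback_leftInvForm`,
`hasDerivAt_momentForm`). To prove it, a left-invariant form is written near a point as `∑ h_i
dy_i`; the derivatives in `t` and along `M` commute on the functions `y_i ∘ μ_t`, and the remaining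
terms `dh_i ∧ dy_i` are given by the Maurer-Cartan equation.

All `μ_t` generate the same fields `ξ_M = π♯ α_ξ(t)`, so applying `π♯` to the formula gives `0 = π♯
dX(ξ) + (ad^*_X ξ)_M`, the bracket identity (`sharp_dAt_evalMap`). If the `μ_t` are also Poisson,
then `π_{G^*}(θ_ξ, θ_η)` at `μ_t(m)` equals `π(α_ξ(t), α_η(t))`, which does not depend on `t`. Its
derivative can also be computed from the multiplicativity of `π_{G^*}` (`hasDerivAt_biForm`): the
linearization contributes `X([ξ, η])` and the variation of the adjoint action contributes two
`ad^*_X` terms, which the bracket identity turns into Lie derivatives of `X` (`lieDer_evalMap_sub`).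

If `Y(ξ) = 𝓛_ξ Φ`, the field `W = -π♯ dΦ` preserves `π` by Jacobi and generates `Y` by
skew-symmetry. That it commutes with `ξ_M` follows from Jacobi, the Maurer-Cartan equation and the
bracket identity for `Y` (`lieDer_bracket_of_coboundary`).

For compact `G` more is true: `Y = 0` (`infDeformation_eq_zero`). Along an orbit the cocycle
identity says that `Y` is a closed 1-form on the simply connected group `G`; a primitive has a
maximum, where `Y` vanishes (`exists_eq_zero_of_closed`). The bracket identity makes `Y` along the
orbit a solution of a homogeneous linear first order system, so it vanishes everywhere
(`eq_zero_of_linear_system`). -/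

/-- The Maurer-Cartan form: the left translation of a tangent vector to the identity. -/
def mcForm (g : Γ) : TangentSpace 𝓘(ℝ, E) g →L[ℝ] GroupLieAlgebra 𝓘(ℝ, E) Γ :=
  (mfderiv 𝓘(ℝ, E) 𝓘(ℝ, E) (fun h : Γ => g⁻¹ * h) g : E →L[ℝ] E)

theorem leftInvForm_apply (a : Module.Dual ℝ (GroupLieAlgebra 𝓘(ℝ, E) Γ)) (g : Γ)
    (v : TangentSpace 𝓘(ℝ, E) g) : leftInvForm a g v = a (mcForm g v) := rfl

variable [LieGroup 𝓘(ℝ, E) ∞ Γ]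

theorem mdifferentiableAt_mul_left (g h : Γ) :
    MDifferentiableAt 𝓘(ℝ, E) 𝓘(ℝ, E) (fun k : Γ => g * k) h :=
  (contMDiff_mul_left (I := 𝓘(ℝ, E)) (n := ∞) (a := g)).mdifferentiableAt (by simp)

theorem mdifferentiableAt_mul_right (g h : Γ) :
    MDifferentiableAt 𝓘(ℝ, E) 𝓘(ℝ, E) (fun k : Γ => k * g) h :=
  (contMDiff_mul_right (I := 𝓘(ℝ, E)) (n := ∞) (a := g)).mdifferentiableAt (by simp)

/-- Change of the base point in a derivative, in the model space. -/
theorem mfderiv_apply_congr_point {F N M : Type*} [NormedAddCommGroup F] [NormedSpace ℝ F]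
    [TopologicalSpace M] [ChartedSpace E M]
    [TopologicalSpace N] [ChartedSpace F N] (f : M → N) {g h : M} (hgh : g = h)
    (v : TangentSpace 𝓘(ℝ, E) g) :
    (mfderiv 𝓘(ℝ, E) 𝓘(ℝ, F) f g : E → F) v = (mfderiv 𝓘(ℝ, E) 𝓘(ℝ, F) f h : E → F) v := by
  subst hgh; rfl

theorem mfderiv_comp_apply' {E₁ E₂ E₃ M₁ M₂ M₃ : Type*}
    [NormedAddCommGroup E₁] [NormedSpace ℝ E₁] [NormedAddCommGroup E₂] [NormedSpace ℝ E₂]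
    [NormedAddCommGroup E₃] [NormedSpace ℝ E₃] [TopologicalSpace M₁] [ChartedSpace E₁ M₁]
    [TopologicalSpace M₂] [ChartedSpace E₂ M₂] [TopologicalSpace M₃] [ChartedSpace E₃ M₃]
    {f : M₁ → M₂} {g : M₂ → M₃} {x : M₁} {y : M₂} (hy : f x = y)
    (hg : MDifferentiableAt 𝓘(ℝ, E₂) 𝓘(ℝ, E₃) g y)
    (hf : MDifferentiableAt 𝓘(ℝ, E₁) 𝓘(ℝ, E₂) f x)
    (v : TangentSpace 𝓘(ℝ, E₁) x) :
    (mfderiv 𝓘(ℝ, E₁) 𝓘(ℝ, E₃) (g ∘ f) x : E₁ → E₃) v =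
      (mfderiv 𝓘(ℝ, E₂) 𝓘(ℝ, E₃) g y : E₂ → E₃) ((mfderiv 𝓘(ℝ, E₁) 𝓘(ℝ, E₂) f x : E₁ → E₂) v) := by
  subst hy
  exact congrArg (fun T : E₁ →L[ℝ] E₃ => T v) (mfderiv_comp x hg hf)

theorem mfderiv_id_apply' {M : Type*} [TopologicalSpace M] [ChartedSpace E M] (x : M)
    (v : TangentSpace 𝓘(ℝ, E) x) :
    (mfderiv 𝓘(ℝ, E) 𝓘(ℝ, E) (id : M → M) x : E → E) v = v :=
  congrArg (fun T : E →L[ℝ] E => T v) (mfderiv_id (I := 𝓘(ℝ, E)) (x := x))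

theorem mcForm_mulInvariantVectorField (a : GroupLieAlgebra 𝓘(ℝ, E) Γ) (g : Γ) :
    mcForm g (mulInvariantVectorField a g) = a := by
  have h := mfderiv_comp_apply' (f := fun k : Γ => g * k) (g := fun k : Γ => g⁻¹ * k)
    (x := 1) (y := g) (mul_one g)
    (mdifferentiableAt_mul_left _ _) (mdifferentiableAt_mul_left _ _) a
  have h2 : (fun k : Γ => g⁻¹ * k) ∘ (fun k : Γ => g * k) = id := by ext; simp
  rw [h2] at h
  exact h.symm.trans (mfderiv_id_apply' _ _)

theorem mulInvariantVectorField_mcForm (g : Γ) (v : TangentSpace 𝓘(ℝ, E) g) :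
    mulInvariantVectorField (mcForm g v) g = v := by
  have h := mfderiv_comp_apply' (f := fun k : Γ => g⁻¹ * k) (g := fun k : Γ => g * k)
    (x := g) (y := 1) (inv_mul_cancel g)
    (mdifferentiableAt_mul_left _ _) (mdifferentiableAt_mul_left _ _) v
  have h2 : (fun k : Γ => g * k) ∘ (fun k : Γ => g⁻¹ * k) = id := by ext; simp
  rw [h2] at h
  exact h.symm.trans (mfderiv_id_apply' _ _)

/-- A left-invariant vector field in the chart at `g₀`. -/
def invFrame (g₀ : Γ) (a : GroupLieAlgebra 𝓘(ℝ, E) Γ) : E → E :=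
  VectorField.mpullback 𝓘(ℝ, E) 𝓘(ℝ, E) (extChartAt 𝓘(ℝ, E) g₀).symm (mulInvariantVectorField a)

theorem contMDiffAt_extChartAt_symm_target {M : Type*} [TopologicalSpace M] [ChartedSpace E M]
    [IsManifold 𝓘(ℝ, E) ∞ M] (g₀ : M) {x : E} (hx : x ∈ (extChartAt 𝓘(ℝ, E) g₀).target) :
    ContMDiffAt 𝓘(ℝ, E) 𝓘(ℝ, E) ∞ (extChartAt 𝓘(ℝ, E) g₀).symm x :=
  (contMDiffOn_extChartAt_symm g₀).contMDiffAt ((isOpen_extChartAt_target g₀).mem_nhds hx)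

theorem isInvertible_mfderiv_extChartAt_symm {M : Type*} [TopologicalSpace M] [ChartedSpace E M]
    [IsManifold 𝓘(ℝ, E) ∞ M] (g₀ : M) {x : E} (hx : x ∈ (extChartAt 𝓘(ℝ, E) g₀).target) :
    (mfderiv 𝓘(ℝ, E) 𝓘(ℝ, E) (extChartAt 𝓘(ℝ, E) g₀).symm x).IsInvertible := by
  have : IsManifold 𝓘(ℝ, E) 1 M := .of_le (n := ∞) (by simp)
  have h := isInvertible_mfderivWithin_extChartAt_symm (I := 𝓘(ℝ, E)) (x := g₀) hx
  simpa [mfderivWithin_univ] using h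

/-- The Maurer-Cartan form in the chart at `g₀`. -/
def mcChart (g₀ : Γ) (x : E) : E →L[ℝ] E :=
  (mcForm ((extChartAt 𝓘(ℝ, E) g₀).symm x) : E →L[ℝ] E) ∘L
    (mfderiv 𝓘(ℝ, E) 𝓘(ℝ, E) (extChartAt 𝓘(ℝ, E) g₀).symm x : E →L[ℝ] E)

theorem mfderiv_symm_invFrame (g₀ : Γ) {x : E} (hx : x ∈ (extChartAt 𝓘(ℝ, E) g₀).target)
    (a : GroupLieAlgebra 𝓘(ℝ, E) Γ) :
    (mfderiv 𝓘(ℝ, E) 𝓘(ℝ, E) (extChartAt 𝓘(ℝ, E) g₀).symm x : E → E) (invFrame (E := E) g₀ a x)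
      = mulInvariantVectorField a ((extChartAt 𝓘(ℝ, E) g₀).symm x) :=
  (isInvertible_mfderiv_extChartAt_symm g₀ hx).self_apply_inverse
    (mulInvariantVectorField a ((extChartAt 𝓘(ℝ, E) g₀).symm x))

theorem mcChart_invFrame (g₀ : Γ) {x : E} (hx : x ∈ (extChartAt 𝓘(ℝ, E) g₀).target)
    (a : GroupLieAlgebra 𝓘(ℝ, E) Γ) : mcChart (E := E) g₀ x (invFrame (E := E) g₀ a x) = a :=
  (congrArg (fun v : E => (mcForm ((extChartAt 𝓘(ℝ, E) g₀).symm x) : E →L[ℝ] E) v)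
    (mfderiv_symm_invFrame g₀ hx a)).trans (mcForm_mulInvariantVectorField a _)

theorem invFrame_mcChart (g₀ : Γ) {x : E} (hx : x ∈ (extChartAt 𝓘(ℝ, E) g₀).target) (v : E) :
    invFrame (E := E) g₀ (mcChart (E := E) g₀ x v) x = v := by
  have h : (mfderiv 𝓘(ℝ, E) 𝓘(ℝ, E) (extChartAt 𝓘(ℝ, E) g₀).symm x : E → E)
      (invFrame (E := E) g₀ (mcChart (E := E) g₀ x v) x)
      = (mfderiv 𝓘(ℝ, E) 𝓘(ℝ, E) (extChartAt 𝓘(ℝ, E) g₀).symm x : E → E) v :=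
    (mfderiv_symm_invFrame g₀ hx _).trans (mulInvariantVectorField_mcForm _ _)
  exact (isInvertible_mfderiv_extChartAt_symm (E := E) g₀ hx).injective h

variable [CompleteSpace E]

theorem contDiffAt_invFrame (g₀ : Γ) {x : E} (hx : x ∈ (extChartAt 𝓘(ℝ, E) g₀).target)
    (a : GroupLieAlgebra 𝓘(ℝ, E) Γ) : ContDiffAt ℝ 1 (invFrame (E := E) g₀ a) x := by
  have : IsManifold 𝓘(ℝ, E) 1 Γ := .of_le (n := ∞) (by simp)
  have h1 : ContMDiffAt 𝓘(ℝ, E) 𝓘(ℝ, E).tangent 1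
      (fun g : Γ => (⟨g, mulInvariantVectorField a g⟩ : TangentBundle 𝓘(ℝ, E) Γ))
      ((extChartAt 𝓘(ℝ, E) g₀).symm x) :=
    (contMDiff_mulInvariantVectorField a).contMDiffAt.of_le (by
      rw [minSmoothness_of_isRCLikeNormedField]; norm_num)
  have h2 := h1.mpullback_vectorField_preimage (n := ∞) (contMDiffAt_extChartAt_symm_target g₀ hx)
    (isInvertible_mfderiv_extChartAt_symm g₀ hx) (by rw [one_add_one_eq_two]; exact ENat.LEInfty.out)
  exact contMDiffAt_vectorSpace_iff_contDiffAt.1 h2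

/-- Brackets of left-invariant fields are left-invariant, and pulling back by the inverse chart
commutes with brackets. -/
theorem lieBracket_invFrame (g₀ : Γ) {x : E} (hx : x ∈ (extChartAt 𝓘(ℝ, E) g₀).target)
    (a b : GroupLieAlgebra 𝓘(ℝ, E) Γ) :
    VectorField.lieBracket ℝ (invFrame (E := E) g₀ a) (invFrame (E := E) g₀ b) x = invFrame (E := E) g₀ ⁅a, b⁆ x := by
  have h0 := VectorField.mlieBracketWithin_eq_lieBracketWithin (𝕜 := ℝ) (E := E)
    (V := invFrame (E := E) g₀ a) (W := invFrame (E := E) g₀ b) (s := univ)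
  rw [VectorField.lieBracketWithin_univ] at h0
  refine (congrFun h0 x).symm.trans ?_
  refine (congrFun VectorField.mlieBracketWithin_univ x).trans ?_
  have h := VectorField.mpullback_mlieBracket (I := 𝓘(ℝ, E)) (n := ∞)
    (f := (extChartAt 𝓘(ℝ, E) g₀).symm) (x₀ := x)
    (mdifferentiableAt_mulInvariantVectorField a) (mdifferentiableAt_mulInvariantVectorField b)
    (contMDiffAt_extChartAt_symm_target g₀ hx)
    (by rw [minSmoothness_of_isRCLikeNormedField]; exact ENat.LEInfty.out)
  rw [← mulInvariantVector_mlieBracket] at h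
  exact h.symm

theorem invFrame_add (g₀ : Γ) (a b : GroupLieAlgebra 𝓘(ℝ, E) Γ) (x : E) :
    invFrame (E := E) g₀ (a + b) x = invFrame (E := E) g₀ a x + invFrame (E := E) g₀ b x := by
  unfold invFrame
  rw [mulInvariantVectorField_add, VectorField.mpullback_add_apply]
  rfl

theorem invFrame_smul (g₀ : Γ) (c : ℝ) (a : GroupLieAlgebra 𝓘(ℝ, E) Γ) (x : E) :
    invFrame (E := E) g₀ (c • a) x = c • invFrame (E := E) g₀ a x := by
  unfold invFrame
  rw [mulInvariantVectorField_smul, VectorField.mpullback_const_smul_apply]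
  rfl

variable [FiniteDimensional ℝ E]

/-- The frame of left-invariant vector fields, in the chart at `g₀`, as a linear map. -/
def invFrameCLM (g₀ : Γ) (x : E) : E →L[ℝ] E :=
  LinearMap.toContinuousLinearMap
    { toFun := fun a : E => invFrame (E := E) g₀ a x
      map_add' := fun a b => invFrame_add g₀ a b x
      map_smul' := fun c a => invFrame_smul g₀ c a x }

theorem inverse_invFrameCLM (g₀ : Γ) {x : E} (hx : x ∈ (extChartAt 𝓘(ℝ, E) g₀).target) :
    (invFrameCLM (E := E) g₀ x).inverse = mcChart (E := E) g₀ x := by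
  refine ContinuousLinearMap.inverse_eq ?_ ?_
  · ext v; exact invFrame_mcChart g₀ hx v
  · ext v; exact mcChart_invFrame g₀ hx v

theorem isInvertible_invFrameCLM (g₀ : Γ) {x : E} (hx : x ∈ (extChartAt 𝓘(ℝ, E) g₀).target) :
    (invFrameCLM (E := E) g₀ x).IsInvertible := by
  refine ContinuousLinearMap.IsInvertible.of_inverse (g := mcChart (E := E) g₀ x) ?_ ?_
  · ext v; exact invFrame_mcChart g₀ hx v
  · ext v; exact mcChart_invFrame g₀ hx v

/-- The form inherits its regularity from the frame: it is pointwise the inverse operator, and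
inversion is smooth on invertible operators. -/
theorem contDiffOn_mcChart (g₀ : Γ) :
    ContDiffOn ℝ 1 (mcChart (E := E) g₀) (extChartAt 𝓘(ℝ, E) g₀).target := by
  have hT : ContDiffOn ℝ 1 (invFrameCLM (E := E) g₀) (extChartAt 𝓘(ℝ, E) g₀).target := by
    rw [contDiffOn_clm_apply]
    exact fun a x hx => (contDiffAt_invFrame g₀ hx a).contDiffWithinAt
  refine ContDiffOn.congr (f := fun x => (invFrameCLM (E := E) g₀ x).inverse) ?_
    fun x hx => (inverse_invFrameCLM g₀ hx).symm
  exact fun x hx =>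
    (isInvertible_invFrameCLM g₀ hx).contDiffAt_map_inverse.comp_contDiffWithinAt x (hT x hx)

theorem differentiableAt_mcChart (g₀ : Γ) {x : E} (hx : x ∈ (extChartAt 𝓘(ℝ, E) g₀).target) :
    DifferentiableAt ℝ (mcChart (E := E) g₀) x :=
  ((contDiffOn_mcChart g₀).contDiffAt ((isOpen_extChartAt_target g₀).mem_nhds hx)).differentiableAt
    (by simp)

/-- The bracket of the Lie algebra, on the model space. -/
def modelBracket (Γ : Type*) [TopologicalSpace Γ] [ChartedSpace E Γ] [Group Γ] (u v : E) : E :=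
  Bracket.bracket (L := GroupLieAlgebra 𝓘(ℝ, E) Γ) (M := GroupLieAlgebra 𝓘(ℝ, E) Γ) u v

/-- The Maurer-Cartan equation, in a chart. -/
theorem fderiv_mcChart_sub (g₀ : Γ) {x : E} (hx : x ∈ (extChartAt 𝓘(ℝ, E) g₀).target) (u v : E) :
    fderiv ℝ (mcChart (E := E) g₀) x u v - fderiv ℝ (mcChart (E := E) g₀) x v u
      = - modelBracket Γ (mcChart (E := E) g₀ x u) (mcChart (E := E) g₀ x v) := by
  have hd : ∀ a : E, DifferentiableAt ℝ (invFrame (E := E) g₀ a) x := fun a =>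
    (contDiffAt_invFrame g₀ hx a).differentiableAt (by simp)
  -- Differentiating the constant pairing of the form with the frame trades derivatives of the form
  -- for derivatives of the frame, whose antisymmetrization is a Lie bracket.
  have key : ∀ a w : E, fderiv ℝ (mcChart (E := E) g₀) x w (invFrame (E := E) g₀ a x)
      = - mcChart (E := E) g₀ x (fderiv ℝ (invFrame (E := E) g₀ a) x w) := fun a w => by
    have h1 := (differentiableAt_mcChart g₀ hx).hasFDerivAt.clm_apply (hd a).hasFDerivAt
    have h2 : (fun y => mcChart (E := E) g₀ y (invFrame (E := E) g₀ a y)) =ᶠ[𝓝 x]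
        fun _ => a := by
      filter_upwards [(isOpen_extChartAt_target g₀).mem_nhds hx] with y hy
        using mcChart_invFrame g₀ hy a
    have h3 := h1.unique ((hasFDerivAt_const a x).congr_of_eventuallyEq h2)
    have h4 := congrArg (fun T : E →L[ℝ] E => T w) h3
    simp only [add_apply, ContinuousLinearMap.comp_apply,
      ContinuousLinearMap.flip_apply, zero_apply] at h4
    exact eq_neg_of_add_eq_zero_right h4
  have hb := lieBracket_invFrame g₀ hx (mcChart (E := E) g₀ x u) (mcChart (E := E) g₀ x v)
  have h5 := congrArg (mcChart (E := E) g₀ x) hb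
  rw [mcChart_invFrame g₀ hx, VectorField.lieBracket, invFrame_mcChart g₀ hx,
    invFrame_mcChart g₀ hx, map_sub] at h5
  have h6 := key (mcChart (E := E) g₀ x v) u
  have h7 := key (mcChart (E := E) g₀ x u) v
  rw [invFrame_mcChart g₀ hx] at h6 h7
  rw [h6, h7]
  have h8 : _ = modelBracket Γ (mcChart (E := E) g₀ x u) (mcChart (E := E) g₀ x v) := h5
  rw [← h8]
  abel

end MaurerCartan

/-! ### Differentials of functions -/

section Differentials

variable {E : Type*} [NormedAddCommGroup E] [NormedSpace ℝ E]
  {M : Type*} [TopologicalSpace M] [ChartedSpace E M]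
  {F : Type*} [NormedAddCommGroup F] [NormedSpace ℝ F]
  {N : Type*} [TopologicalSpace N] [ChartedSpace F N]

theorem dAt_congr {f g : M → ℝ} {m : M} (h : f =ᶠ[𝓝 m] g) :
    dAt 𝓘(ℝ, E) f m = dAt 𝓘(ℝ, E) g m :=
  congrArg (fun T : E →L[ℝ] ℝ => T.toLinearMap) h.mfderiv_eq

theorem dAt_comp {f : N → ℝ} {φ : M → N} {m : M}
    (hf : MDifferentiableAt 𝓘(ℝ, F) 𝓘(ℝ, ℝ) f (φ m))
    (hφ : MDifferentiableAt 𝓘(ℝ, E) 𝓘(ℝ, F) φ m) :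
    dAt 𝓘(ℝ, E) (f ∘ φ) m = pullCov 𝓘(ℝ, E) 𝓘(ℝ, F) φ m (dAt 𝓘(ℝ, F) f (φ m)) :=
  congrArg (fun T : E →L[ℝ] ℝ => T.toLinearMap) (mfderiv_comp m hf hφ)

theorem dAt_add' {f g : M → ℝ} {m : M} (hf : MDifferentiableAt 𝓘(ℝ, E) 𝓘(ℝ, ℝ) f m)
    (hg : MDifferentiableAt 𝓘(ℝ, E) 𝓘(ℝ, ℝ) g m) :
    dAt 𝓘(ℝ, E) (f + g) m = dAt 𝓘(ℝ, E) f m + dAt 𝓘(ℝ, E) g m :=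
  congrArg (fun T : E →L[ℝ] ℝ => T.toLinearMap) (mfderiv_add hf hg)

theorem dAt_mul {f g : M → ℝ} {m : M} (hf : MDifferentiableAt 𝓘(ℝ, E) 𝓘(ℝ, ℝ) f m)
    (hg : MDifferentiableAt 𝓘(ℝ, E) 𝓘(ℝ, ℝ) g m) :
    dAt 𝓘(ℝ, E) (fun x => f x * g x) m
      = f m • dAt 𝓘(ℝ, E) g m + g m • dAt 𝓘(ℝ, E) f m :=
  congrArg (fun T : E →L[ℝ] ℝ => T.toLinearMap) (hf.hasMFDerivAt.mul hg.hasMFDerivAt).mfderiv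

theorem mdifferentiableAt_sum {ι : Type*} (s : Finset ι) {f : ι → M → ℝ} {m : M}
    (hf : ∀ i ∈ s, MDifferentiableAt 𝓘(ℝ, E) 𝓘(ℝ, ℝ) (f i) m) :
    MDifferentiableAt 𝓘(ℝ, E) 𝓘(ℝ, ℝ) (fun x => ∑ i ∈ s, f i x) m := by
  classical
  induction s using Finset.induction_on with
  | empty => simpa using mdifferentiableAt_const
  | insert i s hi ih =>
    simp only [Finset.sum_insert hi]
    exact (hf i (by simp)).add (ih fun j hj => hf j (by simp [hj]))

theorem dAt_sum {ι : Type*} (s : Finset ι) {f : ι → M → ℝ} {m : M}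
    (hf : ∀ i ∈ s, MDifferentiableAt 𝓘(ℝ, E) 𝓘(ℝ, ℝ) (f i) m) :
    dAt 𝓘(ℝ, E) (fun x => ∑ i ∈ s, f i x) m = ∑ i ∈ s, dAt 𝓘(ℝ, E) (f i) m := by
  classical
  induction s using Finset.induction_on with
  | empty => exact dAt_zero (L := 𝓘(ℝ, E)) m
  | insert i s hi ih =>
    simp only [Finset.sum_insert hi]
    rw [← ih fun j hj => hf j (by simp [hj])]
    exact dAt_add' (hf i (by simp)) (mdifferentiableAt_sum s fun j hj => hf j (by simp [hj]))

theorem dAt_apply_eq_fderiv {f : M → ℝ} {m : M} (hf : MDifferentiableAt 𝓘(ℝ, E) 𝓘(ℝ, ℝ) f m)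
    (v : TangentSpace 𝓘(ℝ, E) m) : dAt 𝓘(ℝ, E) f m v
      = fderiv ℝ (f ∘ (extChartAt 𝓘(ℝ, E) m).symm) (extChartAt 𝓘(ℝ, E) m m) v := by
  have h : mfderiv 𝓘(ℝ, E) 𝓘(ℝ, ℝ) f m
      = fderivWithin ℝ (writtenInExtChartAt 𝓘(ℝ, E) 𝓘(ℝ, ℝ) m f) (range 𝓘(ℝ, E))
        (extChartAt 𝓘(ℝ, E) m m) := hf.mfderiv
  rw [ModelWithCorners.range_eq_univ, fderivWithin_univ] at h
  exact congrArg (fun T : E →L[ℝ] ℝ => T v) h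

variable [IsManifold 𝓘(ℝ, E) ∞ M]

theorem mdifferentiableAt_extChartAt' (u : M) {g : M} (hg : g ∈ (extChartAt 𝓘(ℝ, E) u).source) :
    MDifferentiableAt 𝓘(ℝ, E) 𝓘(ℝ, E) (extChartAt 𝓘(ℝ, E) u) g :=
  (contMDiffAt_extChartAt' (n := ∞) (by simpa using hg)).mdifferentiableAt (by simp)

/-- The differential of a linear form on the model space, read in the chart at `u`. -/
theorem dAt_chart (u : M) (ℓ : E →L[ℝ] ℝ) {g : M} (hg : g ∈ (extChartAt 𝓘(ℝ, E) u).source)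
    (v : TangentSpace 𝓘(ℝ, E) g) :
    dAt 𝓘(ℝ, E) (fun x => ℓ (extChartAt 𝓘(ℝ, E) u x)) g v
      = ℓ (mfderiv 𝓘(ℝ, E) 𝓘(ℝ, E) (extChartAt 𝓘(ℝ, E) u) g v : E) := by
  have h := mfderiv_comp_apply' (f := extChartAt 𝓘(ℝ, E) u) (g := ℓ) (x := g) rfl
    ℓ.differentiableAt.mdifferentiableAt (mdifferentiableAt_extChartAt' u hg) v
  rw [mfderiv_eq_fderiv, ℓ.fderiv] at h
  exact h

/-- Smooth functions on `M` with prescribed linear expression in a chart. -/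
theorem exists_contMDiff_eq_chart [FiniteDimensional ℝ E] [T2Space M] (u : M) (ℓ : E →L[ℝ] ℝ) :
    ∃ f : M → ℝ, ContMDiff 𝓘(ℝ, E) 𝓘(ℝ, ℝ) ∞ f ∧
      ∀ᶠ g in 𝓝 u, f g = ℓ (extChartAt 𝓘(ℝ, E) u g) := by
  let β : SmoothBumpFunction 𝓘(ℝ, E) u :=
    Classical.choice inferInstance
  refine ⟨fun x => β x • ℓ (extChartAt 𝓘(ℝ, E) u x), β.contMDiff_smul ?_, ?_⟩
  · exact ℓ.contMDiff.comp_contMDiffOn contMDiffOn_extChartAt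
  · filter_upwards [β.eventuallyEq_one] with g hg
    simp [hg]

/-- Hypotheses on bivector fields speak of brackets of global smooth functions; this lets them be
used on arbitrary covectors. -/
theorem exists_dAt_eq [FiniteDimensional ℝ E] [T2Space M] (u : M) (a : Cotangent 𝓘(ℝ, E) u) :
    ∃ f : M → ℝ, ContMDiff 𝓘(ℝ, E) 𝓘(ℝ, ℝ) ∞ f ∧ dAt 𝓘(ℝ, E) f u = a := by
  let ℓ : E →L[ℝ] ℝ := LinearMap.toContinuousLinearMap (show E →ₗ[ℝ] ℝ from a)
  obtain ⟨f, hf, hfl⟩ := exists_contMDiff_eq_chart u ℓ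
  refine ⟨f, hf, ?_⟩
  refine LinearMap.ext fun v => ?_
  refine (dAt_apply_eq_fderiv (hf.mdifferentiableAt (by simp)) v).trans ?_
  have h : f ∘ (extChartAt 𝓘(ℝ, E) u).symm =ᶠ[𝓝 (extChartAt 𝓘(ℝ, E) u u)] ℓ := by
    have h0 := continuousAt_extChartAt_symm (I := 𝓘(ℝ, E)) u
    rw [ContinuousAt, (extChartAt 𝓘(ℝ, E) u).left_inv (mem_extChartAt_source u)] at h0
    have h1 := h0.eventually hfl
    filter_upwards [h1, extChartAt_target_mem_nhds (I := 𝓘(ℝ, E)) u] with x hx hx'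
    rw [Function.comp_apply, hx, (extChartAt 𝓘(ℝ, E) u).right_inv hx']
  rw [h.fderiv_eq, ℓ.fderiv]
  rfl

end Differentials

/-! ### Local expression of left-invariant forms -/

section Decomposition

variable {E : Type*} [NormedAddCommGroup E] [NormedSpace ℝ E] [FiniteDimensional ℝ E]
  [CompleteSpace E]
  {Γ : Type*} [TopologicalSpace Γ] [ChartedSpace E Γ] [Group Γ] [LieGroup 𝓘(ℝ, E) ∞ Γ]

theorem mcForm_eq_mcChart (u : Γ) {g : Γ} (hg : g ∈ (extChartAt 𝓘(ℝ, E) u).source)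
    (v : TangentSpace 𝓘(ℝ, E) g) :
    mcForm g v = mcChart (E := E) u (extChartAt 𝓘(ℝ, E) u g)
      (mfderiv 𝓘(ℝ, E) 𝓘(ℝ, E) (extChartAt 𝓘(ℝ, E) u) g v : E) := by
  have hg' := (extChartAt 𝓘(ℝ, E) u).map_source hg
  have h := mfderiv_comp_apply' (f := extChartAt 𝓘(ℝ, E) u) (g := (extChartAt 𝓘(ℝ, E) u).symm)
    (x := g) rfl ((contMDiffAt_extChartAt_symm_target u hg').mdifferentiableAt (by simp))
    (mdifferentiableAt_extChartAt' u hg) v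
  have h2 : (extChartAt 𝓘(ℝ, E) u).symm ∘ (extChartAt 𝓘(ℝ, E) u) =ᶠ[𝓝 g] id := by
    filter_upwards [(isOpen_extChartAt_source u).mem_nhds hg] with x hx
      using (extChartAt 𝓘(ℝ, E) u).left_inv hx
  rw [h2.mfderiv_eq] at h
  have h3 := (mfderiv_id_apply' g v).symm.trans h
  have h4 : ∀ (k : Γ) (w : E), k = g →
      (mcForm k : E → E) w = (mcForm g : E → E) w := by rintro k w rfl; rfl
  refine Eq.trans ?_ (h4 _ _ ((extChartAt 𝓘(ℝ, E) u).left_inv hg)).symm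
  exact congrArg (fun w : E => (mcForm g : E → E) w) h3

variable [T2Space Γ]

/-- Near `u`, the left-invariant 1-forms are combinations of differentials of smooth functions,
and the Maurer-Cartan equation holds. -/
theorem exists_leftInvForm_eq_sum (u : Γ) :
    ∃ (n : ℕ) (y : Fin n → Γ → ℝ)
      (h : Module.Dual ℝ (GroupLieAlgebra 𝓘(ℝ, E) Γ) → Fin n → Γ → ℝ),
      (∀ i, ContMDiff 𝓘(ℝ, E) 𝓘(ℝ, ℝ) ∞ (y i)) ∧
      (∀ a i, MDifferentiableAt 𝓘(ℝ, E) 𝓘(ℝ, ℝ) (h a i) u) ∧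
      (∀ᶠ g in 𝓝 u, ∀ a, leftInvForm a g = ∑ i, h a i g • dAt 𝓘(ℝ, E) (y i) g) ∧
      (∀ (a : Module.Dual ℝ (GroupLieAlgebra 𝓘(ℝ, E) Γ)) (A B : TangentSpace 𝓘(ℝ, E) u),
        ∑ i, (dAt 𝓘(ℝ, E) (h a i) u A * dAt 𝓘(ℝ, E) (y i) u B
          - dAt 𝓘(ℝ, E) (h a i) u B * dAt 𝓘(ℝ, E) (y i) u A)
        = - a ⁅mcForm u A, mcForm u B⁆) := by
  let b := Module.finBasis ℝ E
  let co : Fin (Module.finrank ℝ E) → E →L[ℝ] ℝ := fun i => LinearMap.toContinuousLinearMap (b.coord i)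
  have hco : ∀ v : E, ∑ i, co i v • b i = v := fun v => b.sum_repr v
  -- Cut-off coordinates: globally smooth, equal to the coordinates near `u`.
  choose y hy hyc using fun i => exists_contMDiff_eq_chart u (co i)
  let al : Module.Dual ℝ (GroupLieAlgebra 𝓘(ℝ, E) Γ) → E →L[ℝ] ℝ := fun a =>
    LinearMap.toContinuousLinearMap (show E →ₗ[ℝ] ℝ from a)
  -- Coefficients of the left-invariant forms with respect to the coordinate differentials.
  let q : Module.Dual ℝ (GroupLieAlgebra 𝓘(ℝ, E) Γ) → Fin (Module.finrank ℝ E) → E → ℝ :=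
    fun a i x => al a (mcChart (E := E) u x (b i))
  have hdy : ∀ᶠ g in 𝓝 u, ∀ i, ∀ v : TangentSpace 𝓘(ℝ, E) g, dAt 𝓘(ℝ, E) (y i) g v
      = co i (mfderiv 𝓘(ℝ, E) 𝓘(ℝ, E) (extChartAt 𝓘(ℝ, E) u) g v : E) := by
    filter_upwards [(eventually_all.2 hyc).eventually_nhds, extChartAt_source_mem_nhds (I := 𝓘(ℝ, E)) u]
      with g hg hg' i v
    have : y i =ᶠ[𝓝 g] fun x => co i (extChartAt 𝓘(ℝ, E) u x) := by
      filter_upwards [hg] with x hx using hx i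
    rw [dAt_congr this, dAt_chart u (co i) hg']
  have hu : extChartAt 𝓘(ℝ, E) u u ∈ (extChartAt 𝓘(ℝ, E) u).target := mem_extChartAt_target u
  have hq : ∀ a i, HasFDerivAt (q a i) ((al a).comp
      ((fderiv ℝ (mcChart (E := E) u) (extChartAt 𝓘(ℝ, E) u u)).flip (b i)))
      (extChartAt 𝓘(ℝ, E) u u) := fun a i => by
    have h1 := (differentiableAt_mcChart u hu).hasFDerivAt.clm_apply
      (hasFDerivAt_const (b i) (extChartAt 𝓘(ℝ, E) u u))
    have h2 := (al a).hasFDerivAt.comp (extChartAt 𝓘(ℝ, E) u u) h1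
    refine h2.congr_fderiv ?_
    ext v
    simp
  have hqd : ∀ a i, MDifferentiableAt 𝓘(ℝ, E) 𝓘(ℝ, ℝ) (q a i) (extChartAt 𝓘(ℝ, E) u u) :=
    fun a i => (hq a i).differentiableAt.mdifferentiableAt
  have hφ := mdifferentiableAt_extChartAt' (E := E) u (mem_extChartAt_source u)
  refine ⟨_, y, fun a i g => q a i (extChartAt 𝓘(ℝ, E) u g), hy, fun a i => (hqd a i).comp u hφ,
    ?_, fun a A B => ?_⟩
  · filter_upwards [hdy, extChartAt_source_mem_nhds (I := 𝓘(ℝ, E)) u] with g hg hg' a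
    refine LinearMap.ext fun v => ?_
    rw [leftInvForm_apply, mcForm_eq_mcChart u hg' v, LinearMap.sum_apply]
    simp only [LinearMap.smul_apply, hg, smul_eq_mul]
    set w : E := (mfderiv 𝓘(ℝ, E) 𝓘(ℝ, E) (extChartAt 𝓘(ℝ, E) u) g v : E)
    change al a (mcChart (E := E) u (extChartAt 𝓘(ℝ, E) u g) w) = _
    conv_lhs => rw [← hco w]
    simp only [map_sum, map_smul, smul_eq_mul]
    exact Finset.sum_congr rfl fun i _ => mul_comm _ _
  · have hdq : ∀ i (v : TangentSpace 𝓘(ℝ, E) u),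
        dAt 𝓘(ℝ, E) (fun g => q a i (extChartAt 𝓘(ℝ, E) u g)) u v
        = al a (fderiv ℝ (mcChart (E := E) u) (extChartAt 𝓘(ℝ, E) u u)
          (mfderiv 𝓘(ℝ, E) 𝓘(ℝ, E) (extChartAt 𝓘(ℝ, E) u) u v : E) (b i)) := fun i v => by
      have h := mfderiv_comp_apply' (f := extChartAt 𝓘(ℝ, E) u) (g := q a i) (x := u) rfl
        (hqd a i) hφ v
      rw [mfderiv_eq_fderiv, (hq a i).fderiv] at h
      exact h
    simp only [hdq, hdy.self_of_nhds]
    set A' : E := (mfderiv 𝓘(ℝ, E) 𝓘(ℝ, E) (extChartAt 𝓘(ℝ, E) u) u A : E) with hA'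
    set B' : E := (mfderiv 𝓘(ℝ, E) 𝓘(ℝ, E) (extChartAt 𝓘(ℝ, E) u) u B : E) with hB'
    -- Summing against the coordinates reassembles `v`, so the sum becomes the antisymmetrized
    -- derivative of the Maurer-Cartan form.
    have hs : ∀ (D : E →L[ℝ] E) (v : E), ∑ i, al a (D (b i)) * co i v = al a (D v) := fun D v => by
      conv_rhs => rw [← hco v]
      simp only [map_sum, map_smul, smul_eq_mul]
      exact Finset.sum_congr rfl fun i _ => mul_comm _ _
    rw [Finset.sum_sub_distrib, hs, hs, ← map_sub, fderiv_mcChart_sub u hu, map_neg]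
    have hA := mcForm_eq_mcChart u (mem_extChartAt_source u) A
    have hB := mcForm_eq_mcChart u (mem_extChartAt_source u) B
    rw [hA, hB]
    rfl

end Decomposition

/-! ### Variation of the pullback of a left-invariant form -/

section Curves

variable {E : Type*} [NormedAddCommGroup E] [NormedSpace ℝ E]
  {M : Type*} [TopologicalSpace M] [ChartedSpace E M]

/-- The velocity of a curve. -/
def velocity (c : ℝ → M) (t : ℝ) : TangentSpace 𝓘(ℝ, E) (c t) :=
  (mfderiv 𝓘(ℝ, ℝ) 𝓘(ℝ, E) c t : ℝ →L[ℝ] E) 1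

theorem hasDerivAt_comp_curve {f : M → ℝ} {c : ℝ → M} {t : ℝ}
    (hf : MDifferentiableAt 𝓘(ℝ, E) 𝓘(ℝ, ℝ) f (c t))
    (hc : MDifferentiableAt 𝓘(ℝ, ℝ) 𝓘(ℝ, E) c t) :
    HasDerivAt (fun s => f (c s)) (dAt 𝓘(ℝ, E) f (c t) (velocity c t)) t := by
  have h := (hf.comp t hc).differentiableAt.hasDerivAt
  have h2 := mfderiv_comp_apply' (f := c) (g := f) (x := t) rfl hf hc (1 : ℝ)
  rw [mfderiv_eq_fderiv] at h2
  have h3 : deriv (f ∘ c) t = dAt 𝓘(ℝ, E) f (c t) (velocity c t) :=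
    fderiv_apply_one_eq_deriv.symm.trans h2
  rw [h3] at h
  exact h

end Curves

/-! ### Symmetry of second derivatives in a parameter and a point. -/

section MixedPartials

variable {E : Type*} [NormedAddCommGroup E] [NormedSpace ℝ E]

/-- Both derivatives are the second derivative of `f` on the pair `(1, 0)`, `(0, v)`, which is
symmetric because `f` is `C²`. -/
theorem mixed_partials_vectorSpace {f : ℝ × E → ℝ} {x : E} (hf : ContDiffAt ℝ 2 f (0, x)) (v : E) :
    DifferentiableAt ℝ (fun y => deriv (fun t => f (t, y)) 0) x ∧
    HasDerivAt (fun t => fderiv ℝ (fun y => f (t, y)) x v)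
      (fderiv ℝ (fun y => deriv (fun t => f (t, y)) 0) x v) 0 := by
  have hd : ∀ᶠ p in 𝓝 ((0 : ℝ), x), DifferentiableAt ℝ f p :=
    (hf.eventually (by simp)).mono fun p hp => hp.differentiableAt (by simp)
  have hD : HasFDerivAt (fderiv ℝ f) (fderiv ℝ (fderiv ℝ f) (0, x)) (0, x) :=
    ((hf.fderiv_right (m := 1) (by norm_num [one_add_one_eq_two])).differentiableAt
      (by simp)).hasFDerivAt
  have hsymm : IsSymmSndFDerivAt ℝ f (0, x) :=
    hf.isSymmSndFDerivAt (by rw [minSmoothness_of_isRCLikeNormedField])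
  have hi1 : HasFDerivAt (fun y : E => ((0 : ℝ), y)) (ContinuousLinearMap.inr ℝ ℝ E) x :=
    hasFDerivAt_prodMk_right 0 x
  have hi2 : ∀ (t : ℝ) (y : E), HasFDerivAt (fun s : ℝ => (s, y)) (ContinuousLinearMap.inl ℝ ℝ E) t :=
    fun t y => hasFDerivAt_prodMk_left t y
  have e1 : (fun y => deriv (fun t => f (t, y)) 0) =ᶠ[𝓝 x]
      fun y => fderiv ℝ f (0, y) (1, 0) := by
    have hc : ContinuousAt (fun y : E => ((0 : ℝ), y)) x := hi1.continuousAt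
    filter_upwards [hc.eventually hd] with y hy
    have := (hy.hasFDerivAt.comp (0 : ℝ) (hi2 0 y)).hasDerivAt.deriv
    simpa [Function.comp_def] using this
  have e2 : (fun t => fderiv ℝ (fun y => f (t, y)) x v) =ᶠ[𝓝 0]
      fun t => fderiv ℝ f (t, x) (0, v) := by
    have hc : ContinuousAt (fun s : ℝ => (s, x)) 0 := (hi2 0 x).continuousAt
    filter_upwards [hc.eventually hd] with t ht
    have := (ht.hasFDerivAt.comp x (hasFDerivAt_prodMk_right (𝕜 := ℝ) t x)).fderiv
    have h' := congrArg (fun T : E →L[ℝ] ℝ => T v) this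
    simpa [Function.comp_def] using h'
  have d1 : HasFDerivAt (fun y => fderiv ℝ f (0, y) (1, 0))
      (((fderiv ℝ (fderiv ℝ f) (0, x)).comp (ContinuousLinearMap.inr ℝ ℝ E)).flip (1, 0)) x := by
    have h1 := (hD.comp x hi1).clm_apply (hasFDerivAt_const ((1 : ℝ), (0 : E)) x)
    refine h1.congr_fderiv ?_
    ext w
    simp
  have d2 : HasDerivAt (fun t => fderiv ℝ f (t, x) (0, v))
      (fderiv ℝ (fderiv ℝ f) (0, x) (1, 0) (0, v)) 0 := by
    have h1 := ((hD.comp (0 : ℝ) (hi2 0 x)).clm_apply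
      (hasFDerivAt_const ((0 : ℝ), v) (0 : ℝ))).hasDerivAt
    simpa using h1
  refine ⟨(d1.congr_of_eventuallyEq e1).differentiableAt, ?_⟩
  rw [e1.fderiv_eq, d1.fderiv]
  refine (d2.congr_of_eventuallyEq e2).congr_deriv ?_
  rw [hsymm.eq]
  simp

variable {M : Type*} [TopologicalSpace M] [ChartedSpace E M] [IsManifold 𝓘(ℝ, E) ∞ M]

theorem mdifferentiableAt_slice_left {E' N : Type*} [NormedAddCommGroup E'] [NormedSpace ℝ E']
    [TopologicalSpace N] [ChartedSpace E' N] {F : ℝ × M → N} {t : ℝ} {m : M}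
    (hF : MDifferentiableAt (𝓘(ℝ, ℝ).prod 𝓘(ℝ, E)) 𝓘(ℝ, E') F (t, m)) :
    MDifferentiableAt 𝓘(ℝ, ℝ) 𝓘(ℝ, E') (fun s => F (s, m)) t :=
  hF.comp t (mdifferentiableAt_id.prodMk mdifferentiableAt_const)

theorem mdifferentiableAt_slice_right {E' N : Type*} [NormedAddCommGroup E'] [NormedSpace ℝ E']
    [TopologicalSpace N] [ChartedSpace E' N] {F : ℝ × M → N} {t : ℝ} {m : M}
    (hF : MDifferentiableAt (𝓘(ℝ, ℝ).prod 𝓘(ℝ, E)) 𝓘(ℝ, E') F (t, m)) :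
    MDifferentiableAt 𝓘(ℝ, E) 𝓘(ℝ, E') (fun m' => F (t, m')) m :=
  hF.comp m (mdifferentiableAt_const.prodMk mdifferentiableAt_id)

/-- Finite order regularity at a point spreads to a neighbourhood, so nearby slices can be
differentiated before a second derivative is taken. -/
theorem eventually_mdifferentiableAt {E' N : Type*} [NormedAddCommGroup E'] [NormedSpace ℝ E']
    [TopologicalSpace N] [ChartedSpace E' N] [IsManifold 𝓘(ℝ, E') ∞ N] {F : ℝ × M → N} {p : ℝ × M}
    (hF : ContMDiffAt (𝓘(ℝ, ℝ).prod 𝓘(ℝ, E)) 𝓘(ℝ, E') 2 F p) :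
    ∀ᶠ q in 𝓝 p, MDifferentiableAt (𝓘(ℝ, ℝ).prod 𝓘(ℝ, E)) 𝓘(ℝ, E') F q := by
  have : IsManifold 𝓘(ℝ, E') 2 N := .of_le (n := ∞) ENat.LEInfty.out
  have : IsManifold 𝓘(ℝ, E) 2 M := .of_le (n := ∞) ENat.LEInfty.out
  exact ((contMDiffAt_iff_contMDiffAt_nhds (by simp)).1 hF).mono fun q hq => hq.mdifferentiableAt (by simp)

/-- Symmetry of second derivatives: the differential of `ψ t`, differentiated in `t`. -/
theorem mixed_partials {ψ : ℝ × M → ℝ} {m : M}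
    (hψ : ContMDiffAt (𝓘(ℝ, ℝ).prod 𝓘(ℝ, E)) 𝓘(ℝ, ℝ) 2 ψ (0, m)) (v : TangentSpace 𝓘(ℝ, E) m) :
    MDifferentiableAt 𝓘(ℝ, E) 𝓘(ℝ, ℝ) (fun m' => deriv (fun t => ψ (t, m')) 0) m ∧
    HasDerivAt (fun t => dAt 𝓘(ℝ, E) (fun m' => ψ (t, m')) m v)
      (dAt 𝓘(ℝ, E) (fun m' => deriv (fun t => ψ (t, m')) 0) m v) 0 := by
  set φ := extChartAt 𝓘(ℝ, E) m with hφ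
  have hs : ContMDiffAt 𝓘(ℝ, ℝ × E) (𝓘(ℝ, ℝ).prod 𝓘(ℝ, E)) 2
      (fun p : ℝ × E => (p.1, φ.symm p.2)) (0, φ m) := by
    refine ContMDiffAt.prodMk contDiff_fst.contMDiff.contMDiffAt ?_
    refine ContMDiffAt.comp (I' := 𝓘(ℝ, E)) (g := φ.symm) (0, φ m) ?_
      contDiff_snd.contMDiff.contMDiffAt
    exact (contMDiffAt_extChartAt_symm_target m (mem_extChartAt_target m)).of_le ENat.LEInfty.out
  have hf : ContDiffAt ℝ 2 (fun p : ℝ × E => ψ (p.1, φ.symm p.2)) (0, φ m) := by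
    rw [← contMDiffAt_iff_contDiffAt]
    refine ContMDiffAt.comp (0, φ m) (g := ψ) ?_ hs
    simpa [hφ] using hψ
  obtain ⟨h1, h2⟩ := mixed_partials_vectorSpace hf v
  have hm : MDifferentiableAt 𝓘(ℝ, E) 𝓘(ℝ, ℝ) (fun m' => deriv (fun t => ψ (t, m')) 0) m := by
    have h3 : MDifferentiableAt 𝓘(ℝ, E) 𝓘(ℝ, ℝ)
        ((fun y => deriv (fun t => ψ (t, φ.symm y)) 0) ∘ φ) m :=
      h1.mdifferentiableAt.comp m (mdifferentiableAt_extChartAt' m (mem_extChartAt_source m))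
    refine h3.congr_of_eventuallyEq ?_
    filter_upwards [extChartAt_source_mem_nhds (I := 𝓘(ℝ, E)) m] with m' hm'
    simp only [Function.comp_apply]
    rw [φ.left_inv hm']
  refine ⟨hm, ?_⟩
  refine HasDerivAt.congr_deriv (h2.congr_of_eventuallyEq ?_) (dAt_apply_eq_fderiv hm v).symm
  have hc : ContinuousAt (fun t : ℝ => (t, m)) 0 := by fun_prop
  filter_upwards [hc.eventually (eventually_mdifferentiableAt hψ)] with t ht
  exact dAt_apply_eq_fderiv (mdifferentiableAt_slice_right ht) v

end MixedPartials

/-! ### The first variation formula. -/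

section Variation

variable {E : Type*} [NormedAddCommGroup E] [NormedSpace ℝ E] [FiniteDimensional ℝ E]
  [CompleteSpace E]
  {Γ : Type*} [TopologicalSpace Γ] [ChartedSpace E Γ] [Group Γ] [LieGroup 𝓘(ℝ, E) ∞ Γ] [T2Space Γ]
  {V : Type*} [NormedAddCommGroup V] [NormedSpace ℝ V]
  {M : Type*} [TopologicalSpace M] [ChartedSpace V M] [IsManifold 𝓘(ℝ, V) ∞ M]

/-- The derivative in `t` of the pullback of a left-invariant form by `F t`, when the velocity of
`F` at `t = 0` is the left translate of `X`. -/
theorem hasDerivAt_pullback_leftInvForm {F : ℝ → M → Γ} {m : M}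
    (hF : ContMDiffAt (𝓘(ℝ, ℝ).prod 𝓘(ℝ, V)) 𝓘(ℝ, E) 2 (fun q : ℝ × M => F q.1 q.2) (0, m))
    {X : M → GroupLieAlgebra 𝓘(ℝ, E) Γ}
    (hX : ∀ᶠ m' in 𝓝 m, mcForm (F 0 m') (velocity (fun t => F t m') 0) = X m')
    (a : Module.Dual ℝ (GroupLieAlgebra 𝓘(ℝ, E) Γ)) (v : TangentSpace 𝓘(ℝ, V) m) :
    HasDerivAt (fun t => pullCov 𝓘(ℝ, V) 𝓘(ℝ, E) (F t) m (leftInvForm a (F t m)) v)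
      (dAt 𝓘(ℝ, V) (fun m' => a (X m')) m v
        + a ⁅mcForm (F 0 m) (mfderiv 𝓘(ℝ, V) 𝓘(ℝ, E) (F 0) m v), X m⁆) 0 := by
  obtain ⟨n, y, h, hy, hh, hdec, hmc⟩ := exists_leftInvForm_eq_sum (E := E) (F 0 m)
  have hFd := eventually_mdifferentiableAt hF
  have hFm := hFd.self_of_nhds
  have hFt : MDifferentiableAt 𝓘(ℝ, ℝ) 𝓘(ℝ, E) (fun t => F t m) 0 := mdifferentiableAt_slice_left hFm
  have hF0 : MDifferentiableAt 𝓘(ℝ, V) 𝓘(ℝ, E) (F 0) m := mdifferentiableAt_slice_right hFm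
  have hyd : ∀ i g, MDifferentiableAt 𝓘(ℝ, E) 𝓘(ℝ, ℝ) (y i) g := fun i g =>
    (hy i).mdifferentiableAt (by simp)
  have hψ : ∀ i, ContMDiffAt (𝓘(ℝ, ℝ).prod 𝓘(ℝ, V)) 𝓘(ℝ, ℝ) 2
      (fun q : ℝ × M => y i (F q.1 q.2)) (0, m) := fun i =>
    (((hy i).of_le ENat.LEInfty.out).contMDiffAt).comp (0, m) hF
  set D : Fin n → M → ℝ := fun i m' => deriv (fun t => y i (F t m')) 0 with hD
  have hmp := fun i => mixed_partials (hψ i) v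
  have hDd : ∀ i, MDifferentiableAt 𝓘(ℝ, V) 𝓘(ℝ, ℝ) (D i) m := fun i => (hmp i).1
  have hhF : ∀ i, MDifferentiableAt 𝓘(ℝ, V) 𝓘(ℝ, ℝ) (fun m' => h a i (F 0 m')) m := fun i =>
    (hh a i).comp m hF0
  have ct : ContinuousAt (fun t : ℝ => (t, m)) 0 := by fun_prop
  have cm : ContinuousAt (fun m' : M => ((0 : ℝ), m')) m := by fun_prop
  have hDv : ∀ᶠ m' in 𝓝 m, ∀ i,
      D i m' = dAt 𝓘(ℝ, E) (y i) (F 0 m') (velocity (fun t => F t m') 0) := by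
    filter_upwards [cm.eventually hFd] with m' hm' i
    exact (hasDerivAt_comp_curve (c := fun t => F t m') (hyd i _)
      (mdifferentiableAt_slice_left hm')).deriv
  -- The local expression of the form, evaluated on the velocity of `F`.
  have haX : (fun m' => a (X m')) =ᶠ[𝓝 m] fun m' => ∑ i, h a i (F 0 m') * D i m' := by
    filter_upwards [hX, hDv, hF0.continuousAt.eventually hdec] with m' h1 h2 h3
    rw [← h1, ← leftInvForm_apply, h3 a, LinearMap.sum_apply]
    simp [h2]
  have hL : (fun t => pullCov 𝓘(ℝ, V) 𝓘(ℝ, E) (F t) m (leftInvForm a (F t m)) v) =ᶠ[𝓝 0]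
      fun t => ∑ i, h a i (F t m) * dAt 𝓘(ℝ, V) (fun m' => y i (F t m')) m v := by
    filter_upwards [hFt.continuousAt.eventually hdec, ct.eventually hFd] with t h1 h2
    have h3 : ∀ i, dAt 𝓘(ℝ, V) (fun m' => y i (F t m')) m
        = pullCov 𝓘(ℝ, V) 𝓘(ℝ, E) (F t) m (dAt 𝓘(ℝ, E) (y i) (F t m)) := fun i =>
      dAt_comp (hyd i _) (mdifferentiableAt_slice_right h2)
    simp only [h3, h1 a, pullCov]
    exact (LinearMap.sum_apply _ _ _).trans (by simp)
  -- Product rule; the derivative of the second factor is where the two differentiations are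
  -- exchanged.
  have hsum : HasDerivAt (fun t => ∑ i, h a i (F t m) * dAt 𝓘(ℝ, V) (fun m' => y i (F t m')) m v)
      (∑ i, (dAt 𝓘(ℝ, E) (h a i) (F 0 m) (velocity (fun t => F t m) 0)
          * dAt 𝓘(ℝ, V) (fun m' => y i (F 0 m')) m v
        + h a i (F 0 m) * dAt 𝓘(ℝ, V) (D i) m v)) 0 :=
    HasDerivAt.fun_sum fun i _ =>
      (hasDerivAt_comp_curve (c := fun t => F t m) (hh a i) hFt).mul (hmp i).2
  refine (hsum.congr_of_eventuallyEq hL).congr_deriv ?_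
  have hfd : ∀ i, MDifferentiableAt 𝓘(ℝ, V) 𝓘(ℝ, ℝ) (fun m' => h a i (F 0 m') * D i m') m :=
    fun i => (hhF i).mul (hDd i)
  rw [dAt_congr haX, dAt_sum _ fun i _ => hfd i, LinearMap.sum_apply]
  have e1 : ∀ i, dAt 𝓘(ℝ, V) (fun m' => h a i (F 0 m') * D i m') m v
      = h a i (F 0 m) * dAt 𝓘(ℝ, V) (D i) m v
        + dAt 𝓘(ℝ, E) (y i) (F 0 m) (velocity (fun t => F t m) 0)
          * dAt 𝓘(ℝ, E) (h a i) (F 0 m) (mfderiv 𝓘(ℝ, V) 𝓘(ℝ, E) (F 0) m v) := fun i => by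
    rw [dAt_mul (hhF i) (hDd i), hDv.self_of_nhds i]
    have : dAt 𝓘(ℝ, V) (fun m' => h a i (F 0 m')) m = _ := dAt_comp (hh a i) hF0
    rw [this]
    rfl
  have e2 : ∀ i, dAt 𝓘(ℝ, V) (fun m' => y i (F 0 m')) m v
      = dAt 𝓘(ℝ, E) (y i) (F 0 m) (mfderiv 𝓘(ℝ, V) 𝓘(ℝ, E) (F 0) m v) := fun i => by
    have : dAt 𝓘(ℝ, V) (fun m' => y i (F 0 m')) m = _ := dAt_comp (hyd i _) hF0
    rw [this]
    rfl
  -- The terms `h_i dD_i` occur on both sides. What is left is the Maurer-Cartan equation on the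
  -- velocity and the image of `v`.
  have h5 := hmc a (velocity (fun t => F t m) 0) (mfderiv 𝓘(ℝ, V) 𝓘(ℝ, E) (F 0) m v)
  rw [hX.self_of_nhds, ← map_neg, lie_skew] at h5
  rw [← h5]
  simp only [e1, e2]
  rw [← Finset.sum_add_distrib]
  refine Finset.sum_congr rfl fun i _ => ?_
  ring

end Variation

/-! ### The exponential map to first order -/

section Exponential

variable {E : Type*} [NormedAddCommGroup E] [NormedSpace ℝ E] [FiniteDimensional ℝ E]
  [CompleteSpace E]
  {Γ : Type*} [TopologicalSpace Γ] [ChartedSpace E Γ] [Group Γ] [LieGroup 𝓘(ℝ, E) ∞ Γ] [T2Space Γ]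

theorem hasDerivAt_extChartAt_comp {M : Type*} [TopologicalSpace M] [ChartedSpace E M]
    {c : ℝ → M} {t : ℝ} {g : M} (hg : c t = g) (hc : MDifferentiableAt 𝓘(ℝ, ℝ) 𝓘(ℝ, E) c t) :
    HasDerivAt (fun s => extChartAt 𝓘(ℝ, E) g (c s)) (velocity c t : E) t := by
  subst hg
  have key : ∀ T : ℝ →L[ℝ] E, HasMFDerivAt 𝓘(ℝ, ℝ) 𝓘(ℝ, E) c t T →
      HasDerivAt (fun s => extChartAt 𝓘(ℝ, E) (c t) (c s)) (T 1) t := fun T hT => by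
    have h : HasFDerivWithinAt (fun s : ℝ => extChartAt 𝓘(ℝ, E) (c t) (c s)) T
      (range 𝓘(ℝ, ℝ)) t := hT.2
    rw [ModelWithCorners.range_eq_univ, hasFDerivWithinAt_univ] at h
    exact h.hasDerivAt
  exact key _ hc.hasMFDerivAt

/-- Rescaling time turns the integral curve for `x` into one for `t • x`; integral curves are
unique. -/
theorem lieExp_smul (x : GroupLieAlgebra 𝓘(ℝ, E) Γ) :
    ∃ γ : ℝ → Γ, γ 0 = 1 ∧ IsMIntegralCurve γ (mulInvariantVectorField x) ∧
      ∀ t : ℝ, lieExp (t • x) = γ t := by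
  have hs := (exists_integralCurve x).choose_spec
  refine ⟨(exists_integralCurve x).choose, hs.1, hs.2, fun t => ?_⟩
  have ht := (exists_integralCurve (t • x)).choose_spec
  have h1 := hs.2.comp_mul t
  rw [← mulInvariantVectorField_smul] at h1
  have hv : ContMDiff 𝓘(ℝ, E) 𝓘(ℝ, E).tangent 1 (fun g : Γ =>
      (⟨g, mulInvariantVectorField (t • x) g⟩ : TangentBundle 𝓘(ℝ, E) Γ)) :=
    (contMDiff_mulInvariantVectorField (t • x)).of_le (by
      rw [minSmoothness_of_isRCLikeNormedField]; norm_num)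
  have h2 := isMIntegralCurve_Ioo_eq_of_contMDiff_boundaryless (t₀ := 0) hv ht.2 h1
    (by simp [hs.1, ht.1])
  refine (congrFun h2 1).trans ?_
  simp

theorem mdifferentiableAt_mul_lieExp (u : Γ) (x : GroupLieAlgebra 𝓘(ℝ, E) Γ) :
    MDifferentiableAt 𝓘(ℝ, ℝ) 𝓘(ℝ, E) (fun t : ℝ => u * lieExp (t • x)) 0 ∧
    (velocity (fun t : ℝ => u * lieExp (t • x)) 0 : E) = mulInvariantVectorField x u := by
  obtain ⟨γ, h0, hγ, he⟩ := lieExp_smul x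
  suffices H : ∀ c : ℝ → Γ, (∀ t, c t = u * γ t) → MDifferentiableAt 𝓘(ℝ, ℝ) 𝓘(ℝ, E) c 0 ∧
      (velocity c 0 : E) = mulInvariantVectorField x u from H _ fun t => by rw [he]
  intro c hc
  obtain rfl : c = fun t => u * γ t := funext hc
  have hγd := (hγ 0).mdifferentiableAt
  refine ⟨(mdifferentiableAt_mul_left u (γ 0)).comp 0 hγd, ?_⟩
  have h1 := mfderiv_comp_apply' (f := γ) (g := fun k : Γ => u * k) (x := 0) (y := 1) h0
    (mdifferentiableAt_mul_left u 1) hγd (1 : ℝ)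
  have h2 : (mfderiv 𝓘(ℝ, ℝ) 𝓘(ℝ, E) γ 0 : ℝ → E) 1 = x := by
    rw [(hγ 0).mfderiv]
    have h3 : (mulInvariantVectorField x (γ 0) : E) = mulInvariantVectorField x (1 : Γ) := by
      rw [h0]
    have h4 : (mfderiv 𝓘(ℝ, E) 𝓘(ℝ, E) (fun k : Γ => 1 * k) 1 : E → E) x = x := by
      rw [show (fun k : Γ => 1 * k) = id from funext one_mul]
      exact mfderiv_id_apply' _ _
    refine Eq.trans ?_ (h3.trans h4)
    exact one_smul ℝ (mulInvariantVectorField x (γ 0) : E)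
  exact h1.trans (congrArg (fun w : E => (mfderiv 𝓘(ℝ, E) 𝓘(ℝ, E) (fun k : Γ => u * k) 1 : E → E) w) h2)

/-- In the chart at `c 0` the two curves differ by `o(t)`, so their velocities agree, and the
velocity of `u exp(tx)` is the left translate of `x`. -/
theorem mcForm_velocity_of_eqToFirstOrder {c : ℝ → Γ} {x : GroupLieAlgebra 𝓘(ℝ, E) Γ}
    (hc : MDifferentiableAt 𝓘(ℝ, ℝ) 𝓘(ℝ, E) c 0)
    (h : EqToFirstOrder 𝓘(ℝ, E) c (fun t => c 0 * lieExp (t • x))) :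
    mcForm (c 0) (velocity c 0) = x := by
  obtain ⟨hd, hv⟩ := mdifferentiableAt_mul_lieExp (c 0) x
  have h1 := hasDerivAt_extChartAt_comp (g := c 0) rfl hc
  have h2 := hasDerivAt_extChartAt_comp (g := c 0) h.1.symm hd
  have h3 : HasDerivAt (fun t => extChartAt 𝓘(ℝ, E) (c 0) (c t)
      - extChartAt 𝓘(ℝ, E) (c 0) (c 0 * lieExp (t • x))) 0 0 := by
    rw [hasDerivAt_iff_isLittleO]
    have h0 : c 0 * lieExp ((0 : ℝ) • x) = c 0 := h.1.symm
    simp only [h0, sub_self, sub_zero, smul_zero]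
    exact h.2
  have h4 := (h1.sub h2).unique h3
  have h5 : (velocity c 0 : E) = mulInvariantVectorField x (c 0) := (sub_eq_zero.1 h4).trans hv
  exact (congrArg (fun w : E => (mcForm (c 0) : E → E) w) h5).trans
    (mcForm_mulInvariantVectorField x (c 0))

end Exponential

/-! ### Pointwise algebra of bivector fields and momentum maps -/

section Pointwise

variable {V M : Type*} [NormedAddCommGroup V] [NormedSpace ℝ V] [TopologicalSpace M]
  [ChartedSpace V M]

theorem BivectorField.sharp_skew (π : BivectorField 𝓘(ℝ, V) M) (m : M)
    (a b : Cotangent 𝓘(ℝ, V) m) : b (π.sharp m a) = - a (π.sharp m b) := by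
  have h := π.alternating m (a + b)
  simp only [map_add, LinearMap.add_apply, π.alternating] at h
  linarith

theorem BivectorField.bracket_skew (π : BivectorField 𝓘(ℝ, V) M) (f g : M → ℝ) :
    π.bracket f g = - π.bracket g f := by
  funext m
  exact π.sharp_skew m _ _

theorem tangent_ext [FiniteDimensional ℝ V] {m : M} {v w : TangentSpace 𝓘(ℝ, V) m}
    (h : ∀ b : Cotangent 𝓘(ℝ, V) m, b v = b w) : v = w := by
  have h' : ∀ b : Module.Dual ℝ V, b (v - w : V) = 0 := fun b =>
    (map_sub b _ _).trans (sub_eq_zero.2 (h b))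
  exact sub_eq_zero.1 ((Module.forall_dual_apply_eq_zero_iff ℝ (v - w : V)).1 h')

variable {E G : Type*} [NormedAddCommGroup E] [NormedSpace ℝ E] [FiniteDimensional ℝ E]
  [TopologicalSpace G] [ChartedSpace E G] [Group G]
  {F Gs : Type*} [NormedAddCommGroup F] [NormedSpace ℝ F] [FiniteDimensional ℝ F] [CompleteSpace F]
  [TopologicalSpace Gs] [ChartedSpace F Gs] [Group Gs] [LieGroup 𝓘(ℝ, F) ∞ Gs]
  [MulAction G M]
  {p : GroupLieAlgebra 𝓘(ℝ, F) Gs ≃ₗ[ℝ] Module.Dual ℝ (GroupLieAlgebra 𝓘(ℝ, E) G)}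

/-- The minus sign in the definition of `ad^*` is absorbed by exchanging the arguments; the first
variation formula produces the bracket in this order. -/
theorem apply_coad (x y : GroupLieAlgebra 𝓘(ℝ, F) Gs) (ξ : GroupLieAlgebra 𝓘(ℝ, E) G) :
    p y (coad p x ξ) = p ⁅y, x⁆ ξ := by
  have : FiniteDimensional ℝ (GroupLieAlgebra 𝓘(ℝ, E) G) := inferInstanceAs (FiniteDimensional ℝ E)
  have h : Module.evalEquiv ℝ (GroupLieAlgebra 𝓘(ℝ, E) G) (coad p x ξ) (p y)
      = (-(toForm p ξ ∘ₗ (LieAlgebra.ad ℝ (GroupLieAlgebra 𝓘(ℝ, F) Gs) x) ∘ₗ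
        p.symm.toLinearMap)) (p y) := by
    rw [coad, LinearEquiv.apply_symm_apply]
  have e : p ⁅y, x⁆ ξ = - p ⁅x, y⁆ ξ := by rw [← lie_skew y x, map_neg, LinearMap.neg_apply]
  rw [e]
  simpa [toForm] using h

theorem momentForm_apply (μ : M → Gs) (ξ : GroupLieAlgebra 𝓘(ℝ, E) G) (m : M)
    (v : TangentSpace 𝓘(ℝ, V) m) :
    momentForm 𝓘(ℝ, V) p μ ξ m v
      = p (mcForm (μ m) (mfderiv 𝓘(ℝ, V) 𝓘(ℝ, F) μ m v)) ξ := rfl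

variable [FiniteDimensional ℝ V] [T2Space M] [IsManifold 𝓘(ℝ, V) ∞ M]

/-- Differentials of smooth functions exhaust the covectors at a point, so the identity on functions
is one between tangent vectors. -/
theorem bracketIdentity_iff {π : BivectorField 𝓘(ℝ, V) M} {X : M → GroupLieAlgebra 𝓘(ℝ, F) Gs} :
    BracketIdentity π p X ↔ ∀ (ξ : GroupLieAlgebra 𝓘(ℝ, E) G) (m : M),
      π.sharp m (dAt 𝓘(ℝ, V) (evalMap p X ξ) m)
        = - infGen 𝓘(ℝ, E) 𝓘(ℝ, V) (coad p (X m) ξ) m := by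
  refine ⟨fun h ξ m => tangent_ext fun b => ?_, fun h ξ f _ m => ?_⟩
  · obtain ⟨f, hf, rfl⟩ := exists_dAt_eq m b
    rw [map_neg]
    exact h ξ f hf m
  · rw [BivectorField.bracket, h, map_neg]
    rfl

variable [T2Space Gs]

/-- The derivative at `t = 0` of the momentum 1-forms of a deformation. -/
theorem hasDerivAt_momentForm {μ : ℝ → M → Gs} {X : M → GroupLieAlgebra 𝓘(ℝ, F) Gs}
    (hpath : ∀ m, ContMDiffAt (𝓘(ℝ, ℝ).prod 𝓘(ℝ, V)) 𝓘(ℝ, F) 2 (fun q : ℝ × M => μ q.1 q.2) (0, m))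
    (hXμ : ∀ m : M, EqToFirstOrder 𝓘(ℝ, F) (fun t => μ t m) (fun t => μ 0 m * lieExp (t • X m)))
    (ξ : GroupLieAlgebra 𝓘(ℝ, E) G) (m : M) (v : TangentSpace 𝓘(ℝ, V) m) :
    HasDerivAt (fun t => momentForm 𝓘(ℝ, V) p (μ t) ξ m v)
      (dAt 𝓘(ℝ, V) (evalMap p X ξ) m v + momentForm 𝓘(ℝ, V) p (μ 0) (coad p (X m) ξ) m v) 0 := by
  rw [momentForm_apply, apply_coad]
  refine hasDerivAt_pullback_leftInvForm (hpath m) (.of_forall fun m' => ?_) (toForm p ξ) v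
  exact mcForm_velocity_of_eqToFirstOrder
    (mdifferentiableAt_slice_left ((hpath m').mdifferentiableAt (by simp))) (hXμ m')

/-- The field generated by `μ_t` does not move with `t`, so `π♯` kills the first variation of the
momentum form. -/
theorem sharp_dAt_evalMap {π : BivectorField 𝓘(ℝ, V) M} {μ : ℝ → M → Gs}
    {X : M → GroupLieAlgebra 𝓘(ℝ, F) Gs}
    (hμ : ∀ᶠ t in 𝓝 (0 : ℝ), IsMomentumMap π p (μ t))
    (hpath : ∀ m, ContMDiffAt (𝓘(ℝ, ℝ).prod 𝓘(ℝ, V)) 𝓘(ℝ, F) 2 (fun q : ℝ × M => μ q.1 q.2) (0, m))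
    (hXμ : ∀ m : M, EqToFirstOrder 𝓘(ℝ, F) (fun t => μ t m) (fun t => μ 0 m * lieExp (t • X m)))
    (ξ : GroupLieAlgebra 𝓘(ℝ, E) G) (m : M) :
    π.sharp m (dAt 𝓘(ℝ, V) (evalMap p X ξ) m)
      = - infGen 𝓘(ℝ, E) 𝓘(ℝ, V) (coad p (X m) ξ) m := by
  refine tangent_ext fun b => ?_
  have h1 := hasDerivAt_momentForm (p := p) hpath hXμ ξ m (π.sharp m b)
  -- Evaluating on `π♯ b` and using skew-symmetry exposes `π♯` of the momentum form, that is `ξ_M`.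
  have h2 : (fun t => momentForm 𝓘(ℝ, V) p (μ t) ξ m (π.sharp m b)) =ᶠ[𝓝 0]
      fun _ => - b (infGen 𝓘(ℝ, E) 𝓘(ℝ, V) ξ m) := by
    filter_upwards [hμ] with t ht
    rw [ht.generates, π.sharp_skew]
  have h3 := h1.unique ((hasDerivAt_const _ _).congr_of_eventuallyEq h2)
  have h4 := π.sharp_skew m (dAt 𝓘(ℝ, V) (evalMap p X ξ) m) b
  have h5 := π.sharp_skew m (momentForm 𝓘(ℝ, V) p (μ 0) (coad p (X m) ξ) m) b
  rw [map_neg, hμ.self_of_nhds.generates]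
  linarith

end Pointwise

/-! ### Poisson maps and pairings of 1-forms -/

section PoissonMaps

variable {V M : Type*} [NormedAddCommGroup V] [NormedSpace ℝ V] [TopologicalSpace M]
  [ChartedSpace V M] [IsManifold 𝓘(ℝ, V) ∞ M]
  {F N : Type*} [NormedAddCommGroup F] [NormedSpace ℝ F] [TopologicalSpace N]
  [ChartedSpace F N] [IsManifold 𝓘(ℝ, F) ∞ N]

theorem IsPoissonMap.pullCov_sharp [FiniteDimensional ℝ F] [T2Space N]
    {π : BivectorField 𝓘(ℝ, V) M} {π' : BivectorField 𝓘(ℝ, F) N} {φ : M → N}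
    (h : IsPoissonMap π π' φ) (m : M) (a b : Cotangent 𝓘(ℝ, F) (φ m)) :
    b (π'.sharp (φ m) a)
      = pullCov 𝓘(ℝ, V) 𝓘(ℝ, F) φ m b (π.sharp m (pullCov 𝓘(ℝ, V) 𝓘(ℝ, F) φ m a)) := by
  obtain ⟨f, hf, rfl⟩ := exists_dAt_eq (φ m) a
  obtain ⟨g, hg, rfl⟩ := exists_dAt_eq (φ m) b
  have hφ : MDifferentiableAt 𝓘(ℝ, V) 𝓘(ℝ, F) φ m := h.1.mdifferentiableAt (by simp)
  rw [← dAt_comp (hf.mdifferentiableAt (by simp)) hφ, ← dAt_comp (hg.mdifferentiableAt (by simp)) hφ]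
  exact (congrFun (h.2 f g hf hg) m).symm

theorem pairing_eventuallyEq {π : BivectorField 𝓘(ℝ, V) M} {n n' : ℕ}
    {y h : Fin n → M → ℝ} {z k : Fin n' → M → ℝ} {m : M} {α β : ∀ m : M, Cotangent 𝓘(ℝ, V) m}
    (hα : ∀ᶠ x in 𝓝 m, α x = ∑ i, h i x • dAt 𝓘(ℝ, V) (y i) x)
    (hβ : ∀ᶠ x in 𝓝 m, β x = ∑ i, k i x • dAt 𝓘(ℝ, V) (z i) x) :
    (fun x => β x (π.sharp x (α x))) =ᶠ[𝓝 m]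
      fun x => ∑ i, ∑ j, k i x * (h j x * π.bracket (y j) (z i) x) := by
  filter_upwards [hα, hβ] with x h1 h2
  rw [h1, h2, LinearMap.sum_apply, map_sum]
  refine Finset.sum_congr rfl fun i _ => ?_
  rw [LinearMap.smul_apply, map_sum, smul_eq_mul, Finset.mul_sum]
  refine Finset.sum_congr rfl fun j _ => ?_
  rw [map_smul, map_smul, smul_eq_mul]
  rfl

/-- Smoothness of `π` is only known on brackets of functions, so the two forms are expanded in
differentials of smooth functions. -/
theorem mdifferentiableAt_pairing {π : BivectorField 𝓘(ℝ, V) M} (hπ : π.IsPoisson) {n n' : ℕ}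
    {y h : Fin n → M → ℝ} {z k : Fin n' → M → ℝ} {m : M} {α β : ∀ m : M, Cotangent 𝓘(ℝ, V) m}
    (hy : ∀ i, ContMDiff 𝓘(ℝ, V) 𝓘(ℝ, ℝ) ∞ (y i)) (hz : ∀ i, ContMDiff 𝓘(ℝ, V) 𝓘(ℝ, ℝ) ∞ (z i))
    (hh : ∀ i, MDifferentiableAt 𝓘(ℝ, V) 𝓘(ℝ, ℝ) (h i) m)
    (hk : ∀ i, MDifferentiableAt 𝓘(ℝ, V) 𝓘(ℝ, ℝ) (k i) m)
    (hα : ∀ᶠ x in 𝓝 m, α x = ∑ i, h i x • dAt 𝓘(ℝ, V) (y i) x)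
    (hβ : ∀ᶠ x in 𝓝 m, β x = ∑ i, k i x • dAt 𝓘(ℝ, V) (z i) x) :
    MDifferentiableAt 𝓘(ℝ, V) 𝓘(ℝ, ℝ) (fun x => β x (π.sharp x (α x))) m := by
  refine MDifferentiableAt.congr_of_eventuallyEq ?_ (pairing_eventuallyEq hα hβ)
  refine mdifferentiableAt_sum _ fun i _ => mdifferentiableAt_sum _ fun j _ => ?_
  exact (hk i).mul ((hh j).mul ((hπ.smooth _ _ (hy j) (hz i)).mdifferentiableAt (by simp)))

end PoissonMaps

/-! ### Poisson Lie groups -/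

section PoissonLieGroups

variable {E : Type*} [NormedAddCommGroup E] [NormedSpace ℝ E]
  {Γ : Type*} [TopologicalSpace Γ] [ChartedSpace E Γ] [Group Γ]

/-- The function `π(ā, b̄)` on a Lie group. -/
def biForm (π : BivectorField 𝓘(ℝ, E) Γ) (a b : Module.Dual ℝ (GroupLieAlgebra 𝓘(ℝ, E) Γ))
    (g : Γ) : ℝ :=
  leftInvForm b g (π.sharp g (leftInvForm a g))

theorem leftInvForm_add (a b : Module.Dual ℝ (GroupLieAlgebra 𝓘(ℝ, E) Γ)) (g : Γ) :
    leftInvForm (a + b) g = leftInvForm a g + leftInvForm b g := rfl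

theorem leftInvForm_smul (r : ℝ) (a : Module.Dual ℝ (GroupLieAlgebra 𝓘(ℝ, E) Γ)) (g : Γ) :
    leftInvForm (r • a) g = r • leftInvForm a g := rfl

/-- The bilinear form `π(ā, b̄)` at a point `g`. -/
def biFormAt (π : BivectorField 𝓘(ℝ, E) Γ) (g : Γ) :
    Module.Dual ℝ (GroupLieAlgebra 𝓘(ℝ, E) Γ) →ₗ[ℝ]
      Module.Dual ℝ (GroupLieAlgebra 𝓘(ℝ, E) Γ) →ₗ[ℝ] ℝ :=
  LinearMap.mk₂ ℝ (fun a b => biForm π a b g)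
    (fun a a' b => by simp [biForm, leftInvForm_add])
    (fun r a b => by simp [biForm, leftInvForm_smul])
    (fun a b b' => by simp [biForm, leftInvForm_add])
    (fun r a b => by simp [biForm, leftInvForm_smul])

/-- The transpose of the adjoint action of `v⁻¹`. -/
def adForm (a : Module.Dual ℝ (GroupLieAlgebra 𝓘(ℝ, E) Γ)) (v : Γ) :
    Module.Dual ℝ (GroupLieAlgebra 𝓘(ℝ, E) Γ) :=
  pullCov 𝓘(ℝ, E) 𝓘(ℝ, E) (fun k : Γ => k * v) 1 (leftInvForm a (1 * v))

variable [LieGroup 𝓘(ℝ, E) ∞ Γ]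

theorem pullCov_mul_left_leftInvForm (a : Module.Dual ℝ (GroupLieAlgebra 𝓘(ℝ, E) Γ)) (u v : Γ) :
    pullCov 𝓘(ℝ, E) 𝓘(ℝ, E) (fun k : Γ => u * k) v (leftInvForm a (u * v)) = leftInvForm a v := by
  refine LinearMap.ext fun w => ?_
  have h := mfderiv_comp_apply' (f := fun k : Γ => u * k) (g := fun k : Γ => (u * v)⁻¹ * k)
    (x := v) rfl (mdifferentiableAt_mul_left _ _) (mdifferentiableAt_mul_left _ _) w
  rw [show (fun k : Γ => (u * v)⁻¹ * k) ∘ (fun k : Γ => u * k) = fun k => v⁻¹ * k by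
    ext k; simp [mul_assoc]] at h
  exact (congrArg (fun z : E => (a : E → ℝ) z) h).symm

/-- Right translations commute with left ones, so the pulled back form is again left-invariant and
is determined at the identity. -/
theorem pullCov_mul_right_leftInvForm (a : Module.Dual ℝ (GroupLieAlgebra 𝓘(ℝ, E) Γ)) (u v : Γ) :
    pullCov 𝓘(ℝ, E) 𝓘(ℝ, E) (fun k : Γ => k * v) u (leftInvForm a (u * v))
      = leftInvForm (adForm a v) u := by
  refine LinearMap.ext fun w => ?_
  have h := mfderiv_comp_apply' (f := fun k : Γ => k * v) (g := fun k : Γ => (u * v)⁻¹ * k)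
    (x := u) rfl (mdifferentiableAt_mul_left _ _) (mdifferentiableAt_mul_right _ _) w
  have h1 := mfderiv_comp_apply' (f := fun k : Γ => u⁻¹ * k) (g := fun k : Γ => k * v)
    (x := u) (y := 1) (inv_mul_cancel u) (mdifferentiableAt_mul_right _ _)
    (mdifferentiableAt_mul_left _ _) w
  have h2 := mfderiv_comp_apply' (f := (fun k : Γ => k * v) ∘ fun k : Γ => u⁻¹ * k)
    (g := fun k : Γ => (1 * v)⁻¹ * k) (x := u) (y := 1 * v) (by simp)
    (mdifferentiableAt_mul_left _ _)
    ((mdifferentiableAt_mul_right _ _).comp u (mdifferentiableAt_mul_left _ _)) w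
  rw [show (fun k : Γ => (1 * v)⁻¹ * k) ∘ (fun k : Γ => k * v) ∘ (fun k : Γ => u⁻¹ * k)
    = (fun k : Γ => (u * v)⁻¹ * k) ∘ (fun k : Γ => k * v) by ext k; simp [mul_assoc]] at h2
  have h3 := h.symm.trans (h2.trans (congrArg (fun z : E => (mfderiv 𝓘(ℝ, E) 𝓘(ℝ, E)
    (fun k : Γ => (1 * v)⁻¹ * k) (1 * v) : E → E) z) h1))
  exact congrArg (fun z : E => (a : E → ℝ) z) h3

/-- Multiplicativity read in the left trivialization: the left-translated term keeps `a` and `b`,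
the right-translated one twists them by the adjoint action. -/
theorem biForm_mul {π : BivectorField 𝓘(ℝ, E) Γ} (hπ : IsPoissonLieGroup π)
    (a b : Module.Dual ℝ (GroupLieAlgebra 𝓘(ℝ, E) Γ)) (u v : Γ) :
    biForm π a b (u * v) = biForm π a b v + biForm π (adForm a v) (adForm b v) u := by
  have h := congrArg (leftInvForm b (u * v)) (hπ.multiplicative u v (leftInvForm a (u * v)))
  rw [map_add, pullCov_mul_left_leftInvForm, pullCov_mul_right_leftInvForm] at h
  refine h.trans (congrArg₂ (· + ·) ?_ ?_)
  · exact congrArg (fun T : Cotangent 𝓘(ℝ, E) v => T (π.sharp v (leftInvForm a v)))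
      (pullCov_mul_left_leftInvForm b u v)
  · exact congrArg (fun T : Cotangent 𝓘(ℝ, E) u => T (π.sharp u (leftInvForm (adForm a v) u)))
      (pullCov_mul_right_leftInvForm b u v)

theorem mcForm_mul_right_one {v : Γ} (hv : v = 1) (w : GroupLieAlgebra 𝓘(ℝ, E) Γ) :
    mcForm ((1 : Γ) * v) (mfderiv 𝓘(ℝ, E) 𝓘(ℝ, E) (fun k : Γ => k * v) 1 w) = w := by
  subst hv
  have h := mfderiv_comp_apply' (f := fun k : Γ => k * 1) (g := fun k : Γ => (1 * 1 : Γ)⁻¹ * k)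
    (x := 1) rfl (mdifferentiableAt_mul_left _ _) (mdifferentiableAt_mul_right _ _) w
  rw [show (fun k : Γ => (1 * 1 : Γ)⁻¹ * k) ∘ (fun k : Γ => k * 1) = id by ext; simp] at h
  exact h.symm.trans (mfderiv_id_apply' _ _)

/-- In a basis the bilinear form is a finite sum of products of scalar functions, so no norm on the
dual is needed and differentiability on each vector suffices. -/
theorem hasDerivAt_bilinear_dual {W : Type*} [AddCommGroup W] [Module ℝ W] [FiniteDimensional ℝ W]
    (B : Module.Dual ℝ W →ₗ[ℝ] Module.Dual ℝ W →ₗ[ℝ] ℝ) {α β : ℝ → Module.Dual ℝ W}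
    {α' β' : Module.Dual ℝ W} {t : ℝ} (hα : ∀ w, HasDerivAt (fun s => α s w) (α' w) t)
    (hβ : ∀ w, HasDerivAt (fun s => β s w) (β' w) t) :
    HasDerivAt (fun s => B (α s) (β s)) (B α' (β t) + B (α t) β') t := by
  let e := Module.finBasis ℝ W
  have hB : ∀ a b, B a b = ∑ i, ∑ j, a (e i) * (b (e j) * B (e.coord i) (e.coord j)) := by
    intro a b
    have hd : ∀ c : Module.Dual ℝ W, c = ∑ i, c (e i) • e.coord i := fun c =>
      (e.sum_dual_apply_smul_coord c).symm
    conv_lhs => rw [hd a, map_sum, LinearMap.sum_apply]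
    refine Finset.sum_congr rfl fun i _ => ?_
    rw [map_smul, LinearMap.smul_apply, smul_eq_mul, ← Finset.mul_sum]
    conv_lhs => rw [hd b, map_sum]
    simp only [map_smul, smul_eq_mul]
  rw [show (fun s => B (α s) (β s)) = _ from funext fun s => hB (α s) (β s), hB α', hB (α t)]
  refine (HasDerivAt.fun_sum fun i _ => HasDerivAt.fun_sum fun j _ =>
    (hα (e i)).mul ((hβ (e j)).mul_const _)).congr_deriv ?_
  simp only [← Finset.sum_add_distrib]

variable [FiniteDimensional ℝ E] [CompleteSpace E] [T2Space Γ]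

theorem mdifferentiableAt_biForm {π : BivectorField 𝓘(ℝ, E) Γ} (hπ : π.IsPoisson)
    (a b : Module.Dual ℝ (GroupLieAlgebra 𝓘(ℝ, E) Γ)) (u : Γ) :
    MDifferentiableAt 𝓘(ℝ, E) 𝓘(ℝ, ℝ) (biForm π a b) u := by
  obtain ⟨n, y, h, hy, hh, hdec, -⟩ := exists_leftInvForm_eq_sum (E := E) u
  exact mdifferentiableAt_pairing hπ hy hy (hh a) (hh b) (hdec.mono fun g hg => hg a)
    (hdec.mono fun g hg => hg b)

/-- The derivative of `π(ā, b̄)` along a curve in a Poisson Lie group. -/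
theorem hasDerivAt_biForm {π : BivectorField 𝓘(ℝ, E) Γ} (hπ : IsPoissonLieGroup π) {c : ℝ → Γ}
    (hc : ContMDiffAt 𝓘(ℝ, ℝ) 𝓘(ℝ, E) 2 c 0) {x : GroupLieAlgebra 𝓘(ℝ, E) Γ}
    (hx : mcForm (c 0) (velocity c 0) = x) (a b : Module.Dual ℝ (GroupLieAlgebra 𝓘(ℝ, E) Γ)) :
    HasDerivAt (fun t => biForm π a b (c t))
      (linearization π a b x
        + (biForm π (-(a ∘ₗ LieAlgebra.ad ℝ _ x)) b (c 0)
          + biForm π a (-(b ∘ₗ LieAlgebra.ad ℝ _ x)) (c 0))) 0 := by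
  have : FiniteDimensional ℝ (GroupLieAlgebra 𝓘(ℝ, E) Γ) :=
    inferInstanceAs (FiniteDimensional ℝ E)
  have hcd : MDifferentiableAt 𝓘(ℝ, ℝ) 𝓘(ℝ, E) c 0 := hc.mdifferentiableAt (by simp)
  -- The curve is factored as `c(0) v(t)` with `v(0) = 1`, so that multiplicativity reduces the
  -- derivative to the identity.
  set v : ℝ → Γ := fun t => (c 0)⁻¹ * c t with hv
  have hv0 : v 0 = 1 := inv_mul_cancel _
  have hvd : MDifferentiableAt 𝓘(ℝ, ℝ) 𝓘(ℝ, E) v 0 := (mdifferentiableAt_mul_left _ _).comp 0 hcd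
  have hvv : (velocity v 0 : E) = x :=
    (mfderiv_comp_apply' (f := c) (g := fun k : Γ => (c 0)⁻¹ * k) (x := 0) rfl
      (mdifferentiableAt_mul_left _ _) hcd (1 : ℝ)).trans hx
  have h1 := hasDerivAt_comp_curve (mdifferentiableAt_biForm hπ.poisson a b (v 0)) hvd
  have h1' : dAt 𝓘(ℝ, E) (biForm π a b) (v 0) (velocity v 0) = linearization π a b x := by
    refine (mfderiv_apply_congr_point (biForm π a b) hv0 (velocity v 0)).trans ?_
    exact congrArg (fun z : E => (mfderiv 𝓘(ℝ, E) 𝓘(ℝ, ℝ) (biForm π a b) 1 : E → ℝ) z) hvv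
  rw [h1'] at h1
  have hF : ContMDiffAt (𝓘(ℝ, ℝ).prod 𝓘(ℝ, E)) 𝓘(ℝ, E) 2
      (fun q : ℝ × Γ => q.2 * v q.1) (0, 1) := by
    have : LieGroup 𝓘(ℝ, E) 2 Γ := LieGroup.of_le (n := ∞) ENat.LEInfty.out
    refine contMDiffAt_snd.mul ((contMDiffAt_const (c := (c 0)⁻¹)).mul ?_)
    exact ContMDiffAt.comp (g := c) (0, 1) hc contMDiffAt_fst
  -- The twisted form is the pullback of a left-invariant form by right translation by `v(t)`. The
  -- first variation formula with constant `X = x` therefore differentiates the adjoint action.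
  have hA : ∀ (a : Module.Dual ℝ (GroupLieAlgebra 𝓘(ℝ, E) Γ)) (w : GroupLieAlgebra 𝓘(ℝ, E) Γ),
      HasDerivAt (fun t => adForm a (v t) w)
        ((-(a ∘ₗ LieAlgebra.ad ℝ _ x)) w) 0 := fun a w => by
    have hG := hasDerivAt_pullback_leftInvForm (F := fun t (k : Γ) => k * v t) (m := 1) hF
      (X := fun _ => x) (.of_forall fun k => ?_) a w
    · refine hG.congr_deriv ?_
      have hc0 : dAt 𝓘(ℝ, E) (fun _ : Γ => a x) 1 w = 0 := by
        have := mfderiv_const (I := 𝓘(ℝ, E)) (I' := 𝓘(ℝ, ℝ)) (c := a x) (x := (1 : Γ))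
        exact congrArg (fun T : E →L[ℝ] ℝ => T w) this
      rw [hc0, mcForm_mul_right_one hv0, zero_add, ← lie_skew, map_neg]
      rfl
    · have h2 := mfderiv_comp_apply' (f := v) (g := fun g : Γ => k * g) (x := 0) rfl
        (mdifferentiableAt_mul_left _ _) hvd (1 : ℝ)
      have h3 : ∀ z : E, (mcForm (k * v 0) : E → E)
          ((mfderiv 𝓘(ℝ, E) 𝓘(ℝ, E) (fun g : Γ => k * g) (v 0) : E → E) z) = z := by
        rw [hv0]
        intro z
        have h4 := mfderiv_comp_apply' (f := fun g : Γ => k * g)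
          (g := fun g : Γ => (k * 1)⁻¹ * g) (x := 1) rfl
          (mdifferentiableAt_mul_left _ _) (mdifferentiableAt_mul_left _ _) z
        rw [show (fun g : Γ => (k * 1)⁻¹ * g) ∘ (fun g : Γ => k * g) = id by ext; simp] at h4
        exact h4.symm.trans (mfderiv_id_apply' _ _)
      refine (congrArg (fun z : E => (mcForm (k * v 0) : E → E) z) h2).trans ?_
      exact (h3 _).trans hvv
  have hA0 : ∀ a : Module.Dual ℝ (GroupLieAlgebra 𝓘(ℝ, E) Γ), adForm a (v 0) = a := fun a =>
    LinearMap.ext fun w => congrArg a (mcForm_mul_right_one hv0 w)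
  have h2 := hasDerivAt_bilinear_dual (biFormAt π (c 0)) (hA a) (hA b)
  rw [hA0, hA0] at h2
  refine (h1.add h2).congr_of_eventuallyEq (.of_forall fun t => ?_)
  have h5 := biForm_mul hπ a b (c 0) (v t)
  rw [show c 0 * v t = c t by simp [hv]] at h5
  exact h5

end PoissonLieGroups

/-! ### The cocycle identity for deformations through Poisson maps -/

section Cocycle

variable {V M : Type*} [NormedAddCommGroup V] [NormedSpace ℝ V] [FiniteDimensional ℝ V]
  [TopologicalSpace M] [ChartedSpace V M] [IsManifold 𝓘(ℝ, V) ∞ M] [T2Space M]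
  {E G : Type*} [NormedAddCommGroup E] [NormedSpace ℝ E] [FiniteDimensional ℝ E]
  [TopologicalSpace G] [ChartedSpace E G] [Group G] [CompleteSpace E] [LieGroup 𝓘(ℝ, E) ∞ G]
  {F Gs : Type*} [NormedAddCommGroup F] [NormedSpace ℝ F] [FiniteDimensional ℝ F] [CompleteSpace F]
  [TopologicalSpace Gs] [ChartedSpace F Gs] [Group Gs] [LieGroup 𝓘(ℝ, F) ∞ Gs] [T2Space Gs]
  [MulAction G M]
  {p : GroupLieAlgebra 𝓘(ℝ, F) Gs ≃ₗ[ℝ] Module.Dual ℝ (GroupLieAlgebra 𝓘(ℝ, E) G)}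

theorem toForm_comp_ad (x : GroupLieAlgebra 𝓘(ℝ, F) Gs) (ξ : GroupLieAlgebra 𝓘(ℝ, E) G) :
    -(toForm p ξ ∘ₗ LieAlgebra.ad ℝ _ x) = toForm p (coad p x ξ) := by
  refine LinearMap.ext fun y => ?_
  have h : p y (coad p x ξ) = - p ⁅x, y⁆ ξ := by
    rw [apply_coad, ← lie_skew y x, map_neg, LinearMap.neg_apply]
  simpa [toForm] using h.symm

theorem biForm_toForm {π : BivectorField 𝓘(ℝ, V) M} {πGs : BivectorField 𝓘(ℝ, F) Gs} {μ : M → Gs}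
    (hμ : IsMomentumMap π p μ) (hP : IsPoissonMap π πGs μ) (ξ η : GroupLieAlgebra 𝓘(ℝ, E) G)
    (m : M) : biForm πGs (toForm p ξ) (toForm p η) (μ m)
      = momentForm 𝓘(ℝ, V) p μ η m (infGen 𝓘(ℝ, E) 𝓘(ℝ, V) ξ m) := by
  rw [hμ.generates]
  exact hP.pullCov_sharp m _ _

/-- Two computations of the derivative of `π_{G^*}(θ_ξ, θ_η)` along `t ↦ μ_t(m)` are compared: it is
zero since the `μ_t` are Poisson momentum maps for one action, and it is given by the Poisson Lie
structure. -/
theorem lieDer_evalMap_sub {πG : BivectorField 𝓘(ℝ, E) G} {π : BivectorField 𝓘(ℝ, V) M}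
    {πGs : BivectorField 𝓘(ℝ, F) Gs} (hπGs : IsPoissonLieGroup πGs) (hdual : IsDualPair πG πGs p)
    {μ : ℝ → M → Gs} {X : M → GroupLieAlgebra 𝓘(ℝ, F) Gs}
    (hμ : ∀ᶠ t in 𝓝 (0 : ℝ), IsMomentumMap π p (μ t) ∧ IsPoissonMap π πGs (μ t))
    (hpath : ∀ m, ContMDiffAt (𝓘(ℝ, ℝ).prod 𝓘(ℝ, V)) 𝓘(ℝ, F) 2 (fun q : ℝ × M => μ q.1 q.2) (0, m))
    (hXμ : ∀ m : M, EqToFirstOrder 𝓘(ℝ, F) (fun t => μ t m) (fun t => μ 0 m * lieExp (t • X m)))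
    (ξ η : GroupLieAlgebra 𝓘(ℝ, E) G) (m : M) :
    lieDer 𝓘(ℝ, E) 𝓘(ℝ, V) ξ (evalMap p X η) m - lieDer 𝓘(ℝ, E) 𝓘(ℝ, V) η (evalMap p X ξ) m
      = evalMap p X ⁅ξ, η⁆ m := by
  have hμ0 := hμ.self_of_nhds
  have hg := hμ0.1.generates
  have hs := sharp_dAt_evalMap (p := p) (hμ.mono fun t ht => ht.1) hpath hXμ
  have hc : ContMDiffAt 𝓘(ℝ, ℝ) 𝓘(ℝ, F) 2 (fun t => μ t m) 0 :=
    (hpath m).comp (0 : ℝ) (contMDiffAt_id.prodMk contMDiffAt_const)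
  have hx := mcForm_velocity_of_eqToFirstOrder (hc.mdifferentiableAt (by simp)) (hXμ m)
  have h1 := hasDerivAt_biForm hπGs hc hx (toForm p ξ) (toForm p η)
  -- The dependence on `t` is removed by writing `ξ_M` through `μ_0` and `η_M` through `μ_t`, with
  -- skew-symmetry in between.
  have h2 : (fun t => biForm πGs (toForm p ξ) (toForm p η) (μ t m)) =ᶠ[𝓝 0]
      fun _ => - momentForm 𝓘(ℝ, V) p (μ 0) ξ m (infGen 𝓘(ℝ, E) 𝓘(ℝ, V) η m) := by
    filter_upwards [hμ] with t ht
    rw [biForm_toForm ht.1 ht.2, hg ξ, π.sharp_skew, ← ht.1.generates]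
  have h3 := h1.unique ((hasDerivAt_const _ _).congr_of_eventuallyEq h2)
  rw [toForm_comp_ad, toForm_comp_ad, ← hdual.bracket_self, biForm_toForm hμ0.1 hμ0.2,
    biForm_toForm hμ0.1 hμ0.2] at h3
  -- The bracket identity replaces the generator of `ad^*_X ξ` by `-π♯ dX(ξ)`.
  have h4 : momentForm 𝓘(ℝ, V) p (μ 0) η m (infGen 𝓘(ℝ, E) 𝓘(ℝ, V) (coad p (X m) ξ) m)
      = lieDer 𝓘(ℝ, E) 𝓘(ℝ, V) η (evalMap p X ξ) m := by
    rw [← neg_eq_iff_eq_neg.2 (hs ξ m), map_neg, π.sharp_skew, neg_neg, ← hg]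
    rfl
  have h5 : momentForm 𝓘(ℝ, V) p (μ 0) (coad p (X m) η) m (infGen 𝓘(ℝ, E) 𝓘(ℝ, V) ξ m)
      = - lieDer 𝓘(ℝ, E) 𝓘(ℝ, V) ξ (evalMap p X η) m := by
    rw [hg ξ, π.sharp_skew, ← hg, ← neg_eq_iff_eq_neg.2 (hs η m), map_neg, π.sharp_skew, neg_neg,
      ← hg]
    rfl
  rw [h4, h5] at h3
  have h6 : p (X m) ⁅ξ, η⁆ = evalMap p X ⁅ξ, η⁆ m := rfl
  linarith

end Cocycle

/-! ### Trivial infinitesimal deformations -/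

section Trivial

variable {V M : Type*} [NormedAddCommGroup V] [NormedSpace ℝ V] [FiniteDimensional ℝ V]
  [TopologicalSpace M] [ChartedSpace V M] [IsManifold 𝓘(ℝ, V) ∞ M] [T2Space M]
  {E G : Type*} [NormedAddCommGroup E] [NormedSpace ℝ E] [FiniteDimensional ℝ E]
  [TopologicalSpace G] [ChartedSpace E G] [Group G]
  {F Gs : Type*} [NormedAddCommGroup F] [NormedSpace ℝ F] [FiniteDimensional ℝ F] [CompleteSpace F]
  [TopologicalSpace Gs] [ChartedSpace F Gs] [Group Gs] [LieGroup 𝓘(ℝ, F) ∞ Gs] [T2Space Gs]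
  [MulAction G M]
  {p : GroupLieAlgebra 𝓘(ℝ, F) Gs ≃ₗ[ℝ] Module.Dual ℝ (GroupLieAlgebra 𝓘(ℝ, E) G)}
  {π : BivectorField 𝓘(ℝ, V) M} {μ : M → Gs}

/-- Local expression of the momentum 1-forms, with the Maurer-Cartan equation. -/
theorem exists_momentForm_eq_sum (hμ : ContMDiff 𝓘(ℝ, V) 𝓘(ℝ, F) ∞ μ) (m : M) :
    ∃ (n : ℕ) (Y : Fin n → M → ℝ) (H : GroupLieAlgebra 𝓘(ℝ, E) G → Fin n → M → ℝ),
      (∀ i, ContMDiff 𝓘(ℝ, V) 𝓘(ℝ, ℝ) ∞ (Y i)) ∧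
      (∀ ξ i, MDifferentiableAt 𝓘(ℝ, V) 𝓘(ℝ, ℝ) (H ξ i) m) ∧
      (∀ᶠ x in 𝓝 m, ∀ ξ, momentForm 𝓘(ℝ, V) p μ ξ x = ∑ i, H ξ i x • dAt 𝓘(ℝ, V) (Y i) x) ∧
      (∀ (ξ : GroupLieAlgebra 𝓘(ℝ, E) G) (A B : TangentSpace 𝓘(ℝ, V) m),
        ∑ i, (dAt 𝓘(ℝ, V) (H ξ i) m A * dAt 𝓘(ℝ, V) (Y i) m B
          - dAt 𝓘(ℝ, V) (H ξ i) m B * dAt 𝓘(ℝ, V) (Y i) m A)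
        = - p ⁅mcForm (μ m) (mfderiv 𝓘(ℝ, V) 𝓘(ℝ, F) μ m A),
            mcForm (μ m) (mfderiv 𝓘(ℝ, V) 𝓘(ℝ, F) μ m B)⁆ ξ) := by
  obtain ⟨n, y, h, hy, hh, hdec, hmc⟩ := exists_leftInvForm_eq_sum (E := F) (μ m)
  have hμd : ∀ x, MDifferentiableAt 𝓘(ℝ, V) 𝓘(ℝ, F) μ x := fun x => hμ.mdifferentiableAt (by simp)
  have hyd : ∀ i x, MDifferentiableAt 𝓘(ℝ, F) 𝓘(ℝ, ℝ) (y i) x := fun i x =>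
    (hy i).mdifferentiableAt (by simp)
  refine ⟨n, fun i => y i ∘ μ, fun ξ i => h (toForm p ξ) i ∘ μ, fun i => (hy i).comp hμ,
    fun ξ i => (hh _ i).comp m (hμd m), ?_, fun ξ A B => ?_⟩
  · filter_upwards [hμ.continuous.continuousAt.eventually hdec] with x hx ξ
    simp only [dAt_comp (hyd _ _) (hμd x), momentForm, hx]
    refine LinearMap.ext fun v => ?_
    refine (LinearMap.sum_apply _ _ _).trans ?_
    rw [LinearMap.sum_apply]
    rfl
  · simp only [dAt_comp (hyd _ _) (hμd m), dAt_comp (hh _ _) (hμd m)]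
    exact hmc (toForm p ξ) _ _

theorem dAt_neg {f : M → ℝ} (hf : ContMDiff 𝓘(ℝ, V) 𝓘(ℝ, ℝ) ∞ f) (m : M) :
    dAt 𝓘(ℝ, V) (-f) m = - dAt 𝓘(ℝ, V) f m := by
  have h := dAt_smul (L := 𝓘(ℝ, V)) (-1) hf m
  rw [neg_one_smul] at h
  exact LinearMap.ext fun v => (LinearMap.congr_fun h v).trans (neg_one_mul _)

/-- If `Y(ξ) = 𝓛_ξ Φ` and `Y` satisfies the bracket identity, then `{Φ, ·}` commutes with the
infinitesimal action. -/
theorem lieDer_bracket_of_coboundary (hπ : π.IsPoisson) (hμ : IsMomentumMap π p μ)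
    {Y : M → GroupLieAlgebra 𝓘(ℝ, F) Gs} (hY : BracketIdentity π p Y)
    {Φ : M → ℝ} (hΦ : ContMDiff 𝓘(ℝ, V) 𝓘(ℝ, ℝ) ∞ Φ)
    (hYΦ : ∀ (ξ : GroupLieAlgebra 𝓘(ℝ, E) G) (m : M),
      evalMap p Y ξ m = lieDer 𝓘(ℝ, E) 𝓘(ℝ, V) ξ Φ m)
    (ξ : GroupLieAlgebra 𝓘(ℝ, E) G) {f : M → ℝ} (hf : ContMDiff 𝓘(ℝ, V) 𝓘(ℝ, ℝ) ∞ f) (m : M) :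
    lieDer 𝓘(ℝ, E) 𝓘(ℝ, V) ξ (π.bracket Φ f) m
      = π.bracket Φ (lieDer 𝓘(ℝ, E) 𝓘(ℝ, V) ξ f) m := by
  obtain ⟨n, Yf, H, hYf, hH, hdec, hmc⟩ := exists_momentForm_eq_sum (p := p) hμ.smooth m
  -- Since `ξ_M = π♯ α_ξ`, the operator `𝓛_ξ` is locally `∑ H_i {Y_i, ·}`, to which Jacobi applies
  -- term by term.
  have hlie : ∀ g : M → ℝ, lieDer 𝓘(ℝ, E) 𝓘(ℝ, V) ξ g =ᶠ[𝓝 m]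
      fun x => ∑ i, H ξ i x * π.bracket (Yf i) g x := fun g => by
    filter_upwards [hdec] with x hx
    simp only [lieDer, vfApply, hμ.generates, hx]
    rw [map_sum, map_sum]
    refine Finset.sum_congr rfl fun i _ => ?_
    rw [map_smul, map_smul]
    rfl
  have hsm : ∀ (g : M → ℝ), ContMDiff 𝓘(ℝ, V) 𝓘(ℝ, ℝ) ∞ g → ∀ i,
      MDifferentiableAt 𝓘(ℝ, V) 𝓘(ℝ, ℝ) (π.bracket (Yf i) g) m := fun g hg i =>
    (hπ.smooth _ _ (hYf i) hg).mdifferentiableAt (by simp)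
  have hdl : ∀ g : M → ℝ, ContMDiff 𝓘(ℝ, V) 𝓘(ℝ, ℝ) ∞ g → ∀ A : TangentSpace 𝓘(ℝ, V) m,
      dAt 𝓘(ℝ, V) (lieDer 𝓘(ℝ, E) 𝓘(ℝ, V) ξ g) m A
        = ∑ i, (H ξ i m * dAt 𝓘(ℝ, V) (π.bracket (Yf i) g) m A
          + π.bracket (Yf i) g m * dAt 𝓘(ℝ, V) (H ξ i) m A) := fun g hg A => by
    have hfd : ∀ i, MDifferentiableAt 𝓘(ℝ, V) 𝓘(ℝ, ℝ)
      (fun x => H ξ i x * π.bracket (Yf i) g x) m := fun i => (hH ξ i).mul (hsm g hg i)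
    rw [dAt_congr (hlie g), dAt_sum _ fun i _ => hfd i, LinearMap.sum_apply]
    refine Finset.sum_congr rfl fun i _ => ?_
    rw [dAt_mul (hH ξ i) (hsm g hg i)]
    rfl
  set A : TangentSpace 𝓘(ℝ, V) m := π.sharp m (dAt 𝓘(ℝ, V) Φ m) with hA
  set B : TangentSpace 𝓘(ℝ, V) m := π.sharp m (dAt 𝓘(ℝ, V) f m) with hB
  have e1 := (hlie (π.bracket Φ f)).self_of_nhds
  have e2 : π.bracket Φ (lieDer 𝓘(ℝ, E) 𝓘(ℝ, V) ξ f) m = _ := hdl f hf A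
  have e3 := hdl Φ hΦ B
  -- Here the bracket identity enters, through `𝓛_ξ Φ = Y(ξ)`.
  have e3' : dAt 𝓘(ℝ, V) (lieDer 𝓘(ℝ, E) 𝓘(ℝ, V) ξ Φ) m B
      = lieDer 𝓘(ℝ, E) 𝓘(ℝ, V) (coad p (Y m) ξ) f m := by
    rw [show lieDer 𝓘(ℝ, E) 𝓘(ℝ, V) ξ Φ = evalMap p Y ξ from funext fun x => (hYΦ ξ x).symm,
      hB, π.sharp_skew]
    have h := hY ξ f hf m
    rw [BivectorField.bracket] at h
    rw [h, neg_neg]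
  -- The Hamiltonian field of `Φ` moves `μ` by `-Y`, so the Maurer-Cartan term below is again the
  -- Lie derivative of `f` along `ad^*_Y ξ`.
  have hθ : mcForm (μ m) (mfderiv 𝓘(ℝ, V) 𝓘(ℝ, F) μ m A) = - Y m := by
    apply p.injective
    refine LinearMap.ext fun ζ => ?_
    rw [← momentForm_apply, hA, π.sharp_skew, ← hμ.generates, map_neg, LinearMap.neg_apply]
    exact congrArg Neg.neg (hYΦ ζ m).symm
  have e4 := hmc ξ A B
  rw [hθ, neg_lie, map_neg, LinearMap.neg_apply, neg_neg, ← lie_skew, map_neg, LinearMap.neg_apply,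
    ← apply_coad, ← momentForm_apply, hB, π.sharp_skew, neg_neg, ← hμ.generates, ← hB] at e4
  have e4' : _ = lieDer 𝓘(ℝ, E) 𝓘(ℝ, V) (coad p (Y m) ξ) f m := e4
  -- Equating the two expressions gives, up to signs in the brackets, `∑ H_i B{Y_i, Φ} = ∑ A(H_i)
  -- B(Y_i)`, which is exactly the defect left over by Jacobi.
  rw [← e4', e3] at e3'
  have hYA : ∀ i, π.bracket (Yf i) Φ m = - dAt 𝓘(ℝ, V) (Yf i) m A := fun i => π.sharp_skew m _ _
  have hYB : ∀ i, π.bracket (Yf i) f m = - dAt 𝓘(ℝ, V) (Yf i) m B := fun i => π.sharp_skew m _ _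
  have hj : ∀ i, π.bracket (Yf i) (π.bracket Φ f) m
      = dAt 𝓘(ℝ, V) (π.bracket (Yf i) f) m A - dAt 𝓘(ℝ, V) (π.bracket (Yf i) Φ) m B := fun i => by
    have h := hπ.jacobi (Yf i) Φ f (hYf i) hΦ hf m
    rw [π.bracket_skew f (Yf i)] at h
    have h2 : π.bracket Φ (-π.bracket (Yf i) f) m = - dAt 𝓘(ℝ, V) (π.bracket (Yf i) f) m A := by
      rw [BivectorField.bracket, dAt_neg (hπ.smooth _ _ (hYf i) hf)]
      rfl
    have h3 : π.bracket f (π.bracket (Yf i) Φ) m = dAt 𝓘(ℝ, V) (π.bracket (Yf i) Φ) m B := rfl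
    linarith
  rw [e1, e2, ← sub_eq_zero, ← Finset.sum_sub_distrib]
  rw [← sub_eq_zero, ← Finset.sum_sub_distrib] at e3'
  rw [← neg_eq_zero, ← Finset.sum_neg_distrib, ← e3']
  refine Finset.sum_congr rfl fun i _ => ?_
  rw [hj, hYA, hYB]
  ring

/-- Invariance is the preceding lemma, preservation of `π` is the Jacobi identity, and generation of
`Y` is skew-symmetry of `π` applied to `α_ξ` and `dΦ`. -/
theorem isTrivialDeformation_of_coboundary (hπ : π.IsPoisson) (hμ : IsMomentumMap π p μ)
    {Y : M → GroupLieAlgebra 𝓘(ℝ, F) Gs} (hY : BracketIdentity π p Y)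
    {Φ : M → ℝ} (hΦ : ContMDiff 𝓘(ℝ, V) 𝓘(ℝ, ℝ) ∞ Φ)
    (hYΦ : ∀ (ξ : GroupLieAlgebra 𝓘(ℝ, E) G) (m : M),
      evalMap p Y ξ m = lieDer 𝓘(ℝ, E) 𝓘(ℝ, V) ξ Φ m) :
    IsTrivialDeformation π p μ Y (fun m => - hamiltonianVF π Φ m) := by
  have hW : ∀ f : M → ℝ, vfApply 𝓘(ℝ, V) (fun m => - hamiltonianVF π Φ m) f = - π.bracket Φ f :=
    fun f => funext fun m => map_neg (dAt 𝓘(ℝ, V) f m) _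
  refine ⟨fun ξ f hf => ?_, fun f g hf hg => ?_, fun ξ m => ?_⟩
  · rw [hW, hW]
    funext m
    rw [Pi.neg_apply, ← lieDer_bracket_of_coboundary hπ hμ hY hΦ hYΦ ξ hf m]
    simp only [lieDer, vfApply]
    rw [dAt_neg (hπ.smooth _ _ hΦ hf)]
    rfl
  · rw [hW, hW, hW]
    funext m
    have h := hπ.jacobi Φ f g hΦ hf hg m
    have h1 : π.bracket (-π.bracket Φ f) g m = π.bracket g (π.bracket Φ f) m := by
      rw [π.bracket_skew, Pi.neg_apply, BivectorField.bracket, dAt_neg (hπ.smooth _ _ hΦ hf)]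
      exact neg_neg _
    have h2 : π.bracket f (-π.bracket Φ g) m = π.bracket f (π.bracket g Φ) m := by
      rw [π.bracket_skew g Φ]
    rw [Pi.neg_apply, Pi.add_apply, h1, h2]
    linarith
  · refine (hYΦ ξ m).trans ?_
    rw [map_neg, hamiltonianVF, π.sharp_skew, neg_neg, ← hμ.generates]
    rfl

theorem infClass_eq_zero_iff (hπ : π.IsPoisson) [LieGroup 𝓘(ℝ, E) ∞ G] [CompleteSpace E]
    (hμ : IsMomentumMap π p μ) (Y : infDeformations π p) :
    infClass π p Y = 0 ↔ IsHamiltonianTrivial π p μ Y.1 := by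
  have h : infClass π p Y = 0 ↔ evalMap p Y.1 ∈ coboundaries 𝓘(ℝ, E) G 𝓘(ℝ, V) M :=
    Submodule.Quotient.mk_eq_zero _
  rw [h]
  constructor
  · rintro ⟨-, Φ, hΦ, hYΦ⟩
    exact ⟨Φ, hΦ, hYΦ, isTrivialDeformation_of_coboundary hπ hμ Y.2.2 hΦ hYΦ⟩
  · rintro ⟨Φ, hΦ, hYΦ, -⟩
    exact ⟨Y.2.1.1, Φ, hΦ, hYΦ⟩

end Trivial

/-! ### Gluing of local primitives on a simply connected space -/

section Gluing

variable {B A : Type*} [TopologicalSpace B] [AddCommGroup A]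

/-- The bundle of germs of primitives: the fibre is discrete, and the transition functions are
the locally constant differences of the local primitives. -/
def primitiveBundle [TopologicalSpace A] [DiscreteTopology A] (U : B → Set B)
    (hU : ∀ i, IsOpen (U i)) (hxU : ∀ x, x ∈ U x) (P : B → B → A)
    (hP : ∀ i j, ∀ x ∈ U i ∩ U j, ∀ᶠ y in 𝓝 x, P i y - P j y = P i x - P j x) :
    FiberBundleCore B B A where
  baseSet := U
  isOpen_baseSet := hU
  indexAt := id
  mem_baseSet_at := hxU
  coordChange i j x a := a + (P i x - P j x)
  coordChange_self i x _ a := by simp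
  continuousOn_coordChange i j := by
    rintro ⟨x, a⟩ ⟨hx, -⟩
    refine ContinuousAt.continuousWithinAt ?_
    refine (continuousAt_const (y := a + (P i x - P j x))).congr ?_
    have h1 : ∀ᶠ q : B × A in 𝓝 (x, a), P i q.1 - P j q.1 = P i x - P j x :=
      (continuous_fst.tendsto (x, a)).eventually (hP i j x hx)
    have h2 : ∀ᶠ q : B × A in 𝓝 (x, a), q.2 = a :=
      (continuous_snd.tendsto (x, a)).eventually ((isOpen_discrete {a}).mem_nhds rfl)
    filter_upwards [h1, h2] with q h1 h2
    rw [h1, h2]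
  coordChange_comp i j k x _ a := by abel

/-- On a simply connected space, functions given locally up to a locally constant function come
from a global function. -/
theorem exists_glue_of_simplyConnected [SimplyConnectedSpace B] [LocallyPathConnectedSpace B]
    (U : B → Set B) (hU : ∀ i, IsOpen (U i)) (hxU : ∀ x, x ∈ U x) (P : B → B → A)
    (hP : ∀ i j, ∀ x ∈ U i ∩ U j, ∀ᶠ y in 𝓝 x, P i y - P j y = P i x - P j x) :
    ∃ Φ : B → A, ∀ x, ∀ᶠ y in 𝓝 x, Φ y - Φ x = P x y - P x x := by
  let _ : TopologicalSpace A := ⊥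
  have : DiscreteTopology A := ⟨rfl⟩
  let Z := primitiveBundle U hU hxU P hP
  have hcov : IsCoveringMap (Bundle.TotalSpace.proj : Z.TotalSpace → B) :=
    FiberBundle.isCoveringMap (F := A) (E := Z.Fiber)
  obtain ⟨x₀⟩ : Nonempty B := inferInstance
  -- With discrete fibres the bundle is a covering, so the identity of the simply connected base
  -- lifts to a global section.
  obtain ⟨σ, ⟨-, hσ⟩, -⟩ := hcov.existsUnique_continuousMap_lifts (ContinuousMap.id B) x₀
    (⟨x₀, (0 : A)⟩ : Z.TotalSpace) rfl
  have hσ1 : ∀ y, (σ y).1 = y := fun y => congrFun hσ y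
  let s : B → A := fun y => (σ y).2
  -- The coordinate `s y` refers to the trivialization indexed by `y` itself. In the one indexed by
  -- `x` it becomes `s y + P y y - P x y`, which is locally constant at `x` by continuity into a
  -- discrete space.
  refine ⟨fun y => P y y + s y, fun x => ?_⟩
  have hc : ContinuousAt (fun y => ((Z.localTriv x) (σ y)).2) x := by
    have h1 : ContinuousAt (Z.localTriv x) (σ x) :=
      (Z.localTriv x).continuousAt ((Z.mem_localTriv_source x (σ x)).2
        (show (σ x).1 ∈ U x by rw [hσ1]; exact hxU x))
    exact continuous_snd.continuousAt.comp (h1.comp σ.continuous.continuousAt)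
  have he : ∀ y, ((Z.localTriv x) (σ y)).2 = s y + (P y y - P x y) := fun y => by
    rw [Z.localTriv_apply]
    change s y + (P (σ y).1 (σ y).1 - P x (σ y).1) = _
    rw [hσ1]
  have h3 := hc.eventually ((isOpen_discrete {_}).mem_nhds rfl)
  filter_upwards [h3] with y hy
  simp only [he] at hy
  have : P y y + s y - (P x x + s x) = (s y + (P y y - P x y)) - (s x + (P x x - P x x))
    + (P x y - P x x) := by abel
  rw [this, hy, sub_self, zero_add]

end Gluing

/-! ### Functions with zero differential -/

section LocallyConstant

variable {E : Type*} [NormedAddCommGroup E] [NormedSpace ℝ E]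
  {M : Type*} [TopologicalSpace M] [ChartedSpace E M] [IsManifold 𝓘(ℝ, E) ∞ M]

theorem dAt_sub {f g : M → ℝ} {m : M} (hf : MDifferentiableAt 𝓘(ℝ, E) 𝓘(ℝ, ℝ) f m)
    (hg : MDifferentiableAt 𝓘(ℝ, E) 𝓘(ℝ, ℝ) g m) :
    dAt 𝓘(ℝ, E) (f - g) m = dAt 𝓘(ℝ, E) f m - dAt 𝓘(ℝ, E) g m :=
  congrArg (fun T : E →L[ℝ] ℝ => T.toLinearMap) (mfderiv_sub hf hg)

/-- The derivative of a function read in a chart. -/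
theorem hasFDerivAt_comp_extChartAt_symm (u : M) {f : M → ℝ} {x : E}
    (hx : x ∈ (extChartAt 𝓘(ℝ, E) u).target)
    (hf : MDifferentiableAt 𝓘(ℝ, E) 𝓘(ℝ, ℝ) f ((extChartAt 𝓘(ℝ, E) u).symm x)) :
    HasFDerivAt (f ∘ (extChartAt 𝓘(ℝ, E) u).symm)
      ((mfderiv 𝓘(ℝ, E) 𝓘(ℝ, ℝ) f ((extChartAt 𝓘(ℝ, E) u).symm x) : E →L[ℝ] ℝ) ∘L
        (mfderiv 𝓘(ℝ, E) 𝓘(ℝ, E) (extChartAt 𝓘(ℝ, E) u).symm x : E →L[ℝ] E)) x :=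
  (hf.hasMFDerivAt.comp x ((contMDiffAt_extChartAt_symm_target u hx).mdifferentiableAt
    (by simp)).hasMFDerivAt).hasFDerivAt

theorem eventually_eq_of_dAt_eq_zero {f : M → ℝ} {m : M}
    (h : ∀ᶠ x in 𝓝 m, MDifferentiableAt 𝓘(ℝ, E) 𝓘(ℝ, ℝ) f x ∧ dAt 𝓘(ℝ, E) f x = 0) :
    ∀ᶠ x in 𝓝 m, f x = f m := by
  set φ := extChartAt 𝓘(ℝ, E) m
  have h0 := continuousAt_extChartAt_symm (I := 𝓘(ℝ, E)) m
  rw [ContinuousAt, φ.left_inv (mem_extChartAt_source m)] at h0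
  obtain ⟨r, hr, hball⟩ := Metric.mem_nhds_iff.1
    (inter_mem (h0.eventually h) (extChartAt_target_mem_nhds (I := 𝓘(ℝ, E)) m))
  have hd : ∀ x ∈ Metric.ball (φ m) r, HasFDerivAt (f ∘ φ.symm) (0 : E →L[ℝ] ℝ) x :=
    fun x hx => by
    have h1 := hasFDerivAt_comp_extChartAt_symm m (hball hx).2 (hball hx).1.1
    refine h1.congr_fderiv ?_
    ext v
    exact LinearMap.congr_fun (hball hx).1.2 _
  have hconst : ∀ x ∈ Metric.ball (φ m) r, (f ∘ φ.symm) x = (f ∘ φ.symm) (φ m) := fun x hx =>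
    Metric.isOpen_ball.is_const_of_fderiv_eq_zero (convex_ball _ _).isPreconnected
      (fun y hy => (hd y hy).differentiableAt.differentiableWithinAt)
      (fun y hy => (hd y hy).fderiv) hx (Metric.mem_ball_self hr)
  have h2 := (continuousAt_extChartAt (I := 𝓘(ℝ, E)) m).eventually (Metric.ball_mem_nhds _ hr)
  filter_upwards [h2, extChartAt_source_mem_nhds (I := 𝓘(ℝ, E)) m] with x hx hx'
  have := hconst _ hx
  rwa [Function.comp_apply, Function.comp_apply, φ.left_inv hx',
    φ.left_inv (mem_extChartAt_source m)] at this

/-- The differential vanishes at a maximum. -/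
theorem dAt_eq_zero_of_isMax {f : M → ℝ} {m : M} (hf : MDifferentiableAt 𝓘(ℝ, E) 𝓘(ℝ, ℝ) f m)
    (hmax : ∀ x, f x ≤ f m) : dAt 𝓘(ℝ, E) f m = 0 := by
  refine LinearMap.ext fun v => ?_
  refine (dAt_apply_eq_fderiv hf v).trans ?_
  have : IsLocalMax (f ∘ (extChartAt 𝓘(ℝ, E) m).symm) (extChartAt 𝓘(ℝ, E) m m) := by
    refine Eventually.of_forall fun x => ?_
    simp only [Function.comp_apply, (extChartAt 𝓘(ℝ, E) m).left_inv (mem_extChartAt_source m)]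
    exact hmax _
  rw [this.fderiv_eq_zero]
  rfl

end LocallyConstant

/-! ### Primitives of closed 1-forms on a Lie group -/

section Primitives

variable {E : Type*} [NormedAddCommGroup E] [NormedSpace ℝ E] [FiniteDimensional ℝ E]
  [CompleteSpace E]
  {Γ : Type*} [TopologicalSpace Γ] [ChartedSpace E Γ] [Group Γ] [LieGroup 𝓘(ℝ, E) ∞ Γ]

theorem dAt_dual_eq_sum {b : Γ → Module.Dual ℝ (GroupLieAlgebra 𝓘(ℝ, E) Γ)} {g : Γ}
    (hb : ∀ ξ, MDifferentiableAt 𝓘(ℝ, E) 𝓘(ℝ, ℝ) (fun g => b g ξ) g) {ι : Type*} [Fintype ι]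
    (e : Module.Basis ι ℝ (GroupLieAlgebra 𝓘(ℝ, E) Γ)) (ξ : GroupLieAlgebra 𝓘(ℝ, E) Γ) :
    dAt 𝓘(ℝ, E) (fun g => b g ξ) g
      = ∑ i, e.repr ξ i • dAt 𝓘(ℝ, E) (fun g => b g (e i)) g := by
  have h1 : (fun g => b g ξ) = fun g => ∑ i, e.repr ξ i * b g (e i) := funext fun g => by
    conv_lhs => rw [← e.sum_repr ξ]
    simp only [map_sum, map_smul, smul_eq_mul]
  rw [h1]
  refine (dAt_sum _ (f := fun i g => e.repr ξ i * b g (e i))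
    fun i _ => mdifferentiableAt_const.mul (hb _)).trans ?_
  refine Finset.sum_congr rfl fun i _ => ?_
  rw [dAt_mul mdifferentiableAt_const (hb _)]
  have h2 : dAt 𝓘(ℝ, E) (fun _ : Γ => e.repr ξ i) g = 0 :=
    congrArg (fun T : E →L[ℝ] ℝ => T.toLinearMap) mfderiv_const
  rw [h2, smul_zero, add_zero]

theorem mfderiv_symm_eq_mulInvariantVectorField (u : Γ) (x w : E) :
    (mfderiv 𝓘(ℝ, E) 𝓘(ℝ, E) (extChartAt 𝓘(ℝ, E) u).symm x : E → E) w
      = mulInvariantVectorField (mcChart (E := E) u x w) ((extChartAt 𝓘(ℝ, E) u).symm x) :=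
  (mulInvariantVectorField_mcForm _ _).symm

/-- A closed 1-form has local primitives. -/
theorem exists_local_primitive {b : Γ → Module.Dual ℝ (GroupLieAlgebra 𝓘(ℝ, E) Γ)}
    (hb : ∀ ξ g, MDifferentiableAt 𝓘(ℝ, E) 𝓘(ℝ, ℝ) (fun g => b g ξ) g)
    (hcl : ∀ (ξ η : GroupLieAlgebra 𝓘(ℝ, E) Γ) (g : Γ),
      dAt 𝓘(ℝ, E) (fun g => b g η) g (mulInvariantVectorField ξ g)
        - dAt 𝓘(ℝ, E) (fun g => b g ξ) g (mulInvariantVectorField η g) = b g ⁅ξ, η⁆) (u : Γ) :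
    ∃ U : Set Γ, IsOpen U ∧ u ∈ U ∧ ∃ P : Γ → ℝ, ∀ g ∈ U,
      MDifferentiableAt 𝓘(ℝ, E) 𝓘(ℝ, ℝ) P g ∧ dAt 𝓘(ℝ, E) P g = leftInvForm (b g) g := by
  set φ := extChartAt 𝓘(ℝ, E) u
  let e := Module.finBasis ℝ E
  let co : Fin (Module.finrank ℝ E) → E →L[ℝ] ℝ := fun i =>
    LinearMap.toContinuousLinearMap (e.coord i)
  let c : Fin (Module.finrank ℝ E) → E → ℝ := fun i x => b (φ.symm x) (e i)
  have hbc : ∀ (x : E) (v : E), ∑ i, c i x * co i v = b (φ.symm x) v := fun x v => by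
    have h : ∀ a : Module.Dual ℝ E, ∑ i, a (e i) * co i v = a v := fun a => by
      conv_rhs => rw [← e.sum_repr v]
      simp only [map_sum, map_smul, smul_eq_mul]
      exact Finset.sum_congr rfl fun i _ => mul_comm _ _
    exact h (b (φ.symm x))
  let D : E → E → E → ℝ := fun x ζ ξ =>
    dAt 𝓘(ℝ, E) (fun g => b g ξ) (φ.symm x) (mulInvariantVectorField ζ (φ.symm x))
  have hD : ∀ x ζ ξ, ∑ i, D x ζ (e i) * co i ξ = D x ζ ξ := fun x ζ ξ => by
    refine Eq.trans ?_ (LinearMap.congr_fun (dAt_dual_eq_sum (fun η => hb η (φ.symm x))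
      (show Module.Basis _ ℝ (GroupLieAlgebra 𝓘(ℝ, E) Γ) from e) ξ) _).symm
    rw [LinearMap.sum_apply]
    exact Finset.sum_congr rfl fun i _ => mul_comm _ _
  -- The 1-form in the chart, expanded in a basis so that only scalar coefficients of `b` have to be
  -- differentiated.
  let θ : E → E →L[ℝ] ℝ := fun x => ∑ i, c i x • (co i ∘L mcChart (E := E) u x)
  have hθ : ∀ x v, θ x v = b (φ.symm x) (mcChart (E := E) u x v) := fun x v => by
    rw [← hbc]
    simp [θ]
  have hc : ∀ x ∈ φ.target, ∀ i, ∃ c' : E →L[ℝ] ℝ, HasFDerivAt (c i) c' x ∧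
      ∀ w, c' w = D x (mcChart (E := E) u x w) (e i) := fun x hx i => by
    refine ⟨_, hasFDerivAt_comp_extChartAt_symm u hx (hb (e i) _), fun w => ?_⟩
    exact congrArg (fun z : E => (mfderiv 𝓘(ℝ, E) 𝓘(ℝ, ℝ) (fun g => b g (e i)) (φ.symm x) :
      E →L[ℝ] ℝ) z) (mfderiv_symm_eq_mulInvariantVectorField u x w)
  have hθd : ∀ x ∈ φ.target, ∃ θ' : E →L[ℝ] E →L[ℝ] ℝ, HasFDerivAt θ θ' x ∧
      ∀ w v, θ' w v = D x (mcChart (E := E) u x w) (mcChart (E := E) u x v)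
        + b (φ.symm x) (fderiv ℝ (mcChart (E := E) u) x w v) := fun x hx => by
    choose c' hc' hc'w using hc x hx
    have hmc := (differentiableAt_mcChart u hx).hasFDerivAt
    refine ⟨_, HasFDerivAt.fun_sum fun i _ => (hc' i).smul
      ((hasFDerivAt_const (co i) x).clm_comp hmc), fun w v => ?_⟩
    rw [← hD, ← hbc, ← Finset.sum_add_distrib, _root_.sum_apply,
      _root_.sum_apply]
    refine Finset.sum_congr rfl fun i _ => ?_
    simp [hc'w]
    ring
  obtain ⟨r, hr, hball⟩ := Metric.mem_nhds_iff.1 (extChartAt_target_mem_nhds (I := 𝓘(ℝ, E)) u)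
  have hd : DifferentiableOn ℝ θ (Metric.ball (φ u) r) := fun x hx => by
    obtain ⟨θ', h, -⟩ := hθd x (hball hx)
    exact h.differentiableAt.differentiableWithinAt
  -- On antisymmetrizing, closedness contributes `b([·, ·])` and the Maurer-Cartan equation
  -- contributes its negative.
  have hsymm : ∀ x ∈ Metric.ball (φ u) r, ∀ w v, fderiv ℝ θ x w v = fderiv ℝ θ x v w :=
      fun x hx w v => by
    obtain ⟨θ', h, h'⟩ := hθd x (hball hx)
    rw [h.fderiv, h', h']
    have h1 := hcl (mcChart (E := E) u x w) (mcChart (E := E) u x v) (φ.symm x)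
    have h2 := congrArg (fun z : E => (b (φ.symm x) : E → ℝ) z)
      (fderiv_mcChart_sub u (hball hx) w v)
    have h3 : (b (φ.symm x) : E → ℝ) (fderiv ℝ (mcChart (E := E) u) x w v
        - fderiv ℝ (mcChart (E := E) u) x v w) = b (φ.symm x)
        (fderiv ℝ (mcChart (E := E) u) x w v)
        - b (φ.symm x) (fderiv ℝ (mcChart (E := E) u) x v w) := map_sub (b (φ.symm x)) _ _
    have h4 : (b (φ.symm x) : E → ℝ) (-modelBracket Γ (mcChart (E := E) u x w)
        (mcChart (E := E) u x v)) = - b (φ.symm x) (Bracket.bracket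
        (L := GroupLieAlgebra 𝓘(ℝ, E) Γ) (M := GroupLieAlgebra 𝓘(ℝ, E) Γ)
        (mcChart (E := E) u x w) (mcChart (E := E) u x v)) := map_neg (b (φ.symm x)) _
    have h5 := (h3.symm.trans h2).trans h4
    change D x _ _ - D x _ _ = _ at h1
    linarith
  obtain ⟨f, hf⟩ := (convex_ball (φ u) r).exists_forall_hasFDerivAt_of_fderiv_symmetric
    Metric.isOpen_ball hd hsymm
  refine ⟨φ.source ∩ φ ⁻¹' Metric.ball (φ u) r,
    (continuousOn_extChartAt u).isOpen_inter_preimage (isOpen_extChartAt_source u)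
      Metric.isOpen_ball, ⟨mem_extChartAt_source u, Metric.mem_ball_self hr⟩, f ∘ φ,
    fun g ⟨hg, hg'⟩ => ?_⟩
  have h1 := (hf _ hg').hasMFDerivAt
  have h2 := mdifferentiableAt_extChartAt' u hg
  refine ⟨h1.mdifferentiableAt.comp g h2, LinearMap.ext fun v => ?_⟩
  have h3 := mfderiv_comp_apply' (f := φ) (g := f) (x := g) rfl h1.mdifferentiableAt h2 v
  refine h3.trans ?_
  rw [h1.mfderiv]
  refine (hθ _ _).trans ?_
  rw [leftInvForm_apply, mcForm_eq_mcChart u hg v]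
  exact congrArg (fun z => b z _) (φ.left_inv hg)

variable [SimplyConnectedSpace Γ]

/-- A closed 1-form on a simply connected group has a primitive. -/
theorem exists_primitive {b : Γ → Module.Dual ℝ (GroupLieAlgebra 𝓘(ℝ, E) Γ)}
    (hb : ∀ ξ g, MDifferentiableAt 𝓘(ℝ, E) 𝓘(ℝ, ℝ) (fun g => b g ξ) g)
    (hcl : ∀ (ξ η : GroupLieAlgebra 𝓘(ℝ, E) Γ) (g : Γ),
      dAt 𝓘(ℝ, E) (fun g => b g η) g (mulInvariantVectorField ξ g)
        - dAt 𝓘(ℝ, E) (fun g => b g ξ) g (mulInvariantVectorField η g) = b g ⁅ξ, η⁆) :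
    ∃ Φ : Γ → ℝ, ∀ g, MDifferentiableAt 𝓘(ℝ, E) 𝓘(ℝ, ℝ) Φ g ∧
      dAt 𝓘(ℝ, E) Φ g = leftInvForm (b g) g := by
  have : LocallyPathConnectedSpace Γ := ChartedSpace.locallyPathConnectedSpace E Γ
  choose U hU hxU P hP using exists_local_primitive hb hcl
  obtain ⟨Φ, hΦ⟩ := exists_glue_of_simplyConnected U hU hxU P fun i j x hx => by
    have h := eventually_eq_of_dAt_eq_zero (f := P i - P j) (m := x) (by
      filter_upwards [((hU i).inter (hU j)).mem_nhds hx] with y hy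
      refine ⟨(hP i y hy.1).1.sub (hP j y hy.2).1, ?_⟩
      rw [dAt_sub (hP i y hy.1).1 (hP j y hy.2).1, (hP i y hy.1).2, (hP j y hy.2).2, sub_self])
    exact h
  refine ⟨Φ, fun g => ?_⟩
  have h1 : Φ =ᶠ[𝓝 g] fun y => P g y + (Φ g - P g g) := by
    filter_upwards [hΦ g] with y hy
    linarith
  have h2 := (hP g g (hxU g)).1
  refine ⟨(h2.add mdifferentiableAt_const).congr_of_eventuallyEq h1, ?_⟩
  rw [dAt_congr h1, ← (hP g g (hxU g)).2]
  have h3 := dAt_add' h2 (mdifferentiableAt_const (c := Φ g - P g g))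
  refine h3.trans ?_
  have h4 : dAt 𝓘(ℝ, E) (fun _ : Γ => Φ g - P g g) g = 0 :=
    congrArg (fun T : E →L[ℝ] ℝ => T.toLinearMap) mfderiv_const
  rw [h4, add_zero]

/-- A closed 1-form on a compact simply connected group vanishes at some point. -/
theorem exists_eq_zero_of_closed [CompactSpace Γ]
    {b : Γ → Module.Dual ℝ (GroupLieAlgebra 𝓘(ℝ, E) Γ)}
    (hb : ∀ ξ g, MDifferentiableAt 𝓘(ℝ, E) 𝓘(ℝ, ℝ) (fun g => b g ξ) g)
    (hcl : ∀ (ξ η : GroupLieAlgebra 𝓘(ℝ, E) Γ) (g : Γ),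
      dAt 𝓘(ℝ, E) (fun g => b g η) g (mulInvariantVectorField ξ g)
        - dAt 𝓘(ℝ, E) (fun g => b g ξ) g (mulInvariantVectorField η g) = b g ⁅ξ, η⁆) :
    ∃ g, b g = 0 := by
  obtain ⟨Φ, hΦ⟩ := exists_primitive hb hcl
  have hc : Continuous Φ := continuous_iff_continuousAt.2 fun g => (hΦ g).1.continuousAt
  obtain ⟨g, -, hg⟩ := isCompact_univ.exists_isMaxOn univ_nonempty hc.continuousOn
  refine ⟨g, LinearMap.ext fun ξ => ?_⟩
  have h1 := dAt_eq_zero_of_isMax (hΦ g).1 fun x => hg (mem_univ x)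
  rw [(hΦ g).2] at h1
  have h2 := LinearMap.congr_fun h1 (mulInvariantVectorField ξ g)
  rwa [leftInvForm_apply, mcForm_mulInvariantVectorField] at h2

end Primitives

/-! ### Uniqueness for linear systems of first order -/

section LinearSystem

variable {E : Type*} [NormedAddCommGroup E] [NormedSpace ℝ E]

/-- Grönwall's inequality on each segment issuing from the centre. -/
theorem eq_zero_on_ball_of_norm_fderiv_le {W : Type*} [NormedAddCommGroup W] [NormedSpace ℝ W]
    {f : E → W} {f' : E → E →L[ℝ] W} {c : E} {r K : ℝ}
    (hf : ∀ x ∈ Metric.ball c r, HasFDerivAt f (f' x) x)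
    (hK : ∀ x ∈ Metric.ball c r, ∀ v, ‖f' x v‖ ≤ K * ‖f x‖ * ‖v‖) (hc : f c = 0) :
    ∀ x ∈ Metric.ball c r, f x = 0 := fun x hx => by
  have hseg : ∀ s ∈ Icc (0 : ℝ) 1, c + s • (x - c) ∈ Metric.ball c r := fun s hs =>
    (convex_ball c r).add_smul_sub_mem (Metric.mem_ball_self (Metric.pos_of_mem_ball hx)) hx hs
  have hd : ∀ s ∈ Icc (0 : ℝ) 1, HasDerivAt (fun s : ℝ => f (c + s • (x - c)))
      (f' (c + s • (x - c)) (x - c)) s := fun s hs => by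
    have h1 : HasDerivAt (fun s : ℝ => c + s • (x - c)) (x - c) s := by
      simpa using ((hasDerivAt_id s).smul_const (x - c)).const_add c
    exact (hf _ (hseg s hs)).comp_hasDerivAt s h1
  have h := eq_zero_of_abs_deriv_le_mul_abs_self_of_eq_zero_right (K := K * ‖x - c‖)
    (fun s hs => (hd s hs).continuousAt.continuousWithinAt)
    (fun s hs => (hd s (Ico_subset_Icc_self hs)).hasDerivWithinAt) (by simpa using hc)
    (fun s hs => (hK _ (hseg s (Ico_subset_Icc_self hs)) _).trans_eq (by ring)) 1 (by simp)
  simpa using h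

variable [FiniteDimensional ℝ E] [CompleteSpace E]
  {Γ : Type*} [TopologicalSpace Γ] [ChartedSpace E Γ] [Group Γ] [LieGroup 𝓘(ℝ, E) ∞ Γ]

/-- A solution of a homogeneous linear system of first order on a connected group, that vanishes
at a point, vanishes. -/
theorem eq_zero_of_linear_system [PreconnectedSpace Γ] {ι κ : Type*} [Fintype ι] [Fintype κ]
    (e : Module.Basis κ ℝ (GroupLieAlgebra 𝓘(ℝ, E) Γ)) {y : ι → Γ → ℝ} {C : ι → ι → κ → Γ → ℝ}
    (hy : ∀ j g, MDifferentiableAt 𝓘(ℝ, E) 𝓘(ℝ, ℝ) (y j) g) (hC : ∀ l j k, Continuous (C l j k))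
    (hD : ∀ j k g, dAt 𝓘(ℝ, E) (y j) g (mulInvariantVectorField (e k) g)
      = ∑ l, y l g * C l j k g) {g₀ : Γ} (h₀ : ∀ j, y j g₀ = 0) (j : ι) (g : Γ) : y j g = 0 := by
  have hyc : ∀ j, Continuous (y j) := fun j => continuous_iff_continuousAt.2 fun g =>
    (hy j g).continuousAt
  -- On a connected group it is enough that the common zero set is closed and open.
  suffices h : {g | ∀ j, y j g = 0} = univ from (h ▸ mem_univ g : g ∈ {g | ∀ j, y j g = 0}) j
  refine IsClopen.eq_univ ⟨?_, isOpen_iff_mem_nhds.2 fun u hu => ?_⟩ ⟨g₀, h₀⟩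
  · simp only [ofPred_forall]
    exact isClosed_iInter fun j => isClosed_eq (hyc j) continuous_const
  set φ := extChartAt 𝓘(ℝ, E) u
  let co : κ → E →L[ℝ] ℝ := fun k =>
    LinearMap.toContinuousLinearMap (show E →ₗ[ℝ] ℝ from e.coord k)
  -- `B j x` bounds the size of the derivative of `y j` in the chart relative to the solution. The
  -- sum `S` is continuous at the centre, so `S (φ u) + 1` serves as a uniform constant on a small
  -- ball.
  let B : ι → E → ℝ := fun j x => ∑ k, ∑ l, |C l j k (φ.symm x)| * (‖co k‖ * ‖mcChart (E := E) u x‖)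
  let S : E → ℝ := fun x => ∑ j, B j x
  have hB0 : ∀ j x, 0 ≤ B j x := fun j x => by positivity
  have hSc : ContinuousAt S (φ u) := by
    have h1 := continuousAt_extChartAt_symm (I := 𝓘(ℝ, E)) u
    have h2 := (differentiableAt_mcChart (E := E) u (mem_extChartAt_target u)).continuousAt
    refine tendsto_finsetSum _ fun j _ => tendsto_finsetSum _ fun k _ =>
      tendsto_finsetSum _ fun l _ => ?_
    exact (((hC l j k).continuousAt.comp h1).abs).mul (continuousAt_const.mul h2.norm)
  have hS : ∀ᶠ x in 𝓝 (φ u), S x < S (φ u) + 1 :=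
    hSc.eventually (eventually_lt_nhds (lt_add_one _))
  obtain ⟨r, hr, hball⟩ := Metric.mem_nhds_iff.1
    (inter_mem hS (extChartAt_target_mem_nhds (I := 𝓘(ℝ, E)) u))
  let f : E → ι → ℝ := fun x j => y j (φ.symm x)
  let f' : E → E →L[ℝ] ι → ℝ := fun x => ContinuousLinearMap.pi fun j =>
    (mfderiv 𝓘(ℝ, E) 𝓘(ℝ, ℝ) (y j) (φ.symm x) : E →L[ℝ] ℝ) ∘L
      (mfderiv 𝓘(ℝ, E) 𝓘(ℝ, E) φ.symm x : E →L[ℝ] E)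
  have hf : ∀ x ∈ Metric.ball (φ u) r, HasFDerivAt f (f' x) x := fun x hx =>
    hasFDerivAt_pi.2 fun j => hasFDerivAt_comp_extChartAt_symm u (hball hx).2 (hy j _)
  have hf' : ∀ x j v, f' x v j
      = ∑ k, co k (mcChart (E := E) u x v) * ∑ l, f x l * C l j k (φ.symm x) := fun x j v => by
    let T : Module.Dual ℝ (GroupLieAlgebra 𝓘(ℝ, E) Γ) := LinearMap.comp
      (M₂ := TangentSpace 𝓘(ℝ, E) (φ.symm x * 1))
      (show Module.Dual ℝ E from dAt 𝓘(ℝ, E) (y j) (φ.symm x))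
      (mfderiv 𝓘(ℝ, E) 𝓘(ℝ, E) (fun k : Γ => φ.symm x * k) 1).toLinearMap
    have h1 : f' x v j = T (mcChart (E := E) u x v) :=
      congrArg (fun z : E => (mfderiv 𝓘(ℝ, E) 𝓘(ℝ, ℝ) (y j) (φ.symm x) : E →L[ℝ] ℝ) z)
        (mfderiv_symm_eq_mulInvariantVectorField u x v)
    have h2 : ∀ ζ : GroupLieAlgebra 𝓘(ℝ, E) Γ, T ζ = ∑ k, e.coord k ζ * T (e k) := fun ζ => by
      conv_lhs => rw [← e.sum_repr ζ]
      simp only [map_sum, map_smul, smul_eq_mul]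
      rfl
    refine (h1.trans (h2 _)).trans ?_
    exact Finset.sum_congr rfl fun k _ => congrArg₂ (· * ·) rfl (hD j k (φ.symm x))
  have hle : ∀ x ∈ Metric.ball (φ u) r, ∀ v, ‖f' x v‖ ≤ (S (φ u) + 1) * ‖f x‖ * ‖v‖ := by
    intro x hx v
    have hSx : ∀ j, B j x ≤ S (φ u) + 1 := fun j =>
      (Finset.single_le_sum (f := fun j => B j x) (fun j _ => hB0 j x) (Finset.mem_univ j)).trans
        (hball hx).1.le
    have hS0 : 0 ≤ S (φ u) + 1 :=
      add_nonneg (Finset.sum_nonneg fun j _ => hB0 j _) zero_le_one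
    refine (pi_norm_le_iff_of_nonneg (by positivity)).2 fun j => ?_
    have h1 : ‖f' x v j‖ ≤ B j x * ‖f x‖ * ‖v‖ := by
      rw [hf', Finset.sum_mul, Finset.sum_mul]
      refine (norm_sum_le _ _).trans (Finset.sum_le_sum fun k _ => ?_)
      rw [Finset.mul_sum, Finset.sum_mul, Finset.sum_mul]
      refine (norm_sum_le _ _).trans (Finset.sum_le_sum fun l _ => ?_)
      have h2 : ‖co k (mcChart (E := E) u x v)‖ ≤ ‖co k‖ * (‖mcChart (E := E) u x‖ * ‖v‖) :=
        ((co k).le_opNorm _).trans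
          (mul_le_mul_of_nonneg_left ((mcChart (E := E) u x).le_opNorm v) (norm_nonneg _))
      rw [norm_mul, norm_mul, Real.norm_eq_abs (C l j k _)]
      calc _ ≤ (‖co k‖ * (‖mcChart (E := E) u x‖ * ‖v‖)) * (‖f x‖ * |C l j k (φ.symm x)|) :=
            mul_le_mul h2 (mul_le_mul_of_nonneg_right (norm_le_pi_norm (f x) l) (abs_nonneg _))
              (by positivity) (by positivity)
        _ = _ := by ring
    refine h1.trans ?_
    gcongr
    exact hSx j
  have hφu : φ.symm (φ u) = u := φ.left_inv (mem_extChartAt_source u)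
  have hz := eq_zero_on_ball_of_norm_fderiv_le hf hle
    (funext fun j => (congrArg (y j) hφu).trans (hu j))
  have h3 := (continuousAt_extChartAt (I := 𝓘(ℝ, E)) u).eventually (Metric.ball_mem_nhds _ hr)
  filter_upwards [h3, extChartAt_source_mem_nhds (I := 𝓘(ℝ, E)) u] with g hg hg' j
  exact (congrArg (y j) (φ.left_inv hg')).symm.trans (congrFun (hz _ hg) j)

end LinearSystem

/-! ### Infinitesimal deformations for compact groups -/

section Compact

variable {E G : Type*} [NormedAddCommGroup E] [NormedSpace ℝ E] [FiniteDimensional ℝ E]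
  [CompleteSpace E]
  [TopologicalSpace G] [ChartedSpace E G] [Group G] [LieGroup 𝓘(ℝ, E) ∞ G]

/-- Obtained by differentiating `k * k⁻¹ = 1`. -/
theorem mfderiv_inv_one (w : GroupLieAlgebra 𝓘(ℝ, E) G) :
    (mfderiv 𝓘(ℝ, E) 𝓘(ℝ, E) (fun k : G => k⁻¹) 1 : E → E) w = - (w : E) := by
  have hinv : MDifferentiableAt 𝓘(ℝ, E) 𝓘(ℝ, E) (fun k : G => k⁻¹) 1 :=
    (contMDiff_inv 𝓘(ℝ, E) ∞).mdifferentiableAt (by simp)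
  have hmul : MDifferentiableAt (𝓘(ℝ, E).prod 𝓘(ℝ, E)) 𝓘(ℝ, E) (fun q : G × G => q.1 * q.2)
      ((1 : G), (1 : G)⁻¹) := (contMDiff_mul 𝓘(ℝ, E) ∞).mdifferentiableAt (by simp)
  have hpr := mdifferentiableAt_id (I := 𝓘(ℝ, E)) (x := (1 : G)).prodMk hinv
  have h1 : (mfderiv 𝓘(ℝ, E) 𝓘(ℝ, E) (fun k : G => k * k⁻¹) 1 : E → E) w = 0 := by
    rw [show (fun k : G => k * k⁻¹) = fun _ => 1 from funext fun k => mul_inv_cancel k, mfderiv_const]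
    rfl
  have h2 := congrArg (fun T : E →L[ℝ] E => T w) (mfderiv_comp (1 : G) hmul hpr)
  have h3 := mfderiv_prod_eq_add_apply (v := mfderiv 𝓘(ℝ, E) (𝓘(ℝ, E).prod 𝓘(ℝ, E))
    (fun k : G => (id k, k⁻¹)) 1 w) hmul
  have h4 := congrArg (fun T : E →L[ℝ] E × E => T w) (mfderiv_prodMk mdifferentiableAt_id hinv)
  have h5 : (mfderiv 𝓘(ℝ, E) 𝓘(ℝ, E) (fun z : G => z * (1 : G)⁻¹) 1 : E → E) w = w := by
    rw [show (fun z : G => z * (1 : G)⁻¹) = id from funext fun k => by simp]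
    exact mfderiv_id_apply' _ _
  have h6 : ∀ k : G, ∀ z : E, k = 1 →
      (mfderiv 𝓘(ℝ, E) 𝓘(ℝ, E) (fun z : G => (1 : G) * z) k : E → E) z = z := by
    rintro k z rfl
    rw [show (fun z : G => (1 : G) * z) = id from funext fun k => by simp]
    exact mfderiv_id_apply' _ _
  set D : E := (mfderiv 𝓘(ℝ, E) 𝓘(ℝ, E) (fun k : G => k⁻¹) 1 : E → E) w
  have h7 : (mfderiv 𝓘(ℝ, E) (𝓘(ℝ, E).prod 𝓘(ℝ, E)) (fun k : G => (id k, k⁻¹)) 1 : E → E × E) w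
      = (w, D) := h4.trans (Prod.ext (mfderiv_id_apply' _ _) rfl)
  have h8 : (0 : E) = (show E from w) + D := by
    refine (h1.symm.trans (h2.trans h3)).trans (congrArg₂ (fun a b : E => a + b) ?_ ?_)
    · exact (congrArg (fun z : E × E => (mfderiv 𝓘(ℝ, E) 𝓘(ℝ, E)
        (fun z : G => z * (1 : G)⁻¹) 1 : E → E) z.1) h7).trans h5
    · exact (h6 _ _ inv_one).trans (congrArg Prod.snd h7)
  exact eq_neg_of_add_eq_zero_right h8.symm

variable {V M : Type*} [NormedAddCommGroup V] [NormedSpace ℝ V] [FiniteDimensional ℝ V]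
  [TopologicalSpace M] [ChartedSpace V M] [IsManifold 𝓘(ℝ, V) ∞ M] [T2Space M]
  {F Gs : Type*} [NormedAddCommGroup F] [NormedSpace ℝ F] [FiniteDimensional ℝ F] [CompleteSpace F]
  [TopologicalSpace Gs] [ChartedSpace F Gs] [Group Gs] [LieGroup 𝓘(ℝ, F) ∞ Gs] [T2Space Gs]
  [MulAction G M]

/-- The derivative of the orbit map `g ↦ g⁻¹ • m` along a left-invariant vector field. -/
theorem mfderiv_inv_smul
    (hact : ContMDiff (𝓘(ℝ, E).prod 𝓘(ℝ, V)) 𝓘(ℝ, V) ∞ (fun q : G × M => q.1 • q.2)) (m : M) (g : G)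
    (ξ : GroupLieAlgebra 𝓘(ℝ, E) G) :
    (mfderiv 𝓘(ℝ, E) 𝓘(ℝ, V) (fun g : G => g⁻¹ • m) g : E → V) (mulInvariantVectorField ξ g)
      = infGen 𝓘(ℝ, E) 𝓘(ℝ, V) ξ (g⁻¹ • m) := by
  have hsl : ∀ (m' : M) (k : G), MDifferentiableAt 𝓘(ℝ, E) 𝓘(ℝ, V) (fun g : G => g • m') k :=
    fun m' k => (hact.comp (contMDiff_id.prodMk contMDiff_const)).mdifferentiableAt (by simp)
  have hinv : ∀ k : G, MDifferentiableAt 𝓘(ℝ, E) 𝓘(ℝ, E) (fun k : G => k⁻¹) k := fun k =>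
    (contMDiff_inv 𝓘(ℝ, E) ∞).mdifferentiableAt (by simp)
  have h1 := mfderiv_comp_apply' (f := fun k : G => g * k) (g := fun g : G => g⁻¹ • m) (x := 1)
    (mul_one g) ((hsl m _).comp g (hinv g)) (mdifferentiableAt_mul_left _ _) ξ
  have h2 : (fun g : G => g⁻¹ • m) ∘ (fun k : G => g * k)
      = (fun k : G => k • (g⁻¹ • m)) ∘ fun k : G => k⁻¹ := by
    funext k
    simp [mul_smul]
  rw [h2] at h1
  have h3 := mfderiv_comp_apply' (f := fun k : G => k⁻¹) (g := fun k : G => k • (g⁻¹ • m)) (x := 1)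
    inv_one (hsl _ _) (hinv 1) ξ
  refine h1.symm.trans (h3.trans ?_)
  rw [mfderiv_inv_one]
  exact map_neg (mfderiv 𝓘(ℝ, E) 𝓘(ℝ, V) (fun k : G => k • (g⁻¹ • m)) 1) _

variable {p : GroupLieAlgebra 𝓘(ℝ, F) Gs ≃ₗ[ℝ] Module.Dual ℝ (GroupLieAlgebra 𝓘(ℝ, E) G)}
  {π : BivectorField 𝓘(ℝ, V) M} {μ : M → Gs}

/-- The right side is linear in `Y m`: the bracket identity determines the derivatives of `Y` along
orbits from its values. -/
theorem lieDer_evalMap_eq (hμ : IsMomentumMap π p μ) {Y : M → GroupLieAlgebra 𝓘(ℝ, F) Gs}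
    (hY : BracketIdentity π p Y) (ξ η : GroupLieAlgebra 𝓘(ℝ, E) G) (m : M) :
    lieDer 𝓘(ℝ, E) 𝓘(ℝ, V) ξ (evalMap p Y η) m
      = - momentForm 𝓘(ℝ, V) p μ (coad p (Y m) η) m (infGen 𝓘(ℝ, E) 𝓘(ℝ, V) ξ m) := by
  have h := bracketIdentity_iff.1 hY η m
  rw [hμ.generates ξ, π.sharp_skew, ← hμ.generates, ← neg_eq_iff_eq_neg.2 h, map_neg, π.sharp_skew,
    neg_neg, neg_neg, ← hμ.generates]
  rfl

theorem continuous_momentForm_infGen (hπ : π.IsPoisson) (hμ : IsMomentumMap π p μ)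
    (ζ ξ : GroupLieAlgebra 𝓘(ℝ, E) G) :
    Continuous fun m => momentForm 𝓘(ℝ, V) p μ ζ m (infGen 𝓘(ℝ, E) 𝓘(ℝ, V) ξ m) := by
  refine continuous_iff_continuousAt.2 fun m => ?_
  obtain ⟨n, y, H, hy, hH, hdec, -⟩ := exists_momentForm_eq_sum (p := p) hμ.smooth m
  have h := mdifferentiableAt_pairing hπ (α := momentForm 𝓘(ℝ, V) p μ ξ)
    (β := momentForm 𝓘(ℝ, V) p μ ζ) hy hy (hH ξ) (hH ζ) (hdec.mono fun x hx => hx ξ)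
    (hdec.mono fun x hx => hx ζ)
  simp only [hμ.generates]
  exact h.continuousAt

/-- If `G` is compact and simply connected, then every infinitesimal deformation vanishes: along an
orbit it is a closed 1-form on `G`, whose primitive has a critical point, and by the bracket identity
it solves a homogeneous linear system. -/
theorem infDeformation_eq_zero [SimplyConnectedSpace G] [CompactSpace G] (hπ : π.IsPoisson)
    (hact : ContMDiff (𝓘(ℝ, E).prod 𝓘(ℝ, V)) 𝓘(ℝ, V) ∞ (fun q : G × M => q.1 • q.2))
    (hμ : IsMomentumMap π p μ) (Y : infDeformations π p) : Y.1 = 0 := by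
  funext m
  have hfd : FiniteDimensional ℝ (GroupLieAlgebra 𝓘(ℝ, E) G) :=
    inferInstanceAs (FiniteDimensional ℝ E)
  -- With the inverse, left-invariant fields on `G` are carried to the generators `ξ_M`, whose
  -- definition contains the sign.
  let o : G → M := fun g => g⁻¹ • m
  have ho : ∀ g, MDifferentiableAt 𝓘(ℝ, E) 𝓘(ℝ, V) o g := fun g =>
    (hact.comp ((contMDiff_inv 𝓘(ℝ, E) ∞).prodMk contMDiff_const)).mdifferentiableAt (by simp)
  let b : G → Module.Dual ℝ (GroupLieAlgebra 𝓘(ℝ, E) G) := fun g => p (Y.1 (o g))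
  have hYd : ∀ ξ m, MDifferentiableAt 𝓘(ℝ, V) 𝓘(ℝ, ℝ) (evalMap p Y.1 ξ) m := fun ξ m =>
    (Y.2.1.1.2 ξ).mdifferentiableAt (by simp)
  have hb : ∀ ξ g, MDifferentiableAt 𝓘(ℝ, E) 𝓘(ℝ, ℝ) (fun g => b g ξ) g := fun ξ g =>
    (hYd ξ _).comp g (ho g)
  have hbD : ∀ (ξ η : GroupLieAlgebra 𝓘(ℝ, E) G) (g : G),
      dAt 𝓘(ℝ, E) (fun g => b g η) g (mulInvariantVectorField ξ g)
        = lieDer 𝓘(ℝ, E) 𝓘(ℝ, V) ξ (evalMap p Y.1 η) (o g) := fun ξ η g => by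
    have h := LinearMap.congr_fun (dAt_comp (hYd η (o g)) (ho g)) (mulInvariantVectorField ξ g)
    refine h.trans ?_
    exact congrArg (fun z : V => (mfderiv 𝓘(ℝ, V) 𝓘(ℝ, ℝ) (evalMap p Y.1 η) (o g) : V →L[ℝ] ℝ) z)
      (mfderiv_inv_smul hact m g ξ)
  -- The cocycle identity along the orbit is the closedness of `b`.
  obtain ⟨g₀, hg₀⟩ := exists_eq_zero_of_closed hb fun ξ η g => by
    rw [hbD, hbD]
    exact Y.2.1.2 ξ η (o g)
  let e := Module.finBasis ℝ (GroupLieAlgebra 𝓘(ℝ, E) G)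
  let q := fun l => p.symm (e.coord l)
  have hYq : ∀ m, Y.1 m = ∑ l, p (Y.1 m) (e l) • q l := fun m => by
    apply p.injective
    refine e.ext fun j => ?_
    simp [q]
  let R : M → GroupLieAlgebra 𝓘(ℝ, E) G → GroupLieAlgebra 𝓘(ℝ, E) G → ℝ := fun m ζ ξ =>
    momentForm 𝓘(ℝ, V) p μ ζ m (infGen 𝓘(ℝ, E) 𝓘(ℝ, V) ξ m)
  -- Expanding `Y` in the basis dual to `e` separates the unknowns from the coefficients of the
  -- linear system.
  have hR : ∀ m ξ η, R m (coad p (Y.1 m) η) ξ = ∑ l, p (Y.1 m) (e l) * R m (coad p (q l) η) ξ :=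
      fun m ξ η => by
    let T : GroupLieAlgebra 𝓘(ℝ, F) Gs →ₗ[ℝ] ℝ :=
      { toFun := fun x => R m (coad p x η) ξ
        map_add' := fun x x' => by
          simp only [R, momentForm_apply, coad_add, map_add]
        map_smul' := fun r x => by
          simp only [R, momentForm_apply, coad_smul, map_smul, RingHom.id_apply] }
    have h := congrArg T (hYq m)
    rw [map_sum] at h
    refine h.trans (Finset.sum_congr rfl fun l _ => ?_)
    rw [map_smul]
    rfl
  have hz := eq_zero_of_linear_system e (y := fun j g => b g (e j))
    (C := fun l j k g => - R (o g) (coad p (q l) (e j)) (e k)) (fun j g => hb (e j) g)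
    (fun l j k => ((continuous_momentForm_infGen hπ hμ _ _).comp
      (continuous_iff_continuousAt.2 fun g => (ho g).continuousAt)).neg)
    (fun j k g => by
      rw [hbD, lieDer_evalMap_eq hμ Y.2.2]
      refine (congrArg Neg.neg (hR (o g) (e k) (e j))).trans ?_
      simp only [mul_neg, Finset.sum_neg_distrib]
      rfl) (g₀ := g₀) (fun j => by rw [hg₀]; rfl)
  apply p.injective
  refine e.ext fun j => ?_
  -- The orbit map takes the identity of `G` to `m`.
  have h := hz j 1
  simp only [b, o, inv_one, one_smul] at h
  rw [h]
  simp

theorem isHamiltonianTrivial_of_compact [SimplyConnectedSpace G] [CompactSpace G] (hπ : π.IsPoisson)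
    (hact : ContMDiff (𝓘(ℝ, E).prod 𝓘(ℝ, V)) 𝓘(ℝ, V) ∞ (fun q : G × M => q.1 • q.2))
    (hμ : IsMomentumMap π p μ) (Y : infDeformations π p) : IsHamiltonianTrivial π p μ Y.1 := by
  have hY : Y = 0 := Subtype.ext (infDeformation_eq_zero hπ hact hμ Y)
  rw [← infClass_eq_zero_iff hπ hμ, hY, map_zero]

end Compact

end PoissonLie

end

/-! ### Assembly of the four assertions. -/

theorem mainTheorem3
    {EM : Type*} [NormedAddCommGroup EM] [NormedSpace ℝ EM] [FiniteDimensional ℝ EM]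
    {M : Type*} [TopologicalSpace M] [ChartedSpace EM M] [IsManifold 𝓘(ℝ, EM) ∞ M]
    [T2Space M] [SecondCountableTopology M]
    {EG : Type*} [NormedAddCommGroup EG] [NormedSpace ℝ EG] [FiniteDimensional ℝ EG]
    [CompleteSpace EG]
    {G : Type*} [TopologicalSpace G] [ChartedSpace EG G] [Group G] [LieGroup 𝓘(ℝ, EG) ∞ G]
    [T2Space G] [SimplyConnectedSpace G]
    {ES : Type*} [NormedAddCommGroup ES] [NormedSpace ℝ ES] [FiniteDimensional ℝ ES]
    [CompleteSpace ES]
    {Gs : Type*} [TopologicalSpace Gs] [ChartedSpace ES Gs] [Group Gs] [LieGroup 𝓘(ℝ, ES) ∞ Gs]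
    [T2Space Gs] [SimplyConnectedSpace Gs]
    (πG : BivectorField 𝓘(ℝ, EG) G) (hπG : IsPoissonLieGroup πG)
    (πGs : BivectorField 𝓘(ℝ, ES) Gs) (hπGs : IsPoissonLieGroup πGs)
    (p : GroupLieAlgebra 𝓘(ℝ, ES) Gs ≃ₗ[ℝ] Module.Dual ℝ (GroupLieAlgebra 𝓘(ℝ, EG) G))
    (hdual : IsDualPair πG πGs p)
    (π : BivectorField 𝓘(ℝ, EM) M) (hπ : π.IsPoisson)
    [MulAction G M] (haction : IsPoissonAction πG π)
    (ε : ℝ) (hε : 0 < ε) (μ : ℝ → M → Gs)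
    (hμ : ∀ t ∈ Icc (-ε) ε, IsMomentumMap π p (μ t))
    (hpath : ContMDiffOn (𝓘(ℝ, ℝ).prod 𝓘(ℝ, EM)) 𝓘(ℝ, ES) 2
      (fun q : ℝ × M => μ q.1 q.2) (Icc (-ε) ε ×ˢ univ))
    (X : M → GroupLieAlgebra 𝓘(ℝ, ES) Gs) (hX : IsSmoothMap 𝓘(ℝ, EM) p X)
    (hXμ : ∀ m : M, EqToFirstOrder 𝓘(ℝ, ES) (fun t => μ t m)
      (fun t => μ 0 m * lieExp (t • X m))) :
    BracketIdentity π p X ∧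
    ((∀ t ∈ Icc (-ε) ε, IsPoissonMap π πGs (μ t)) →
      (∀ (ξ η : GroupLieAlgebra 𝓘(ℝ, EG) G) (m : M),
        lieDer 𝓘(ℝ, EG) 𝓘(ℝ, EM) ξ (evalMap p X η) m
          - lieDer 𝓘(ℝ, EG) 𝓘(ℝ, EM) η (evalMap p X ξ) m = evalMap p X ⁅ξ, η⁆ m) ∧
      X ∈ infDeformations π p) ∧
    (∀ Y : infDeformations π p,
      infClass π p Y = 0 ↔ IsHamiltonianTrivial π p (μ 0) Y.1) ∧
    (CompactSpace G → LieAlgebra.IsSemisimple ℝ (GroupLieAlgebra 𝓘(ℝ, EG) G) →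
      ∀ Y : infDeformations π p, IsHamiltonianTrivial π p (μ 0) Y.1) := by
  have hsub : ∀ᶠ t in 𝓝 (0 : ℝ), t ∈ Icc (-ε) ε := Icc_mem_nhds (neg_lt_zero.2 hε) hε
  have hμ0 : IsMomentumMap π p (μ 0) := hμ 0 hsub.self_of_nhds
  -- `t = 0` is interior to the interval, so regularity on the closed strip is regularity at the
  -- points `(0, m)`.
  have hpath' : ∀ m, ContMDiffAt (𝓘(ℝ, ℝ).prod 𝓘(ℝ, EM)) 𝓘(ℝ, ES) 2
      (fun q : ℝ × M => μ q.1 q.2) (0, m) := fun m =>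
    hpath.contMDiffAt (prod_mem_nhds hsub univ_mem)
  have hbr : BracketIdentity π p X :=
    bracketIdentity_iff.2 (sharp_dAt_evalMap (hsub.mono hμ) hpath' hXμ)
  refine ⟨hbr, fun hP => ?_, fun Y => infClass_eq_zero_iff hπ hμ0 Y, fun _ _ Y =>
    isHamiltonianTrivial_of_compact hπ haction.1 hμ0 Y⟩
  have hco := lieDer_evalMap_sub hπGs hdual (hsub.mono fun t ht => ⟨hμ t ht, hP t ht⟩) hpath' hXμ
  refine ⟨hco, ⟨⟨⟨fun ξ η => ?_, fun r ξ => ?_⟩, hX⟩, hco⟩, hbr⟩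
  · exact funext fun m => map_add (p (X m)) ξ η
  · exact funext fun m => map_smul (p (X m)) r ξ
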